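/- Let $p,q\ge 1$ be integers and let $B_{p+q}$ be the group of signed permutations, i.e. permutations $\sigma$ of $\{\pm1,\dots,\pm(p+q)\}$ with $\sigma(-i)=-\sigma(i)$. Write $[a_1\,\dots\,a_k]=(a_1\,\dots\,a_k\,{-a_1}\,\dots\,{-a_k})$ (a zero cycle) and $((a_1\,\dots\,a_k))=(a_1\,\dots\,a_k)({-a_1}\,\dots\,{-a_k})$ (a paired nonzero cycle). The type $B$ transpositions are $[i]$ and $((i\,j))$ with $|i|\ne|j|$; $\ell(\pi)$ is the least $k$ such that $\pi$ is a product of $k$ type $B$ transpositions, and $\pi\le\sigma$ means $\ell(\sigma)=\ell(\pi)+\ell(\pi^{-1}\sigma)$. Let $\epsilon$ be the identity, $\gamma_p=[1\,\dots\,p]$, $\gamma_q=[p+1\,\dots\,p+q]$, $\gamma_{p,q}=\gamma_p\gamma_q$, and let $S^B_{nc}(p,q)=[\epsilon,\gamma_{p,q}]$ in the order $\le$ on $B_{p+q}$. A paired nonzero cycle $((a_1\,\dots\,a_k))$ is connected if $\{a_1,\dots,a_k\}$ meets both $\{\pm1,\dots,\pm p\}$ and $\{\pm(p+1),\dots,\pm(p+q)\}$.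 The connectivity of $\sigma$ is the number of its connected paired nonzero cycles. A maximal chain of $S^B_{nc}(p,q)$ is disconnected if each of its elements has connectivity zero, and connected otherwise. For a chain $C=\{\pi_0<\pi_1<\dots<\pi_n\}$ put $\varphi(C)=(\pi_0^{-1}\pi_1,\dots,\pi_{n-1}^{-1}\pi_n)$. Then: (a) the number of disconnected maximal chains of $S^B_{nc}(p,q)$ is $\binom{p+q}{q}p^pq^q$; (b) the disconnected maximal chains of $S^B_{nc}(p,q)$ are exactly the sets $\{\pi_0,\pi_1,\dots,\pi_n\}$ with $\pi_i=\tau_1\tau_2\cdots\tau_i$ (so $\pi_0=\epsilon$), where $(\tau_1,\dots,\tau_n)$ is a shuffle of $\varphi(C_1)$ and $\varphi(C_2)$ for some maximal chain $C_1$ of $[\epsilon,\gamma_p]$ and some maximal chain $C_2$ of $[\epsilon,\gamma_q]$ (these intervals of $B_{p+q}$ are isomorphic to the type $B$ noncrossing partition lattices of sizes $p$ and $q$); (c) the number of connected maximal chains of $S^B_{nc}(p,q)$ is $\sum_{c=1}^{p}2c\binom{p+q}{p-c}p^{p-c}q^{q+c}$. -/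

import Mathlib

open Equiv

namespace AnnularB

/-- The set `± α` of signed elements: `(a, 1)` stands for `a` and `(a, -1)` for `-a`. -/
abbrev Signed (α : Type*) := α × ℤˣ

/-- The sign change `x ↦ -x` on `± α`. -/
def neg {α : Type*} (x : Signed α) : Signed α := (x.1, -x.2)

/-- The signed permutations of `± α`, i.e. the permutations with `σ (-x) = - σ x`
(for `α` of size `n` this is the hyperoctahedral group `B_n`). -/
def signedPerms (α : Type*) : Set (Perm (Signed α)) :=
  {σ | ∀ x, σ (neg x) = neg (σ x)}

section Cycles

variable {α : Type*} [DecidableEq α]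

/-- The zero cycle `[a₁ … a_k] = (a₁ … a_k -a₁ … -a_k)`. -/
def zeroCycle (l : List (Signed α)) : Perm (Signed α) :=
  (l ++ l.map neg).formPerm

/-- The paired nonzero cycle `((a₁ … a_k)) = (a₁ … a_k)(-a₁ … -a_k)`. -/
def pairedCycle (l : List (Signed α)) : Perm (Signed α) :=
  l.formPerm * (l.map neg).formPerm

/-- Type `B` transpositions: `[i]`, and `((i j))` with `|i| ≠ |j|`. -/
def IsTransposition (t : Perm (Signed α)) : Prop :=
  (∃ i, t = zeroCycle [i]) ∨ ∃ i j : Signed α, i.1 ≠ j.1 ∧ t = pairedCycle [i, j]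

/-- Absolute length: the least `k` such that `σ` is a product of `k` type `B` transpositions. -/
noncomputable def absLength (σ : Perm (Signed α)) : ℕ :=
  sInf {k | ∃ l : List (Perm (Signed α)),
    l.length = k ∧ (∀ t ∈ l, IsTransposition t) ∧ l.prod = σ}

/-- The absolute order. -/
def AbsLE (π σ : Perm (Signed α)) : Prop :=
  absLength σ = absLength π + absLength (π⁻¹ * σ)

/-- The interval `[ε, γ]` of the absolute order on signed permutations. -/
def intervalBelow (γ : Perm (Signed α)) : Set (Perm (Signed α)) :=
  {σ | σ ∈ signedPerms α ∧ AbsLE 1 σ ∧ AbsLE σ γ}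

/-- The maximal chains (as sets) of the interval `[ε, γ]`. -/
def maximalChains (γ : Perm (Signed α)) : Set (Set (Perm (Signed α))) :=
  {C | Maximal (fun D => D ⊆ intervalBelow γ ∧ IsChain AbsLE D) C}

/-- `IsFactorization C τ` says that `C = {π₀ < π₁ < ⋯ < π_n}` and that `τ` is the sequence
`φ(C) = (π₀⁻¹ π₁, π₁⁻¹ π₂, …, π_{n-1}⁻¹ π_n)`. -/
def IsFactorization (C : Set (Perm (Signed α))) (τ : List (Perm (Signed α))) : Prop :=
  ∃ l : List (Perm (Signed α)), l.Pairwise (fun π σ => AbsLE π σ ∧ π ≠ σ) ∧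
    C = {π | π ∈ l} ∧ τ = List.zipWith (fun π σ => π⁻¹ * σ) l l.tail

end Cycles

/-- `IsShuffle l m r` says that `r` is a shuffle (an interleaving) of `l` and `m`. -/
inductive IsShuffle {β : Type*} : List β → List β → List β → Prop
  | nil : IsShuffle [] [] []
  | left (a : β) {l m r : List β} : IsShuffle l m r → IsShuffle (a :: l) m (a :: r)
  | right (a : β) {l m r : List β} : IsShuffle l m r → IsShuffle l (a :: m) (a :: r)

/-- The set `{π₀, π₁, …, π_n}` of partial products `π_i = τ₁ τ₂ ⋯ τ_i` of a sequence. -/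
def partialProducts {G : Type*} [Monoid G] (τ : List G) : Set G :=
  {π | ∃ i ≤ τ.length, π = (τ.take i).prod}

/-- The index set `{1, …, p + q}` of the annulus: `Sum.inl i` is the number `i + 1` (outer circle),
`Sum.inr j` is the number `p + j + 1` (inner circle). -/
abbrev Ann (p q : ℕ) := Fin p ⊕ Fin q

/-- `γ_p = [1 2 … p]`, as a signed permutation of `{±1, …, ±(p+q)}`. -/
def gammaOuter (p q : ℕ) : Perm (Signed (Ann p q)) :=
  zeroCycle ((List.finRange p).map fun i => (Sum.inl i, 1))

/-- `γ_q = [p+1 p+2 … p+q]`, as a signed permutation of `{±1, …, ±(p+q)}`. -/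
def gammaInner (p q : ℕ) : Perm (Signed (Ann p q)) :=
  zeroCycle ((List.finRange q).map fun j => (Sum.inr j, 1))

/-- `γ_{p,q} = [1 … p][p+1 … p+q]`. The interval `[ε, γ_{p,q}]` is the poset of annular
noncrossing permutations of type `B`. -/
def gamma (p q : ℕ) : Perm (Signed (Ann p q)) :=
  gammaOuter p q * gammaInner p q

/-- The connected paired nonzero cycles of a signed permutation `σ`. A paired nonzero cycle
`((a₁ … a_k))` of `σ` is recorded as the unordered pair of the orbits `{a₁, …, a_k}` and
`{-a₁, …, -a_k}`; a cycle through `x` is nonzero if it does not contain `-x`. -/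
def connectedCycles {p q : ℕ} (σ : Perm (Signed (Ann p q))) :
    Set (Sym2 (Set (Signed (Ann p q)))) :=
  {c | ∃ x, ¬ σ.SameCycle x (neg x) ∧
    (∃ i s, σ.SameCycle x (Sum.inl i, s)) ∧ (∃ j s, σ.SameCycle x (Sum.inr j, s)) ∧
    c = s({y | σ.SameCycle x y}, {y | σ.SameCycle (neg x) y})}

/-- The connectivity of `σ`: its number of connected paired nonzero cycles. -/
noncomputable def connectivity {p q : ℕ} (σ : Perm (Signed (Ann p q))) : ℕ :=
  (connectedCycles σ).ncard

/-- The disconnected maximal chains of `[ε, γ_{p,q}]`: every element has connectivity zero. -/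
def disconnectedMaximalChains (p q : ℕ) : Set (Set (Perm (Signed (Ann p q)))) :=
  {C | C ∈ maximalChains (gamma p q) ∧ ∀ π ∈ C, connectivity π = 0}

/-- The connected maximal chains of `[ε, γ_{p,q}]`: those that are not disconnected. -/
def connectedMaximalChains (p q : ℕ) : Set (Set (Perm (Signed (Ann p q)))) :=
  {C | C ∈ maximalChains (gamma p q) ∧ ¬ ∀ π ∈ C, connectivity π = 0}

end AnnularB

set_option linter.unusedSectionVars false

namespace AnnularB

/-! Maximal chains of an interval [ε, γ] correspond to factorizations of γ into the least possible
number of transpositions, by taking partial products (`maximalChains_eq_image`,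
`partialProducts_injOn`), so the task is to count such factorizations of γ_{p,q}.

A signed permutation is a permutation π of the underlying set together with a sign function s. The
orbits of π with sign product −1 are the zero cycles, the others the paired nonzero cycles. The
length is additive over orbits: k for a zero cycle of size k, k − 1 for a nonzero one
(`absLength_toPerm`). Hence a transposition lowers the length exactly when it splits a nonzero cycle
into two nonzero ones, splits a zero cycle, makes a zero cycle nonzero, or merges two zero cycles
into a nonzero one.

Factorizations are counted by induction, removing the last factor. If zero cycles never merge, r
factors give r! times a product of weights, k^(k−1)/k! for a nonzero cycle and k^k/k! for a zero
cycle (`numFactorizations_of_atMostOneZero`); the convolution identities behind this come from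
Abel's identity. If every factor has to respect the two circles, γ_{p,q} falls under this case,
which gives (a). If all transpositions are allowed, the two zero cycles can merge, and the product
of their weights is increased by `annularWeight p q` (`numFactorizations_of_two_zero`). The sum that
defines this weight satisfies the recursion the induction demands (`annularWeight_recursion`), and
(c) is the difference of the two counts.

A chain is disconnected exactly when no factor crosses between the circles (`disconnected_iff`). The
first crossing factor merges an outer orbit with an inner one. The result cannot be a zero cycle,
because a zero cycle of an element below γ lies in a zero cycle of γ (`zero_of_ascending`); so it is
a connected nonzero cycle. Factors on different circles commute, which yields the shuffles of (b)
(`mem_sideFactorizations_iff`). -/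

/-- The polynomial `(x + m) ^ m / m!`. -/
def abelTerm (m : ℕ) (x : ℚ) : ℚ := (x + m) ^ m / m.factorial

/-- The weight `k ^ (k - 1) / k!` of a paired nonzero cycle of size `k`. -/
def treeWeight (k : ℕ) : ℚ := (k : ℚ) ^ (k - 1) / k.factorial

/-- The weight `k ^ k / k!` of a zero cycle of size `k`. -/
def zeroWeight (k : ℕ) : ℚ := (k : ℚ) ^ k / k.factorial

/-! ### Abel's identity -/

section AbelIdentity
open Polynomial

/-- The (N + 1)-st finite difference of x^N vanishes. The term m = N + 1 can be left out because it
contains 0^N with N > 0. -/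
theorem sum_neg_one_pow_choose_mul_pow {N : ℕ} (hN : 0 < N) :
    ∑ m ∈ Finset.range (N + 1), (-1 : ℚ) ^ m * (N + 1).choose m * ((N : ℚ) + 1 - m) ^ N = 0 := by
  have h := congrFun (fwdDiff_iter_pow_eq_zero_of_lt (R := ℚ) (Nat.lt_succ_self N)) 0
  rw [fwdDiff_iter_eq_sum_shift, Finset.sum_range_succ'] at h
  rw [← Finset.sum_range_reflect]
  simp only [Pi.zero_apply] at h
  rw [← h]
  simp only [zero_nsmul, add_zero, ne_eq, hN.ne', not_false_eq_true, zero_pow, smul_zero]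
  refine Finset.sum_congr rfl fun m hm => ?_
  have hm' : m ≤ N := by simpa [Nat.lt_succ_iff] using hm
  obtain ⟨k, rfl⟩ := Nat.exists_eq_add_of_le hm'
  have e1 : m + k + 1 - 1 - m = k := by omega
  have e2 : m + k + 1 - (m + 1) = k := by omega
  rw [e1, Nat.succ_eq_add_one, e2, Nat.choose_symm_of_eq_add (a := k) (b := m + 1) (by ring)]
  simp only [zsmul_eq_mul, nsmul_eq_mul]
  push_cast
  ring

theorem derivative_inv_factorial_mul_pow (n : ℕ) (r : ℚ) :
    derivative (C (((n + 1).factorial : ℚ)⁻¹) * (X + C r) ^ (n + 1)) =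
      C ((n.factorial : ℚ)⁻¹) * (X + C r) ^ n := by
  have : C ((n.factorial : ℚ)⁻¹) =
      (C (((n + 1).factorial : ℚ)⁻¹) * C ((n + 1 : ℕ) : ℚ) : ℚ[X]) := by
    rw [← C_mul, Nat.factorial_succ]; congr 1; push_cast
    have : (n : ℚ) + 1 ≠ 0 := by positivity
    field_simp
  rw [this, derivative_C_mul, derivative_X_add_C_pow, Nat.add_sub_cancel]
  push_cast
  ring

/-- **Abel's identity**. -/
theorem sum_abelTerm_mul_treeWeight (M : ℕ) (x : ℚ) :
    ∑ m ∈ Finset.range M, abelTerm m x * treeWeight (M - m) =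
      M * (x + M) ^ (M - 1) / M.factorial := by
  rcases M with _ | N
  · simp
  let a : ℕ → ℚ[X] := fun m => C ((m.factorial : ℚ)⁻¹) * (X + C (m : ℚ)) ^ m
  -- The difference of the two sides for M = N + 1, as a polynomial in x. By induction its
  -- derivative is a shift of its predecessor, hence zero, and a single value then determines it.
  let P : ℕ → ℚ[X] := fun N => ∑ m ∈ Finset.range (N + 1), a m * C (treeWeight (N + 1 - m)) -
    C ((N.factorial : ℚ)⁻¹) * (X + C ((N : ℚ) + 1)) ^ N
  suffices h : P N = 0 by
    have := congrArg (eval x) h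
    simp only [P, a, eval_sub, eval_finsetSum, eval_mul, eval_C, eval_pow, eval_add, eval_X,
      eval_zero, sub_eq_zero] at this
    rw [Nat.factorial_succ, Nat.add_sub_cancel]
    push_cast
    have h0 : (N.factorial : ℚ) ≠ 0 := by positivity
    have h1 : (N : ℚ) + 1 ≠ 0 := by positivity
    calc _ = _ := Finset.sum_congr rfl fun m _ => by rw [abelTerm, div_eq_inv_mul]
      _ = _ := this
      _ = _ := by field_simp
  have hda : ∀ m, derivative (a (m + 1)) = (a m).comp (X + C 1) := by
    intro m
    simp only [a, derivative_inv_factorial_mul_pow, mul_comp, C_comp, pow_comp, add_comp, X_comp]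
    rw [add_assoc X (C 1), ← C_add, Nat.cast_succ, add_comm (1 : ℚ)]
  induction N with
  | zero => simp [P, a, treeWeight]
  | succ N ih =>
    have hd : derivative (P (N + 1)) = (P N).comp (X + C 1) := by
      simp only [P]
      rw [sub_comp, Polynomial.sum_comp, derivative_sub, derivative_sum, Finset.sum_range_succ',
        derivative_inv_factorial_mul_pow, mul_comp, C_comp, pow_comp, add_comp, X_comp, C_comp]
      congr 1
      · have : derivative (a 0 * C (treeWeight (N + 1 + 1 - 0))) = 0 := by simp [a]
        rw [this, add_zero]
        refine Finset.sum_congr rfl fun m _ => ?_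
        rw [mul_comp, C_comp, derivative_mul, derivative_C, mul_zero, add_zero, hda,
          Nat.add_sub_add_right]
      · rw [add_assoc X (C 1), ← C_add, Nat.cast_succ, add_comm (1 : ℚ)]
    rw [ih, zero_comp] at hd
    obtain ⟨r, hr⟩ : ∃ r, P (N + 1) = C r := ⟨_, eq_C_of_derivative_eq_zero hd⟩
    -- At x = −(N + 2) the right side vanishes and the left side is a multiple of the alternating
    -- sum in `sum_neg_one_pow_choose_mul_pow`.
    have he : eval (-((N : ℚ) + 2)) (P (N + 1)) = 0 := by
      simp only [P, a, eval_sub, eval_finsetSum, eval_mul, eval_C, eval_pow, eval_add, eval_X]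
      push_cast
      rw [show -((N : ℚ) + 2) + (N + 1 + 1) = 0 by ring, zero_pow (by omega), mul_zero, sub_zero]
      have h := sum_neg_one_pow_choose_mul_pow (N := N + 1) N.succ_pos
      have h0 : ((N + 1 + 1).factorial : ℚ)⁻¹ ≠ 0 := by positivity
      rw [← mul_right_inj' h0, mul_zero, Finset.mul_sum] at h
      rw [← h]
      refine Finset.sum_congr rfl fun m hm => ?_
      have hm' : m ≤ N + 1 := by simpa [Nat.lt_succ_iff] using hm
      obtain ⟨k, hk⟩ := Nat.exists_eq_add_of_le hm'
      have hk2 : N + 1 + 1 - m = k + 1 := by omega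
      have hNk : (N : ℚ) = m + k - 1 := by
        rw [eq_sub_iff_add_eq]; exact_mod_cast hk
      rw [treeWeight, hk2, Nat.cast_choose ℚ (by omega : m ≤ N + 1 + 1), hk2, Nat.add_sub_cancel,
        hk, hNk, pow_add]
      push_cast
      have h1 : (m.factorial : ℚ) ≠ 0 := by positivity
      have h2 : ((k + 1).factorial : ℚ) ≠ 0 := by positivity
      have h3 : ((m + k + 1).factorial : ℚ) ≠ 0 := by positivity
      rw [show (-((m : ℚ) + k - 1 + 2) + m) = (-1) * (k + 1) by ring, mul_pow,
        show ((m : ℚ) + k + 1 - m) = k + 1 by ring]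
      field_simp
    rw [hr] at he ⊢
    rw [eval_C] at he
    rw [he, C_0]

end AbelIdentity

/-! ### Convolution identities for the weights of cycles -/

theorem zeroWeight_eq_sum {k : ℕ} (hk : 0 < k) :
    ∑ i ∈ Finset.range k, zeroWeight i * treeWeight (k - i) = zeroWeight k := by
  have h := sum_abelTerm_mul_treeWeight k 0
  simp only [abelTerm, zero_add] at h
  simp only [zeroWeight]
  rw [h, ← pow_succ', Nat.sub_add_cancel hk]

theorem natCast_mul_treeWeight {k : ℕ} (hk : 0 < k) : (k : ℚ) * treeWeight k = zeroWeight k := by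
  rw [treeWeight, zeroWeight, ← mul_div_assoc, ← pow_succ', Nat.sub_add_cancel hk]

theorem zeroWeight_zero : zeroWeight 0 = 1 := by simp [zeroWeight]

theorem treeWeight_one : treeWeight 1 = 1 := by simp [treeWeight]

/-- Abel's identity at x = 0 with the term i = 0 set apart. In the count that term is the step
making a zero cycle nonzero; the others split it into a zero cycle of size i and a nonzero one of
size k − i. -/
theorem sum_zeroWeight_mul_treeWeight {k : ℕ} (hk : 0 < k) :
    treeWeight k + ∑ i ∈ Finset.Ico 1 k, zeroWeight i * treeWeight (k - i) = zeroWeight k := by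
  rw [← zeroWeight_eq_sum hk, Finset.range_eq_Ico, Finset.sum_eq_sum_Ico_succ_bot hk,
    zeroWeight_zero, one_mul, Nat.sub_zero]

/-- Write k = i + (k − i). Since i times the tree weight of i is the zero weight of i, each half is
the sum in `sum_zeroWeight_mul_treeWeight`. In the count the terms are the splittings of a nonzero
cycle. -/
theorem sum_treeWeight_mul_treeWeight {k : ℕ} (hk : 0 < k) :
    (k : ℚ) * ∑ i ∈ Finset.Ico 1 k, treeWeight i * treeWeight (k - i) =
      2 * (k - 1) * treeWeight k := by
  have h1 : ∑ i ∈ Finset.Ico 1 k, (i : ℚ) * (treeWeight i * treeWeight (k - i)) =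
      (k - 1) * treeWeight k := by
    have := sum_zeroWeight_mul_treeWeight hk
    rw [← natCast_mul_treeWeight hk] at this
    rw [sub_mul, one_mul, ← this, add_sub_cancel_left]
    refine Finset.sum_congr rfl fun i hi => ?_
    rw [← natCast_mul_treeWeight (Finset.mem_Ico.1 hi).1, mul_assoc]
  have h2 : ∑ i ∈ Finset.Ico 1 k, ((k - i : ℕ) : ℚ) * (treeWeight i * treeWeight (k - i)) =
      (k - 1) * treeWeight k := by
    rw [← h1]
    refine Finset.sum_bij' (fun i _ => k - i) (fun i _ => k - i) ?_ ?_ ?_ ?_ ?_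
    all_goals intro i hi; rw [Finset.mem_Ico] at hi
    · rw [Finset.mem_Ico]; omega
    · rw [Finset.mem_Ico]; omega
    · omega
    · omega
    · rw [Nat.sub_sub_self hi.2.le]; ring
  have : (2 : ℚ) * (k - 1) * treeWeight k =
      (k - 1) * treeWeight k + (k - 1) * treeWeight k := by ring
  rw [this]
  nth_rw 1 [← h1]
  rw [← h2, ← Finset.sum_add_distrib, Finset.mul_sum]
  refine Finset.sum_congr rfl fun i hi => ?_
  rw [Nat.cast_sub (Finset.mem_Ico.1 hi).2.le]
  ring

/-! ### The annular weight: recursion, symmetry, integer form -/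

/-- The number of connected factorizations of `γ_{p,q}`, divided by `(p + q)!`. -/
def annularWeight (p q : ℕ) : ℚ :=
  ∑ c ∈ Finset.Icc 1 p, 2 * c * (abelTerm (p - c) c * abelTerm (q + c) (-c))

theorem sum_pow_div_factorial_mul (M : ℕ) (x y : ℚ) :
    ∑ m ∈ Finset.range (M + 1), y ^ m / m.factorial * (x ^ (M - m) / (M - m).factorial) =
      (x + y) ^ M / M.factorial := by
  rw [add_comm x y, add_pow, Finset.sum_div]
  refine Finset.sum_congr rfl fun m hm => ?_
  have hm' : m ≤ M := by simpa [Nat.lt_succ_iff] using hm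
  rw [Nat.cast_choose ℚ hm']
  have h1 : (m.factorial : ℚ) ≠ 0 := by positivity
  have h2 : ((M - m).factorial : ℚ) ≠ 0 := by positivity
  have h3 : (M.factorial : ℚ) ≠ 0 := by positivity
  field_simp

theorem sum_mul_pow_div_factorial_mul (M : ℕ) (x y : ℚ) :
    ∑ m ∈ Finset.range (M + 1), m * (y ^ m / m.factorial * (x ^ (M - m) / (M - m).factorial)) =
      M * (y * (x + y) ^ (M - 1)) / M.factorial := by
  rcases M with _ | M
  · simp
  rw [Finset.sum_range_succ', Nat.cast_zero, zero_mul, add_zero, Nat.add_sub_cancel]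
  have := sum_pow_div_factorial_mul M x y
  have h3 : (M.factorial : ℚ) ≠ 0 := by positivity
  have h4 : (M : ℚ) + 1 ≠ 0 := by positivity
  have h5 : ((M + 1 : ℕ) : ℚ) * (y * (x + y) ^ M) / (M + 1).factorial =
      y * ((x + y) ^ M / M.factorial) := by
    rw [Nat.factorial_succ]; push_cast; field_simp
  rw [h5, ← this, Finset.mul_sum]
  refine Finset.sum_congr rfl fun m hm => ?_
  rw [show M + 1 - (m + 1) = M - m by omega, Nat.factorial_succ m, pow_succ]
  have h1 : (m.factorial : ℚ) ≠ 0 := by positivity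
  have h2 : (m : ℚ) + 1 ≠ 0 := by positivity
  push_cast
  field_simp

/-- With c = j + m and M = p − j, the summand is j + m times a term of the binomial expansion of (p
− j)^M / M!. The contributions of j and of m cancel unless M = 0. -/
theorem sum_abelTerm_correction {p j : ℕ} (hjp : j ≤ p) :
    ∑ c ∈ Finset.Icc j p, (c : ℚ) * (abelTerm (p - c) c * abelTerm (c - j) (-c)) =
      if j = p then (p : ℚ) else 0 := by
  obtain ⟨M, rfl⟩ := Nat.exists_eq_add_of_le hjp
  have h1 := sum_pow_div_factorial_mul M (j + M) (-j)
  have h2 := sum_mul_pow_div_factorial_mul M (j + M) (-j)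
  have : ∑ c ∈ Finset.Icc j (j + M), (c : ℚ) * (abelTerm (j + M - c) c * abelTerm (c - j) (-c)) =
      ∑ m ∈ Finset.range (M + 1), ((j : ℚ) + m) * ((-(j : ℚ)) ^ m / m.factorial *
        (((j : ℚ) + M) ^ (M - m) / (M - m).factorial)) := by
    rw [← Finset.Ico_add_one_right_eq_Icc, Finset.sum_Ico_eq_sum_range]
    refine Finset.sum_congr (by congr 1; omega) fun m hm => ?_
    have hm' : m ≤ M := by simp only [Finset.mem_range] at hm; omega
    rw [abelTerm, abelTerm, show j + M - (j + m) = M - m by omega,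
      show j + m - j = m by omega, Nat.cast_sub hm']
    push_cast
    rw [show (j : ℚ) + m + (M - m) = j + M by ring, show -((j : ℚ) + m) + m = -j by ring]
    ring
  rw [this]
  simp only [add_mul, Finset.sum_add_distrib]
  rw [← Finset.mul_sum, h1, h2]
  rcases M with _ | M
  · simp
  · rw [if_neg (by omega)]
    rw [Nat.add_sub_cancel, show (j : ℚ) + ((M + 1 : ℕ) : ℚ) + -j = (M + 1 : ℕ) by ring, pow_succ]
    ring

/-- For fixed c the sum over i is Abel's identity at x = c with M = p − c. -/
theorem sum_annularWeight_left (p q : ℕ) :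
    (p : ℚ) * ∑ i ∈ Finset.Ico 1 p, annularWeight i q * treeWeight (p - i) =
      ∑ c ∈ Finset.Icc 1 p,
        2 * c * (((p : ℚ) - c) * (abelTerm (p - c) c * abelTerm (q + c) (-c))) := by
  have h : ∑ i ∈ Finset.Ico 1 p, annularWeight i q * treeWeight (p - i) =
      ∑ c ∈ Finset.Icc 1 p, ∑ i ∈ Finset.Ico c p,
        2 * c * (abelTerm (i - c) c * abelTerm (q + c) (-c)) * treeWeight (p - i) := by
    simp only [annularWeight, Finset.sum_mul]
    refine Finset.sum_comm' fun i c => ?_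
    simp only [Finset.mem_Ico, Finset.mem_Icc]
    omega
  rw [h, Finset.mul_sum]
  refine Finset.sum_congr rfl fun c hc => ?_
  obtain ⟨hc1, hcp⟩ := Finset.mem_Icc.1 hc
  obtain ⟨M, rfl⟩ := Nat.exists_eq_add_of_le hcp
  rw [Finset.sum_Ico_eq_sum_range, show c + M - c = M by omega]
  have := sum_abelTerm_mul_treeWeight M c
  calc _ = ((c + M : ℕ) : ℚ) * (2 * c * abelTerm (q + c) (-c) *
        ∑ m ∈ Finset.range M, abelTerm m c * treeWeight (M - m)) := by
        congr 1
        rw [Finset.mul_sum]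
        refine Finset.sum_congr rfl fun m _ => ?_
        rw [show c + m - c = m by omega, show c + M - (c + m) = M - m by omega]
        ring
    _ = _ := by
        rw [this, abelTerm, abelTerm]
        rcases M with _ | M
        · simp
        · rw [Nat.add_sub_cancel, pow_succ ((c : ℚ) + _)]; push_cast; ring

/-- For fixed c this is Abel's identity at x = −c with M = q + c, whose range is too long. Its term
m = c vanishes; the terms m < c belong to no `annularWeight p j`, and summed over c they produce the
term with `treeWeight (p + q)`. -/
theorem sum_annularWeight_right {p q : ℕ} (hp : 0 < p) (hq : 0 < q) :
    (q : ℚ) * ∑ j ∈ Finset.Ico 1 q, annularWeight p j * treeWeight (q - j) =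
      ∑ c ∈ Finset.Icc 1 p,
        2 * c * (((q : ℚ) + c) * (abelTerm (p - c) c * abelTerm (q + c) (-c))) -
      2 * p * q * treeWeight (p + q) := by
  -- Put j = c − m and evaluate the sum over c first: by `sum_abelTerm_correction` only j = p
  -- survives.
  have hcorr : ∑ c ∈ Finset.Icc 1 p, (2 : ℚ) * c * (abelTerm (p - c) c *
      ∑ m ∈ Finset.range c, abelTerm m (-c) * treeWeight (q + c - m)) =
      2 * p * treeWeight (p + q) := by
    calc _ = ∑ c ∈ Finset.Icc 1 p, ∑ j ∈ Finset.Icc 1 c, (2 : ℚ) * (treeWeight (q + j) *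
          (c * (abelTerm (p - c) c * abelTerm (c - j) (-c)))) := by
          refine Finset.sum_congr rfl fun c hc => ?_
          rw [Finset.mul_sum, Finset.mul_sum]
          refine Finset.sum_bij' (fun m _ => c - m) (fun j _ => c - j) ?_ ?_ ?_ ?_ ?_
          all_goals intro i hi; simp only [Finset.mem_range, Finset.mem_Icc] at hi ⊢
          · omega
          · omega
          · omega
          · omega
          · rw [show c - (c - i) = i by omega, show q + c - i = q + (c - i) by omega]; ring
      _ = ∑ j ∈ Finset.Icc 1 p, ∑ c ∈ Finset.Icc j p, (2 : ℚ) * (treeWeight (q + j) *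
          (c * (abelTerm (p - c) c * abelTerm (c - j) (-c)))) := by
          refine Finset.sum_comm' fun i c => ?_
          simp only [Finset.mem_Icc]
          omega
      _ = ∑ j ∈ Finset.Icc 1 p, (2 : ℚ) * (treeWeight (q + j) * if j = p then (p : ℚ) else 0) := by
          refine Finset.sum_congr rfl fun j hj => ?_
          have h2 := (Finset.mem_Icc.1 hj).2
          rw [← sum_abelTerm_correction h2, Finset.mul_sum, Finset.mul_sum]
      _ = _ := by
          rw [Finset.sum_eq_single p]
          · rw [if_pos rfl, add_comm q p]; ring
          · intro j _ hj; simp [hj]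
          · intro h; simp at h; omega
  have key : ∀ c ∈ Finset.Icc 1 p, ∑ j ∈ Finset.Ico 1 q, (q : ℚ) *
      (2 * c * (abelTerm (p - c) c * abelTerm (j + c) (-c)) * treeWeight (q - j)) =
      2 * c * (((q : ℚ) + c) * (abelTerm (p - c) c * abelTerm (q + c) (-c))) - q * (2 * c *
        (abelTerm (p - c) c * ∑ m ∈ Finset.range c, abelTerm m (-c) * treeWeight (q + c - m))) := by
    intro c hc
    obtain ⟨hc1, hcp⟩ := Finset.mem_Icc.1 hc
    have h0 := sum_abelTerm_mul_treeWeight (q + c) (-c)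
    have hz : abelTerm c (-c) = 0 := by
      rw [abelTerm, neg_add_cancel, zero_pow (by omega), zero_div]
    rw [Finset.range_eq_Ico, ← Finset.sum_Ico_consecutive _ (Nat.zero_le c) (by omega : c ≤ q + c),
      Finset.sum_eq_sum_Ico_succ_bot (by omega : c < q + c), hz, zero_mul, zero_add,
      ← Finset.range_eq_Ico] at h0
    have h1 : ∑ m ∈ Finset.Ico (c + 1) (q + c), abelTerm m (-c) * treeWeight (q + c - m) =
        ∑ j ∈ Finset.Ico 1 q, abelTerm (j + c) (-c) * treeWeight (q - j) := by
      rw [add_comm c 1, ← Finset.sum_Ico_add']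
      refine Finset.sum_congr rfl fun j _ => ?_
      rw [show q + c - (j + c) = q - j by omega]
    rw [h1] at h0
    have h2 : (q : ℚ) * (((q + c : ℕ) : ℚ) * (-(c : ℚ) + (q + c : ℕ)) ^ (q + c - 1) /
        (q + c).factorial) = ((q : ℚ) + c) * abelTerm (q + c) (-c) := by
      rw [abelTerm]
      obtain ⟨r, hr⟩ : ∃ r, q + c = r + 1 := ⟨q + c - 1, by omega⟩
      have hr' : (q : ℚ) + c = r + 1 := by exact_mod_cast hr
      rw [hr, Nat.add_sub_cancel]
      push_cast
      rw [← hr', show -(c : ℚ) + (q + c) = q by ring, pow_succ]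
      ring
    rw [← h0] at h2
    calc _ = 2 * c * abelTerm (p - c) c * (q * ∑ j ∈ Finset.Ico 1 q,
          abelTerm (j + c) (-c) * treeWeight (q - j)) := by
          rw [Finset.mul_sum, Finset.mul_sum]
          exact Finset.sum_congr rfl fun j _ => by ring
      _ = _ := by linear_combination 2 * c * abelTerm (p - c) c * h2
  simp only [annularWeight, Finset.sum_mul]
  rw [Finset.sum_comm, Finset.mul_sum]
  simp only [Finset.mul_sum] at key ⊢
  rw [Finset.sum_congr rfl key, Finset.sum_sub_distrib]
  simp only [← Finset.mul_sum]
  rw [hcorr]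
  ring

/-- The factors p − c and q + c of the two preceding sums add up to p + q. In the count, the three
terms on the right come from merging the two zero cycles, shrinking the first, and shrinking the
second. -/
theorem annularWeight_recursion {p q : ℕ} (hp : 0 < p) (hq : 0 < q) :
    ((p : ℚ) + q) * annularWeight p q = 2 * p * q * treeWeight (p + q) +
      p * ∑ i ∈ Finset.Ico 1 p, annularWeight i q * treeWeight (p - i) +
      q * ∑ j ∈ Finset.Ico 1 q, annularWeight p j * treeWeight (q - j) := by
  rw [sum_annularWeight_left, sum_annularWeight_right hp hq, annularWeight, Finset.mul_sum]
  rw [add_sub_assoc', eq_sub_iff_add_eq, add_assoc, ← Finset.sum_add_distrib, add_comm]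
  congr 1
  exact Finset.sum_congr rfl fun c _ => by ring

/-- The sum telescopes: F 0 is the right side, and F p is zero through its factor p − c. The closed
form serves to exhibit the symmetry in p and q, which the definition hides. -/
theorem add_mul_annularWeight {p q : ℕ} (hp : 0 < p) :
    ((p : ℚ) + q) * annularWeight p q = 2 * p * q * (zeroWeight p * zeroWeight q) := by
  let F : ℕ → ℚ := fun c => if c ≤ p then
    2 * ((p : ℚ) ^ (p - c) / (p - c).factorial * (p - c : ℕ)) *
      ((q : ℚ) ^ (q + c + 1) / (q + c).factorial) else 0
  have h : ∀ c ∈ Finset.Icc 1 p,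
      ((p : ℚ) + q) * (2 * c * (abelTerm (p - c) c * abelTerm (q + c) (-c))) =
        F (c - 1) - F c := by
    intro c hc
    obtain ⟨hc1, hcp⟩ := Finset.mem_Icc.1 hc
    obtain ⟨d, rfl⟩ : ∃ d, c = d + 1 := ⟨c - 1, by omega⟩
    obtain ⟨M, rfl⟩ := Nat.exists_eq_add_of_le hcp
    simp only [F]
    rw [if_pos (by omega), if_pos (by omega), abelTerm, abelTerm, Nat.add_sub_cancel,
      show d + 1 + M - (d + 1) = M by omega, show d + 1 + M - d = M + 1 by omega,
      show q + (d + 1) = (q + d) + 1 by omega, Nat.factorial_succ M, Nat.factorial_succ (q + d)]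
    push_cast
    rw [show -((d : ℚ) + 1) + (q + d + 1) = q by ring]
    have h1 : (M.factorial : ℚ) ≠ 0 := by positivity
    have h2 : ((q + d).factorial : ℚ) ≠ 0 := by positivity
    have h3 : (M : ℚ) + 1 ≠ 0 := by positivity
    have h4 : (q : ℚ) + d + 1 ≠ 0 := by positivity
    field_simp
    ring
  rw [annularWeight, Finset.mul_sum, Finset.sum_congr rfl h]
  have h2 : ∑ c ∈ Finset.Icc 1 p, (F (c - 1) - F c) = F 0 - F p := by
    rw [← Finset.Ico_add_one_right_eq_Icc, Finset.sum_Ico_eq_sum_range, Nat.add_sub_cancel,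
      ← Finset.sum_range_sub']
    refine Finset.sum_congr rfl fun c _ => ?_
    rw [Nat.add_sub_cancel_left, add_comm]
  rw [h2]
  simp [F, zeroWeight]
  ring

theorem annularWeight_comm {p q : ℕ} (hp : 0 < p) (hq : 0 < q) :
    annularWeight p q = annularWeight q p := by
  have h : (p : ℚ) + q ≠ 0 := by positivity
  apply mul_left_cancel₀ h
  rw [add_mul_annularWeight hp, add_comm (p : ℚ), add_mul_annularWeight hq]
  ring

theorem factorial_mul_annularWeight (p q : ℕ) :
    ((p + q).factorial : ℚ) * annularWeight p q =
      ((∑ c ∈ Finset.Icc 1 p,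
        2 * c * (p + q).choose (p - c) * p ^ (p - c) * q ^ (q + c) : ℕ) : ℚ) := by
  rw [annularWeight, Finset.mul_sum]
  push_cast
  refine Finset.sum_congr rfl fun c hc => ?_
  obtain ⟨hc1, hcp⟩ := Finset.mem_Icc.1 hc
  rw [Nat.cast_choose ℚ (by omega : p - c ≤ p + q), show p + q - (p - c) = q + c by omega,
    abelTerm, abelTerm, Nat.cast_sub hcp]
  push_cast
  rw [show (c : ℚ) + (p - c) = p by ring, show -(c : ℚ) + (q + c) = q by ring]
  have h1 : ((p - c).factorial : ℚ) ≠ 0 := by positivity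
  have h2 : ((q + c).factorial : ℚ) ≠ 0 := by positivity
  field_simp

theorem factorial_mul_zeroWeight (p q : ℕ) :
    ((p + q).factorial : ℚ) * (zeroWeight p * zeroWeight q) =
      (((p + q).choose q * p ^ p * q ^ q : ℕ) : ℚ) := by
  push_cast
  rw [Nat.cast_choose ℚ (by omega : q ≤ p + q), Nat.add_sub_cancel, zeroWeight, zeroWeight]
  have h1 : (p.factorial : ℚ) ≠ 0 := by positivity
  have h2 : (q.factorial : ℚ) ≠ 0 := by positivity
  field_simp

/-! ### Orbits of a permutation and their change under multiplication by a swap -/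

section Orbits
variable {α : Type*} [Fintype α] [DecidableEq α]

/-- The orbit of `a` under `π`. -/
def orb (π : Perm α) (a : α) : Finset α := Finset.univ.filter (π.SameCycle a)

theorem mem_orb {π : Perm α} {a b : α} : b ∈ orb π a ↔ π.SameCycle a b := by simp [orb]

theorem self_mem_orb (π : Perm α) (a : α) : a ∈ orb π a := mem_orb.2 (.refl _ _)

theorem orb_eq_iff {π : Perm α} {a b : α} : orb π a = orb π b ↔ π.SameCycle a b := by
  constructor
  · intro h
    rw [← mem_orb, h]; exact self_mem_orb π b
  · intro h
    ext x
    rw [mem_orb, mem_orb]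
    exact ⟨h.symm.trans, h.trans⟩

theorem orb_card_pos (π : Perm α) (a : α) : 0 < (orb π a).card :=
  Finset.card_pos.2 ⟨a, self_mem_orb π a⟩

theorem isCycleOn_orb (π : Perm α) (a : α) : π.IsCycleOn (orb π a) := by
  refine ⟨⟨fun x hx => ?_, π.injective.injOn, fun y hy => ⟨π⁻¹ y, ?_, by simp⟩⟩,
    fun x hx y hy => ?_⟩
  · simpa [mem_orb] using hx
  · simpa [mem_orb] using hy
  · rw [Finset.mem_coe, mem_orb] at hx hy
    exact hx.symm.trans hy

theorem exists_pow_eq_of_sameCycle {π : Perm α} {a b : α} (h : π.SameCycle a b) :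
    ∃ i < (orb π a).card, (π ^ i) a = b :=
  (isCycleOn_orb π a).exists_pow_eq (self_mem_orb π a) (mem_orb.2 h)

theorem pow_eq_pow_iff (π : Perm α) (a : α) {m n : ℕ} :
    (π ^ m) a = (π ^ n) a ↔ m ≡ n [MOD (orb π a).card] :=
  (isCycleOn_orb π a).pow_apply_eq_pow_apply (self_mem_orb π a)

theorem pow_orb_card (π : Perm α) (a : α) : (π ^ (orb π a).card) a = a :=
  (isCycleOn_orb π a).pow_card_apply (self_mem_orb π a)

theorem pow_injOn (π : Perm α) (a : α) (m : ℕ) :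
    Set.InjOn (fun j => (π ^ j) a) (Finset.Ico m (m + (orb π a).card) : Set ℕ) := by
  intro i hi j hj h
  simp only [Finset.coe_Ico, Set.mem_Ico] at hi hj
  have := (pow_eq_pow_iff π a).1 h
  obtain ⟨i, rfl⟩ := Nat.exists_eq_add_of_le hi.1
  obtain ⟨j, rfl⟩ := Nat.exists_eq_add_of_le hj.1
  have := Nat.ModEq.add_left_cancel' m this
  rw [Nat.ModEq.eq_of_lt_of_lt this (by omega) (by omega)]

theorem mem_of_sameCycle {π : Perm α} {S : Finset α} (hS : ∀ x ∈ S, π x ∈ S) {a b : α}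
    (ha : a ∈ S) (h : π.SameCycle a b) : b ∈ S := by
  obtain ⟨n, -, rfl⟩ := h.exists_pow_eq'
  clear h
  induction n with
  | zero => simpa
  | succ n ih => rw [pow_succ', Perm.mul_apply]; exact hS _ ih

/-- A closed walk f m, …, f n is both connected and invariant, so it fills an orbit. The free lower
end m allows an orbit to be cut at any place. -/
theorem orb_eq_image {π : Perm α} {f : ℕ → α} {m n : ℕ} (hmn : m ≤ n)
    (h : ∀ j, m ≤ j → j < n → π (f j) = f (j + 1)) (hl : π (f n) = f m) :
    orb π (f n) = (Finset.Icc m n).image f := by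
  have hsc : ∀ j, m ≤ j → j ≤ n → π.SameCycle (f m) (f j) := by
    intro j hj
    induction j, hj using Nat.le_induction with
    | base => exact fun _ => .refl _ _
    | succ j hj ih =>
      intro hjn
      rw [← h j hj hjn, Perm.sameCycle_apply_right]
      exact ih (by omega)
  ext x
  constructor
  · intro hx
    refine mem_of_sameCycle ?_ (Finset.mem_image_of_mem f (Finset.mem_Icc.2 ⟨hmn, le_rfl⟩))
      (mem_orb.1 hx)
    intro y hy
    obtain ⟨j, hj, rfl⟩ := Finset.mem_image.1 hy
    rw [Finset.mem_Icc] at hj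
    rcases hj.2.lt_or_eq with hlt | rfl
    · rw [h j hj.1 hlt]; exact Finset.mem_image_of_mem f (Finset.mem_Icc.2 ⟨by omega, hlt⟩)
    · rw [hl]; exact Finset.mem_image_of_mem f (Finset.mem_Icc.2 ⟨le_rfl, hmn⟩)
  · intro hx
    obtain ⟨j, hj, rfl⟩ := Finset.mem_image.1 hx
    rw [Finset.mem_Icc] at hj
    rw [mem_orb]
    exact (hsc n hmn le_rfl).symm.trans (hsc j hj.1 hj.2)

theorem orb_congr {π π' : Perm α} {x : α} (h : ∀ y ∈ orb π x, π' y = π y) :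
    orb π' x = orb π x := by
  have hcl : ∀ y ∈ orb π x, π y ∈ orb π x := fun y hy => by simpa [mem_orb] using hy
  ext y
  constructor
  · intro hy
    refine mem_of_sameCycle (fun z hz => ?_) (self_mem_orb π x) (mem_orb.1 hy)
    rw [h z hz]; exact hcl z hz
  · intro hy
    rw [mem_orb] at hy
    obtain ⟨n, -, rfl⟩ := hy.exists_pow_eq'
    clear hy
    induction n with
    | zero => exact self_mem_orb _ _
    | succ n ih =>
      rw [pow_succ', Perm.mul_apply, ← h _ (mem_orb.2 (by simp [Perm.SameCycle.refl])), mem_orb,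
        Perm.sameCycle_apply_right]
      exact mem_orb.1 ih

theorem mul_swap_apply_of_ne {π : Perm α} {a b x : α} (ha : x ≠ a) (hb : x ≠ b) :
    (π * swap a b) x = π x := by rw [Perm.mul_apply, swap_apply_of_ne_of_ne ha hb]

/-- The swap redirects just two arrows: π^i a now goes to π a, and a goes to π^(i+1) a. The cycle
closes up into two arcs. -/
theorem orb_mul_swap_pow (π : Perm α) (a : α) {i : ℕ} (hi : 0 < i) (hik : i < (orb π a).card) :
    orb (π * swap a ((π ^ i) a)) ((π ^ i) a) = (Finset.Icc 1 i).image (fun j => (π ^ j) a) ∧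
    orb (π * swap a ((π ^ i) a)) a =
      (Finset.Icc (i + 1) (orb π a).card).image (fun j => (π ^ j) a) := by
  have hne : ∀ j, 0 < j → j < (orb π a).card → j ≠ i →
      (π * swap a ((π ^ i) a)) ((π ^ j) a) = (π ^ (j + 1)) a := by
    intro j hj hjk hji
    rw [mul_swap_apply_of_ne, ← Perm.mul_apply, ← pow_succ']
    · intro h
      exact hj.ne' (pow_injOn π a 0 (by simpa using hjk) (by simpa using orb_card_pos π a) h)
    · intro h
      exact hji (pow_injOn π a 0 (by simpa using hjk) (by simpa using hik) h)
  constructor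
  · refine orb_eq_image (f := fun j => (π ^ j) a) hi (fun j hj hji => ?_) ?_
    · exact hne j hj (by omega) hji.ne
    · rw [Perm.mul_apply, swap_apply_right, pow_one]
  · have := orb_eq_image (π := π * swap a ((π ^ i) a)) (f := fun j => (π ^ j) a) hik
      (fun j hj hji => hne j (by omega) hji (by omega)) (by
        simp only [pow_orb_card]
        rw [Perm.mul_apply, swap_apply_left, ← Perm.mul_apply, ← pow_succ'])
    simpa only [pow_orb_card] using this

theorem card_orb_mul_swap_pow (π : Perm α) (a : α) {i : ℕ} (hi : 0 < i)
    (hik : i < (orb π a).card) :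
    (orb (π * swap a ((π ^ i) a)) ((π ^ i) a)).card = i ∧
    (orb (π * swap a ((π ^ i) a)) a).card = (orb π a).card - i := by
  obtain ⟨h1, h2⟩ := orb_mul_swap_pow π a hi hik
  have hinj := pow_injOn π a 1
  rw [h1, h2, Finset.card_image_of_injOn, Finset.card_image_of_injOn]
  · rw [Nat.card_Icc, Nat.card_Icc]; omega
  · refine hinj.mono fun j hj => ?_
    simp only [Finset.coe_Icc, Set.mem_Icc, Finset.coe_Ico, Set.mem_Ico] at hj ⊢; omega
  · refine hinj.mono fun j hj => ?_
    simp only [Finset.coe_Icc, Set.mem_Icc, Finset.coe_Ico, Set.mem_Ico] at hj ⊢; omega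

theorem orb_union_of_sameCycle {π : Perm α} {a b : α} (hab : a ≠ b) (h : π.SameCycle a b) :
    orb (π * swap a b) a ∪ orb (π * swap a b) b = orb π a ∧
      Disjoint (orb (π * swap a b) a) (orb (π * swap a b) b) := by
  obtain ⟨i, hik, rfl⟩ := exists_pow_eq_of_sameCycle h
  have hi : 0 < i := by
    rcases Nat.eq_zero_or_pos i with rfl | hi
    · exact absurd rfl hab
    · exact hi
  obtain ⟨c1, c2⟩ := card_orb_mul_swap_pow π a hi hik
  obtain ⟨h1, h2⟩ := orb_mul_swap_pow π a hi hik
  have hd : Disjoint (orb (π * swap a ((π ^ i) a)) a) (orb (π * swap a ((π ^ i) a)) ((π ^ i) a)) := by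
    rw [h1, h2, Finset.disjoint_left]
    intro x hx hx'
    obtain ⟨j, hj, rfl⟩ := Finset.mem_image.1 hx
    obtain ⟨l, hl, hjl⟩ := Finset.mem_image.1 hx'
    rw [Finset.mem_Icc] at hj hl
    have := pow_injOn π a 1 (by simp; omega) (by simp; omega) hjl
    omega
  refine ⟨Finset.eq_of_subset_of_card_le ?_ ?_, hd⟩
  · rw [h1, h2]
    intro x hx
    rcases Finset.mem_union.1 hx with hx | hx
    all_goals
      obtain ⟨j, hj, rfl⟩ := Finset.mem_image.1 hx
      exact mem_orb.2 (by simp [Perm.SameCycle.refl])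
  · rw [Finset.card_union_of_disjoint hd, c1, c2]; omega

theorem not_sameCycle_mul_swap {π : Perm α} {a b : α} (hab : a ≠ b) (h : π.SameCycle a b) :
    ¬ (π * swap a b).SameCycle a b := by
  intro h'
  have hd := (orb_union_of_sameCycle hab h).2
  rw [← orb_eq_iff.2 h', Finset.disjoint_self_iff_empty] at hd
  exact absurd (hd ▸ self_mem_orb (π * swap a b) a) (Finset.notMem_empty a)

theorem orb_mul_swap_of_notMem {π : Perm α} {a b x : α} (ha : ¬ π.SameCycle a x)
    (hb : ¬ π.SameCycle b x) : orb (π * swap a b) x = orb π x := by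
  refine orb_congr fun y hy => mul_swap_apply_of_ne ?_ ?_
  · rintro rfl; exact ha (mem_orb.1 hy).symm
  · rintro rfl; exact hb (mem_orb.1 hy).symm

/-- From a the new permutation goes to π b and then follows the old orbit of b until it arrives at
b. -/
theorem sameCycle_mul_swap {π : Perm α} {a b : α} (h : ¬ π.SameCycle a b) :
    (π * swap a b).SameCycle a b := by
  have key : ∀ j, j < (orb π b).card → (π * swap a b).SameCycle a ((π ^ (j + 1)) b) := by
    intro j
    induction j with
    | zero =>
      intro _
      have : (π ^ (0 + 1)) b = (π * swap a b) a := by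
        rw [zero_add, pow_one, Perm.mul_apply, swap_apply_left]
      rw [this, Perm.sameCycle_apply_right]
    | succ j ih =>
      intro hj
      have : (π ^ (j + 1 + 1)) b = (π * swap a b) ((π ^ (j + 1)) b) := by
        rw [mul_swap_apply_of_ne, pow_succ' _ (j + 1), Perm.mul_apply]
        · rintro rfl; exact h (by simp [Perm.SameCycle.refl])
        · intro he
          have := pow_injOn π b 0 (by simpa using hj : j + 1 ∈ _)
            (by simpa [orb_card_pos] using ⟨b, self_mem_orb π b⟩ : 0 ∈ _) he
          omega
      rw [this, Perm.sameCycle_apply_right]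
      exact ih (by omega)
  have hp := orb_card_pos π b
  have := key ((orb π b).card - 1) (by omega)
  rwa [Nat.sub_add_cancel hp, pow_orb_card] at this

theorem mul_swap_mul_swap (π : Perm α) (a b : α) : π * swap a b * swap a b = π := by
  rw [mul_assoc, swap_mul_self, mul_one]

/-- A swap is an involution, so merging is splitting read backwards. -/
theorem orb_union_of_not_sameCycle {π : Perm α} {a b : α} (h : ¬ π.SameCycle a b) :
    orb π a ∪ orb π b = orb (π * swap a b) a ∧ Disjoint (orb π a) (orb π b) := by
  have hab : a ≠ b := by rintro rfl; exact h (.refl _ _)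
  have := orb_union_of_sameCycle hab (sameCycle_mul_swap h)
  rwa [mul_swap_mul_swap] at this

/-- The set of orbits of `π`. -/
def orbs (π : Perm α) : Finset (Finset α) := Finset.univ.image (orb π)

theorem orb_mem_orbs (π : Perm α) (a : α) : orb π a ∈ orbs π :=
  Finset.mem_image_of_mem _ (Finset.mem_univ a)

theorem mem_orbs {π : Perm α} {O : Finset α} : O ∈ orbs π ↔ ∃ a, orb π a = O := by simp [orbs]

theorem orbs_mul_swap_erase {π : Perm α} {a b : α} (hab : a ≠ b) (h : π.SameCycle a b) :
    ((orbs (π * swap a b)).erase (orb (π * swap a b) a)).erase (orb (π * swap a b) b) =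
      (orbs π).erase (orb π a) := by
  obtain ⟨hu, hd⟩ := orb_union_of_sameCycle hab h
  ext O
  simp only [Finset.mem_erase, mem_orbs]
  constructor
  · rintro ⟨h1, h2, x, rfl⟩
    rw [Ne, orb_eq_iff] at h1 h2
    have hx : ¬ π.SameCycle a x := by
      rw [← mem_orb, ← hu, Finset.mem_union, mem_orb, mem_orb, Perm.sameCycle_comm,
        Perm.sameCycle_comm (x := b)]
      tauto
    have hx' : ¬ π.SameCycle b x := fun hbx => hx (h.trans hbx)
    rw [orb_mul_swap_of_notMem hx hx', Ne, orb_eq_iff, Perm.sameCycle_comm]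
    exact ⟨hx, x, rfl⟩
  · rintro ⟨h1, x, rfl⟩
    rw [Ne, orb_eq_iff, Perm.sameCycle_comm] at h1
    have hx' : ¬ π.SameCycle b x := fun hbx => h1 (h.trans hbx)
    have h2 := h1
    rw [← mem_orb, ← hu, Finset.mem_union, mem_orb, mem_orb, Perm.sameCycle_comm,
      Perm.sameCycle_comm (x := b), not_or, ← orb_eq_iff, ← orb_eq_iff] at h2
    rw [orb_mul_swap_of_notMem h1 hx'] at h2
    exact ⟨h2.2, h2.1, x, orb_mul_swap_of_notMem h1 hx'⟩

end Orbits

/-! ### Signed cycle types and their change under a transposition -/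

section Labels
variable {α : Type*} [Fintype α] [DecidableEq α]

/-- The sign of the orbit of `a`: it is `-1` for a zero cycle and `1` for a nonzero cycle. -/
def orbSign (π : Perm α) (s : α → ℤˣ) (a : α) : ℤˣ := ∏ x ∈ orb π a, s x

/-- The size and the sign of a set. -/
def setLabel (s : α → ℤˣ) (O : Finset α) : ℕ × ℤˣ := (O.card, ∏ x ∈ O, s x)

/-- The size and the sign of the orbit of `a`. -/
def orbLabel (π : Perm α) (s : α → ℤˣ) (a : α) : ℕ × ℤˣ := ((orb π a).card, orbSign π s a)

/-- The signed cycle type. -/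
def signedType (π : Perm α) (s : α → ℤˣ) : Multiset (ℕ × ℤˣ) := (orbs π).val.map (setLabel s)

theorem orbSign_congr {π : Perm α} (s : α → ℤˣ) {a b : α} (h : π.SameCycle a b) :
    orbSign π s a = orbSign π s b := by rw [orbSign, orbSign, orb_eq_iff.2 h]

theorem orbLabel_mem (π : Perm α) (s : α → ℤˣ) (a : α) : orbLabel π s a ∈ signedType π s :=
  Multiset.mem_map_of_mem _ (orb_mem_orbs π a)

theorem mem_signedType {π : Perm α} {s : α → ℤˣ} {l : ℕ × ℤˣ} :
    l ∈ signedType π s ↔ ∃ a, orbLabel π s a = l := by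
  constructor
  · intro h
    obtain ⟨O, hO, rfl⟩ := Multiset.mem_map.1 h
    obtain ⟨a, rfl⟩ := mem_orbs.1 hO
    exact ⟨a, rfl⟩
  · rintro ⟨a, rfl⟩
    exact orbLabel_mem π s a

theorem signedType_eq_cons (π : Perm α) (s : α → ℤˣ) (a : α) :
    signedType π s = orbLabel π s a ::ₘ ((orbs π).erase (orb π a)).val.map (setLabel s) := by
  have h := Finset.insert_erase (orb_mem_orbs π a)
  rw [signedType]
  nth_rw 1 [← h]
  rw [Finset.insert_val_of_notMem (Finset.notMem_erase _ _), Multiset.map_cons]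
  rfl

theorem signedType_eq_cons_cons {π : Perm α} (s : α → ℤˣ) {a b : α} (hab : ¬ π.SameCycle a b) :
    signedType π s = orbLabel π s a ::ₘ orbLabel π s b ::ₘ
      (((orbs π).erase (orb π a)).erase (orb π b)).val.map (setLabel s) := by
  have hb : orb π b ∈ (orbs π).erase (orb π a) := by
    rw [Finset.mem_erase, Ne, orb_eq_iff, Perm.sameCycle_comm]
    exact ⟨hab, orb_mem_orbs π b⟩
  rw [signedType_eq_cons π s a]
  nth_rw 1 [← Finset.insert_erase hb]
  rw [Finset.insert_val_of_notMem (Finset.notMem_erase _ _), Multiset.map_cons]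
  rfl

/-- The signs of the product of a signed permutation with signs `s` and the transposition
exchanging `a` and `ε b`. -/
def edgeSign (s : α → ℤˣ) (a b : α) (ε : ℤˣ) (x : α) : ℤˣ :=
  s (swap a b x) * if x = a ∨ x = b then ε else 1

/-- The signs of the product of a signed permutation with signs `s` and `[a]`. -/
def loopSign (s : α → ℤˣ) (a : α) (x : α) : ℤˣ := s x * if x = a then -1 else 1

theorem edgeSign_of_ne (s : α → ℤˣ) {a b x : α} (ε : ℤˣ) (ha : x ≠ a) (hb : x ≠ b) :
    edgeSign s a b ε x = s x := by
  simp [edgeSign, ha, hb, swap_apply_of_ne_of_ne ha hb]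

theorem edgeSign_edgeSign (s : α → ℤˣ) (a b : α) (ε : ℤˣ) :
    edgeSign (edgeSign s a b ε) a b ε = s := by
  funext x
  by_cases ha : x = a
  · subst ha; simp [edgeSign, mul_assoc]
  · by_cases hb : x = b
    · subst hb; simp [edgeSign, mul_assoc]
    · rw [edgeSign_of_ne _ _ ha hb, edgeSign_of_ne _ _ ha hb]

theorem prod_edgeSign_of_notMem (s : α → ℤˣ) {a b : α} (ε : ℤˣ) {O : Finset α} (ha : a ∉ O)
    (hb : b ∉ O) : ∏ x ∈ O, edgeSign s a b ε x = ∏ x ∈ O, s x := by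
  refine Finset.prod_congr rfl fun x hx => edgeSign_of_ne s ε ?_ ?_
  · rintro rfl; exact ha hx
  · rintro rfl; exact hb hx

/-- When just one of a, b lies in O, ε enters the product once. So in a split the two values of ε
realize both signs of the part that contains a. -/
theorem prod_edgeSign_left (s : α → ℤˣ) {a b : α} (ε : ℤˣ) {O : Finset α} (ha : a ∈ O)
    (hb : b ∉ O) :
    ∏ x ∈ O, edgeSign s a b ε x = ε * ∏ x ∈ O, edgeSign s a b 1 x := by
  rw [← Finset.mul_prod_erase O _ ha, ← Finset.mul_prod_erase O (edgeSign s a b 1) ha,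
    prod_edgeSign_of_notMem s ε (Finset.notMem_erase _ _) (fun h => hb (Finset.mem_of_mem_erase h)),
    prod_edgeSign_of_notMem s 1 (Finset.notMem_erase _ _) (fun h => hb (Finset.mem_of_mem_erase h))]
  simp only [edgeSign, true_or, if_true, mul_one]
  rw [mul_comm _ ε, mul_assoc]

/-- The two swapped values both stay in the product, and ε occurs twice. -/
theorem prod_edgeSign_of_mem (s : α → ℤˣ) {a b : α} (hab : a ≠ b) (ε : ℤˣ) {O : Finset α}
    (ha : a ∈ O) (hb : b ∈ O) : ∏ x ∈ O, edgeSign s a b ε x = ∏ x ∈ O, s x := by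
  have hb' : b ∈ O.erase a := Finset.mem_erase.2 ⟨hab.symm, hb⟩
  rw [← Finset.mul_prod_erase O _ ha, ← Finset.mul_prod_erase O s ha,
    ← Finset.mul_prod_erase _ _ hb', ← Finset.mul_prod_erase _ s hb',
    prod_edgeSign_of_notMem s ε (by simp) (by simp)]
  simp only [edgeSign, true_or, or_true, if_true, swap_apply_left, swap_apply_right]
  rw [← mul_assoc (s b * ε), ← mul_assoc (s a), mul_mul_mul_comm, Int.units_mul_self, mul_one,
    mul_comm (s b)]

/-- Multiplying by a transposition that exchanges elements of the same orbit. -/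
theorem signedType_split {π : Perm α} {a b : α} (s : α → ℤˣ) (hab : a ≠ b)
    (h : π.SameCycle a b) :
    ∃ R, signedType π s = orbLabel π s a ::ₘ R ∧ ∀ ε,
      signedType (π * swap a b) (edgeSign s a b ε) =
        orbLabel (π * swap a b) (edgeSign s a b ε) a ::ₘ
        orbLabel (π * swap a b) (edgeSign s a b ε) b ::ₘ R := by
  refine ⟨_, signedType_eq_cons π s a, fun ε => ?_⟩
  rw [signedType_eq_cons_cons _ (not_sameCycle_mul_swap hab h), orbs_mul_swap_erase hab h]
  congr 2
  refine Multiset.map_congr rfl fun O hO => ?_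
  obtain ⟨hne, hO'⟩ := Finset.mem_erase.1 hO
  obtain ⟨x, rfl⟩ := mem_orbs.1 hO'
  rw [Ne, orb_eq_iff] at hne
  rw [setLabel, setLabel, prod_edgeSign_of_notMem]
  · exact fun hx => hne (mem_orb.1 hx)
  · exact fun hx => hne ((mem_orb.1 hx).trans h.symm)

theorem orbSign_split {π : Perm α} {a b : α} (s : α → ℤˣ) (hab : a ≠ b)
    (h : π.SameCycle a b) (ε : ℤˣ) :
    orbSign (π * swap a b) (edgeSign s a b ε) b =
      orbSign (π * swap a b) (edgeSign s a b ε) a * orbSign π s a := by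
  obtain ⟨hu, hd⟩ := orb_union_of_sameCycle hab h
  have : orbSign π s a = orbSign (π * swap a b) (edgeSign s a b ε) a *
      orbSign (π * swap a b) (edgeSign s a b ε) b := by
    rw [orbSign, orbSign, orbSign, ← Finset.prod_union hd, hu,
      prod_edgeSign_of_mem s hab ε (self_mem_orb π a) (mem_orb.2 h)]
  rw [this, ← mul_assoc, Int.units_mul_self, one_mul]

theorem orbSign_split_left {π : Perm α} {a b : α} (s : α → ℤˣ) (hab : a ≠ b)
    (h : π.SameCycle a b) (ε : ℤˣ) :
    orbSign (π * swap a b) (edgeSign s a b ε) a =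
      ε * orbSign (π * swap a b) (edgeSign s a b 1) a := by
  rw [orbSign, orbSign, prod_edgeSign_left s ε (self_mem_orb _ a)]
  exact fun hb => not_sameCycle_mul_swap hab h (mem_orb.1 hb)

theorem card_orb_split {π : Perm α} {a b : α} (hab : a ≠ b) (h : π.SameCycle a b) :
    (orb (π * swap a b) a).card + (orb (π * swap a b) b).card = (orb π a).card := by
  obtain ⟨hu, hd⟩ := orb_union_of_sameCycle hab h
  rw [← Finset.card_union_of_disjoint hd, hu]

/-- Multiplying by a transposition that exchanges elements of different orbits. -/
theorem signedType_merge {π : Perm α} {a b : α} (s : α → ℤˣ) (h : ¬ π.SameCycle a b) (ε : ℤˣ) :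
    ∃ R, signedType π s = orbLabel π s a ::ₘ orbLabel π s b ::ₘ R ∧
      signedType (π * swap a b) (edgeSign s a b ε) =
        ((orb π a).card + (orb π b).card, orbSign π s a * orbSign π s b) ::ₘ R := by
  have hab : a ≠ b := by rintro rfl; exact h (.refl _ _)
  have h' := sameCycle_mul_swap h
  -- The same transposition splits the merged orbit again and restores (π, s).
  obtain ⟨R, h1, h2⟩ := signedType_split (edgeSign s a b ε) hab h'
  have h3 := card_orb_split hab h'
  have h4 := orbSign_split (edgeSign s a b ε) hab h' ε
  have h2 := h2 ε
  rw [mul_swap_mul_swap] at h2 h3 h4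
  rw [edgeSign_edgeSign] at h2 h4
  refine ⟨R, h2, ?_⟩
  rw [h1, h3, h4, ← mul_assoc, Int.units_mul_self, one_mul]
  rfl

theorem signedType_loop (π : Perm α) (s : α → ℤˣ) (a : α) :
    ∃ R, signedType π s = orbLabel π s a ::ₘ R ∧
      signedType π (loopSign s a) = ((orb π a).card, -orbSign π s a) ::ₘ R := by
  refine ⟨_, signedType_eq_cons π s a, ?_⟩
  rw [signedType_eq_cons π _ a]
  have hoff : ∀ x, x ≠ a → loopSign s a x = s x := fun x hx => by simp [loopSign, hx]
  congr 1
  · rw [orbLabel, orbSign, orbSign, ← Finset.mul_prod_erase _ _ (self_mem_orb π a),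
      ← Finset.mul_prod_erase _ s (self_mem_orb π a),
      Finset.prod_congr rfl fun x hx => hoff x (Finset.ne_of_mem_erase hx)]
    simp [loopSign]
  · refine Multiset.map_congr rfl fun O hO => ?_
    obtain ⟨hne, hO'⟩ := Finset.mem_erase.1 hO
    obtain ⟨x, rfl⟩ := mem_orbs.1 hO'
    rw [setLabel, setLabel]
    congr 1
    refine Finset.prod_congr rfl fun y hy => hoff y ?_
    rintro rfl
    exact hne (orb_eq_iff.2 (mem_orb.1 hy))

/-- Each orbit is met once per element, hence the multiplier `l.1`. This turns sums over starting
points of transpositions into sums over cycles. -/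
theorem sum_orbLabel {M : Type*} [AddCommMonoid M] (π : Perm α) (s : α → ℤˣ) (f : ℕ × ℤˣ → M) :
    ∑ a, f (orbLabel π s a) = ((signedType π s).map fun l => l.1 • f l).sum := by
  rw [signedType, Multiset.map_map]
  change _ = ∑ O ∈ orbs π, O.card • f (setLabel s O)
  rw [← Finset.sum_fiberwise_of_maps_to (fun a _ => orb_mem_orbs π a)]
  refine Finset.sum_congr rfl fun O hO => ?_
  obtain ⟨b, rfl⟩ := mem_orbs.1 hO
  have : Finset.univ.filter (fun a => orb π a = orb π b) = orb π b := by
    ext a; simp [orb_eq_iff, mem_orb, Perm.sameCycle_comm]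
  rw [this, ← Finset.sum_const]
  refine Finset.sum_congr rfl fun a ha => ?_
  rw [orbLabel, orbSign, setLabel, orb_eq_iff.2 (mem_orb.1 ha)]

/-- The contribution of a label to the length. -/
def labelLen (l : ℕ × ℤˣ) : ℕ := if l.2 = 1 then l.1 - 1 else l.1

/-- The length of a signed permutation in terms of its signed cycle type. -/
def typeLen (π : Perm α) (s : α → ℤˣ) : ℕ := ((signedType π s).map labelLen).sum

theorem orbLabel_pos {π : Perm α} {s : α → ℤˣ} {l : ℕ × ℤˣ} (hl : l ∈ signedType π s) :
    0 < l.1 := by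
  obtain ⟨a, rfl⟩ := mem_signedType.1 hl
  exact orb_card_pos π a

theorem typeLen_eq_zero_iff {π : Perm α} {s : α → ℤˣ} :
    typeLen π s = 0 ↔ π = 1 ∧ s = fun _ => 1 := by
  rw [typeLen, Multiset.sum_eq_zero_iff]
  constructor
  · intro h
    have key : ∀ a, orbSign π s a = 1 ∧ orb π a = {a} := by
      intro a
      have h0 := h _ (Multiset.mem_map_of_mem _ (orbLabel_mem π s a))
      have hp := orb_card_pos π a
      rw [labelLen] at h0
      split_ifs at h0 with h1
      · refine ⟨h1, ?_⟩
        simp only [orbLabel] at h0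
        obtain ⟨x, hx⟩ := Finset.card_eq_one.1 (by omega : (orb π a).card = 1)
        have := self_mem_orb π a
        rw [hx, Finset.mem_singleton] at this
        rw [hx, this]
      · simp only [orbLabel] at h0; omega
    constructor
    · ext a
      have : π a ∈ orb π a := mem_orb.2 (by simp [Perm.SameCycle.refl])
      rw [(key a).2, Finset.mem_singleton] at this
      rw [this, Perm.one_apply]
    · funext a
      have := (key a).1
      rwa [orbSign, (key a).2, Finset.prod_singleton] at this
  · rintro ⟨rfl, rfl⟩ n hn
    obtain ⟨l, hl, rfl⟩ := Multiset.mem_map.1 hn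
    obtain ⟨a, rfl⟩ := mem_signedType.1 hl
    have : orb (1 : Perm α) a = {a} := by
      ext x; rw [mem_orb, Perm.sameCycle_one, Finset.mem_singleton, eq_comm]
    simp [labelLen, orbLabel, orbSign, this]

end Labels

/-! ### Signed permutations as pairs (π, s), and the transpositions among them -/

section SignedPermutations
variable {α : Type*}

/-- The signed permutation `(a, e) ↦ (π a, s a * e)`. -/
def toPerm (π : Perm α) (s : α → ℤˣ) : Perm (Signed α) where
  toFun x := (π x.1, s x.1 * x.2)
  invFun x := (π.symm x.1, s (π.symm x.1) * x.2)
  left_inv x := by simp [← mul_assoc, Int.units_mul_self]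
  right_inv x := by simp [← mul_assoc, Int.units_mul_self]

theorem toPerm_apply (π : Perm α) (s : α → ℤˣ) (x : Signed α) :
    toPerm π s x = (π x.1, s x.1 * x.2) := rfl

theorem toPerm_mul (π π' : Perm α) (s s' : α → ℤˣ) :
    toPerm π s * toPerm π' s' = toPerm (π * π') fun a => s (π' a) * s' a := by
  ext x <;> simp [toPerm_apply, mul_assoc]

theorem toPerm_one : toPerm (1 : Perm α) (fun _ => 1) = 1 := by
  ext x <;> simp [toPerm_apply]

theorem toPerm_inj {π π' : Perm α} {s s' : α → ℤˣ} :
    toPerm π s = toPerm π' s' ↔ π = π' ∧ s = s' := by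
  constructor
  · intro h
    have h' : ∀ a, toPerm π s (a, 1) = toPerm π' s' (a, 1) := fun a => by rw [h]
    simp only [toPerm_apply, Prod.mk.injEq, mul_one] at h'
    exact ⟨Equiv.ext fun a => (h' a).1, funext fun a => (h' a).2⟩
  · rintro ⟨rfl, rfl⟩; rfl

theorem toPerm_mem_signedPerms (π : Perm α) (s : α → ℤˣ) : toPerm π s ∈ signedPerms α := by
  intro x; simp [toPerm_apply, neg]

theorem neg_neg (x : Signed α) : neg (neg x) = x := by simp [neg]

theorem one_mem_signedPerms : (1 : Perm (Signed α)) ∈ signedPerms α := fun _ => rfl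

theorem mul_mem_signedPerms {σ τ : Perm (Signed α)} (hσ : σ ∈ signedPerms α)
    (hτ : τ ∈ signedPerms α) : σ * τ ∈ signedPerms α := fun x => by
  rw [Perm.mul_apply, hτ, hσ, Perm.mul_apply]

theorem inv_mem_signedPerms {σ : Perm (Signed α)} (hσ : σ ∈ signedPerms α) :
    σ⁻¹ ∈ signedPerms α := fun x => by
  rw [Perm.inv_eq_iff_eq, hσ]; simp

theorem list_prod_mem_signedPerms {l : List (Perm (Signed α))} (h : ∀ t ∈ l, t ∈ signedPerms α) :
    l.prod ∈ signedPerms α := by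
  induction l with
  | nil => exact one_mem_signedPerms
  | cons t l ih =>
    rw [List.prod_cons]
    exact mul_mem_signedPerms (h t (by simp)) (ih fun t ht => h t (by simp [ht]))

theorem exists_toPerm_eq [Finite α] {σ : Perm (Signed α)} (hσ : σ ∈ signedPerms α) :
    ∃ π s, toPerm π s = σ := by
  have key : ∀ a e, σ (a, e) = ((σ (a, 1)).1, (σ (a, 1)).2 * e) := by
    intro a e
    rcases Int.units_eq_one_or e with rfl | rfl
    · simp
    · have : ((a, -1) : Signed α) = neg (a, 1) := rfl
      rw [this, hσ]; simp [neg]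
  have hinj : Function.Injective fun a => (σ (a, 1)).1 := by
    intro a b hab
    -- With this choice of sign, `(a, (σ (a, 1)).2)` is sent to a pair with sign 1, so equal first
    -- coordinates give equal images.
    have h1 := key a (σ (a, 1)).2
    have h2 := key b (σ (b, 1)).2
    rw [Int.units_mul_self] at h1 h2
    have := σ.injective (h1.trans ((congrArg (fun c => (c, (1 : ℤˣ))) hab).trans h2.symm))
    exact (Prod.ext_iff.1 this).1
  refine ⟨Equiv.ofBijective _ (Finite.injective_iff_bijective.1 hinj), fun a => (σ (a, 1)).2, ?_⟩
  refine Equiv.ext fun ⟨a, e⟩ => ?_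
  rw [key, toPerm_apply]
  rfl

variable [DecidableEq α]

/-- The transposition `[a]`. -/
def loop (a : α) : Perm (Signed α) := toPerm 1 fun x => if x = a then -1 else 1

/-- The transposition `((a εb))`. -/
def edge (a b : α) (ε : ℤˣ) : Perm (Signed α) :=
  toPerm (swap a b) fun x => if x = a ∨ x = b then ε else 1

theorem toPerm_mul_loop (π : Perm α) (s : α → ℤˣ) (a : α) :
    toPerm π s * loop a = toPerm π (loopSign s a) := by
  rw [loop, toPerm_mul, mul_one]; rfl

theorem toPerm_mul_edge (π : Perm α) (s : α → ℤˣ) (a b : α) (ε : ℤˣ) :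
    toPerm π s * edge a b ε = toPerm (π * swap a b) (edgeSign s a b ε) := by
  rw [edge, toPerm_mul]; rfl

theorem edge_comm (a b : α) (ε : ℤˣ) : edge a b ε = edge b a ε := by
  rw [edge, edge, swap_comm]; simp only [or_comm]

/-- Exchanging a and b is the only coincidence; it causes the factor 2 in `two_mul_sum_coloured`. -/
theorem edge_eq_edge_iff {a b c d : α} {ε δ : ℤˣ} (hab : a ≠ b) :
    edge a b ε = edge c d δ ↔ (a = c ∧ b = d ∧ ε = δ) ∨ (a = d ∧ b = c ∧ ε = δ) := by
  constructor
  · intro h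
    rw [edge, edge, toPerm_inj] at h
    obtain ⟨h1, h2⟩ := h
    have ha := Equiv.ext_iff.1 h1 a
    rw [swap_apply_left] at ha
    have h3 := congrFun h2 a
    by_cases hac : a = c
    · subst hac
      rw [swap_apply_left] at ha
      simp at h3
      exact .inl ⟨rfl, ha, h3⟩
    · by_cases had : a = d
      · subst had
        rw [swap_apply_right] at ha
        simp at h3
        exact .inr ⟨rfl, ha, h3⟩
      · rw [swap_apply_of_ne_of_ne hac had] at ha
        exact absurd ha.symm hab
  · rintro (⟨rfl, rfl, rfl⟩ | ⟨rfl, rfl, rfl⟩)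
    · rfl
    · exact edge_comm _ _ _

theorem loop_injective : Function.Injective (loop : α → Perm (Signed α)) := by
  intro a b h
  rw [loop, loop, toPerm_inj] at h
  have := congrFun h.2 a
  by_contra hab
  simp [hab] at this

theorem loop_ne_edge (c : α) {a b : α} (hab : a ≠ b) (ε : ℤˣ) : loop c ≠ edge a b ε := by
  intro h
  rw [loop, edge, toPerm_inj] at h
  have := Equiv.ext_iff.1 h.1 a
  rw [swap_apply_left] at this
  exact hab this

theorem loop_mul_self (a : α) : loop a * loop a = 1 := by
  rw [loop, toPerm_mul, mul_one, ← toPerm_one, toPerm_inj]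
  exact ⟨rfl, funext fun x => by by_cases h : x = a <;> simp [h]⟩

theorem edge_mul_self (a b : α) (ε : ℤˣ) : edge a b ε * edge a b ε = 1 := by
  rw [edge, toPerm_mul, swap_mul_self, ← toPerm_one, toPerm_inj]
  refine ⟨rfl, funext fun x => ?_⟩
  by_cases ha : x = a
  · subst ha; simp
  · by_cases hb : x = b
    · subst hb; simp
    · simp [ha, hb, swap_apply_of_ne_of_ne ha hb]

theorem zeroCycle_singleton (i : Signed α) : zeroCycle [i] = loop i.1 := by
  have : zeroCycle [i] = swap i (neg i) := by simp [zeroCycle]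
  rw [this]
  obtain ⟨a, e⟩ := i
  refine Equiv.ext fun ⟨b, f⟩ => ?_
  rw [loop, toPerm_apply]
  by_cases hab : b = a
  · subst hab
    by_cases hef : f = e
    · subst hef; simp [neg]
    · have : f = -e := Int.units_ne_iff_eq_neg.1 hef
      subst this
      have : ((b, -e) : Signed α) = neg (b, e) := rfl
      rw [this, swap_apply_right]; simp [neg]
  · rw [swap_apply_of_ne_of_ne] <;> simp [neg, hab]

theorem pairedCycle_pair {i j : Signed α} (hij : i.1 ≠ j.1) :
    pairedCycle [i, j] = edge i.1 j.1 (i.2 * j.2) := by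
  have : pairedCycle [i, j] = swap i j * swap (neg i) (neg j) := by
    simp [pairedCycle]
  rw [this]
  obtain ⟨a, e⟩ := i
  obtain ⟨b, f⟩ := j
  simp only at hij
  refine Equiv.ext fun ⟨c, g⟩ => ?_
  rw [edge, toPerm_apply, Perm.mul_apply]
  simp only [neg]
  have hne : e ≠ -e := by rcases Int.units_eq_one_or e with rfl | rfl <;> decide
  have hnf : f ≠ -f := by rcases Int.units_eq_one_or f with rfl | rfl <;> decide
  by_cases hca : c = a
  · subst hca
    by_cases hg : g = e
    · subst hg
      rw [swap_apply_of_ne_of_ne (a := (c, -g)), swap_apply_left]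
      · simp [mul_comm g f, mul_assoc]
      · simp
      · simp [hij]
    · have : g = -e := Int.units_ne_iff_eq_neg.1 hg
      subst this
      rw [swap_apply_left, swap_apply_of_ne_of_ne]
      · simp [mul_comm e f, mul_assoc]
      · simp [hij.symm]
      · simp
  · by_cases hcb : c = b
    · subst hcb
      by_cases hg : g = f
      · subst hg
        rw [swap_apply_of_ne_of_ne (a := (a, -e)), swap_apply_right]
        · simp [mul_assoc]
        · simp [hij.symm]
        · simp
      · have : g = -f := Int.units_ne_iff_eq_neg.1 hg
        subst this
        rw [swap_apply_right, swap_apply_of_ne_of_ne]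
        · simp [mul_assoc]
        · simp
        · simp [hij]
    · rw [swap_apply_of_ne_of_ne (a := (a, -e)), swap_apply_of_ne_of_ne, swap_apply_of_ne_of_ne]
        <;> simp [hca, hcb]

theorem isTransposition_iff {t : Perm (Signed α)} :
    IsTransposition t ↔ (∃ a, t = loop a) ∨ ∃ a b ε, a ≠ b ∧ t = edge a b ε := by
  constructor
  · rintro (⟨i, rfl⟩ | ⟨i, j, hij, rfl⟩)
    · exact .inl ⟨i.1, zeroCycle_singleton i⟩
    · exact .inr ⟨i.1, j.1, _, hij, pairedCycle_pair hij⟩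
  · rintro (⟨a, rfl⟩ | ⟨a, b, ε, hab, rfl⟩)
    · exact .inl ⟨(a, 1), (zeroCycle_singleton (a, 1)).symm⟩
    · refine .inr ⟨(a, 1), (b, ε), hab, ?_⟩
      rw [pairedCycle_pair hab, one_mul]

theorem isTransposition_loop (a : α) : IsTransposition (loop a) :=
  isTransposition_iff.2 (.inl ⟨a, rfl⟩)

theorem isTransposition_edge {a b : α} (hab : a ≠ b) (ε : ℤˣ) : IsTransposition (edge a b ε) :=
  isTransposition_iff.2 (.inr ⟨a, b, ε, hab, rfl⟩)

theorem IsTransposition.mul_self {t : Perm (Signed α)} (ht : IsTransposition t) : t * t = 1 := by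
  rcases isTransposition_iff.1 ht with ⟨a, rfl⟩ | ⟨a, b, ε, _, rfl⟩
  · exact loop_mul_self a
  · exact edge_mul_self a b ε

theorem IsTransposition.mem_signedPerms {t : Perm (Signed α)} (ht : IsTransposition t) :
    t ∈ signedPerms α := by
  rcases isTransposition_iff.1 ht with ⟨a, rfl⟩ | ⟨a, b, ε, _, rfl⟩ <;>
  exact toPerm_mem_signedPerms _ _

end SignedPermutations

/-! ### The absolute length computed from the signed cycle type -/

section Length
variable {α : Type*} [Fintype α] [DecidableEq α]

theorem typeLen_split_of_pos {π : Perm α} {a b : α} (s : α → ℤˣ) (hab : a ≠ b)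
    (h : π.SameCycle a b) {ε : ℤˣ} (h0 : orbSign π s a = 1)
    (h1 : orbSign (π * swap a b) (edgeSign s a b ε) a = 1) :
    typeLen (π * swap a b) (edgeSign s a b ε) + 1 = typeLen π s := by
  obtain ⟨R, e1, e2⟩ := signedType_split s hab h
  have h2 := orbSign_split s hab h ε
  have h3 := card_orb_split hab h
  rw [h0, h1, mul_one] at h2
  rw [typeLen, typeLen, e1, e2]
  have := orb_card_pos (π * swap a b) a
  have := orb_card_pos (π * swap a b) b
  simp only [Multiset.map_cons, Multiset.sum_cons, labelLen, orbLabel, h0, h1, h2, if_true]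
  omega

/-- Two zero cycles of total size k have length k, one more than the nonzero cycle they come from.
-/
theorem typeLen_split_of_neg {π : Perm α} {a b : α} (s : α → ℤˣ) (hab : a ≠ b)
    (h : π.SameCycle a b) {ε : ℤˣ} (h0 : orbSign π s a = 1)
    (h1 : orbSign (π * swap a b) (edgeSign s a b ε) a = -1) :
    typeLen (π * swap a b) (edgeSign s a b ε) = typeLen π s + 1 := by
  obtain ⟨R, e1, e2⟩ := signedType_split s hab h
  have h2 := orbSign_split s hab h ε
  have h3 := card_orb_split hab h
  rw [h0, h1, mul_one] at h2
  rw [typeLen, typeLen, e1, e2]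
  have := orb_card_pos (π * swap a b) a
  have := orb_card_pos (π * swap a b) b
  have hn : ¬ ((-1 : ℤˣ) = 1) := by decide
  simp only [Multiset.map_cons, Multiset.sum_cons, labelLen, orbLabel, h0, h1, h2, if_true, if_neg hn]
  omega

/-- The two parts have opposite signs whatever ε is, so exactly one of them saves one unit of
length. -/
theorem typeLen_split_of_zero {π : Perm α} {a b : α} (s : α → ℤˣ) (hab : a ≠ b)
    (h : π.SameCycle a b) (ε : ℤˣ) (h0 : orbSign π s a = -1) :
    typeLen (π * swap a b) (edgeSign s a b ε) + 1 = typeLen π s := by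
  obtain ⟨R, e1, e2⟩ := signedType_split s hab h
  have h2 := orbSign_split s hab h ε
  have h3 := card_orb_split hab h
  rw [h0] at h2
  rw [typeLen, typeLen, e1, e2]
  have := orb_card_pos (π * swap a b) a
  have := orb_card_pos (π * swap a b) b
  have hn : ¬ ((-1 : ℤˣ) = 1) := by decide
  rcases Int.units_eq_one_or (orbSign (π * swap a b) (edgeSign s a b ε) a) with h1 | h1 <;>
  rw [h1] at h2 <;>
  simp [labelLen, orbLabel, h0, h1, h2, hn] <;>
  omega

theorem typeLen_merge_of_zero {π : Perm α} {a b : α} (s : α → ℤˣ) (h : ¬ π.SameCycle a b)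
    (ε : ℤˣ) (ha : orbSign π s a = -1) (hb : orbSign π s b = -1) :
    typeLen (π * swap a b) (edgeSign s a b ε) + 1 = typeLen π s := by
  obtain ⟨R, e1, e2⟩ := signedType_merge s h ε
  rw [typeLen, typeLen, e1, e2]
  have := orb_card_pos π a
  have := orb_card_pos π b
  have hn : ¬ ((-1 : ℤˣ) = 1) := by decide
  simp only [Multiset.map_cons, Multiset.sum_cons, labelLen, orbLabel, ha, hb, if_neg hn,
    Int.units_mul_self, if_true]
  omega

theorem typeLen_merge_of_pos {π : Perm α} {a b : α} (s : α → ℤˣ) (h : ¬ π.SameCycle a b)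
    (ε : ℤˣ) (hs : orbSign π s a = 1 ∨ orbSign π s b = 1) :
    typeLen (π * swap a b) (edgeSign s a b ε) = typeLen π s + 1 := by
  obtain ⟨R, e1, e2⟩ := signedType_merge s h ε
  rw [typeLen, typeLen, e1, e2]
  have := orb_card_pos π a
  have := orb_card_pos π b
  have hn : ¬ ((-1 : ℤˣ) = 1) := by decide
  rcases Int.units_eq_one_or (orbSign π s a) with ha | ha <;>
  rcases Int.units_eq_one_or (orbSign π s b) with hb | hb <;>
  simp [labelLen, orbLabel, ha, hb, hn] at hs ⊢ <;>
  omega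

theorem typeLen_loop_of_zero {π : Perm α} {a : α} {s : α → ℤˣ} (h : orbSign π s a = -1) :
    typeLen π (loopSign s a) + 1 = typeLen π s := by
  obtain ⟨R, e1, e2⟩ := signedType_loop π s a
  rw [typeLen, typeLen, e1, e2]
  have := orb_card_pos π a
  have hn : ¬ ((-1 : ℤˣ) = 1) := by decide
  simp [labelLen, orbLabel, h, hn]
  omega

theorem typeLen_loop_of_pos {π : Perm α} {a : α} {s : α → ℤˣ} (h : orbSign π s a = 1) :
    typeLen π (loopSign s a) = typeLen π s + 1 := by
  obtain ⟨R, e1, e2⟩ := signedType_loop π s a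
  rw [typeLen, typeLen, e1, e2]
  have := orb_card_pos π a
  have hn : ¬ ((-1 : ℤˣ) = 1) := by decide
  simp [labelLen, orbLabel, h, hn]
  omega

theorem typeLen_loop_le (π : Perm α) (a : α) (s : α → ℤˣ) :
    typeLen π (loopSign s a) ≤ typeLen π s + 1 := by
  rcases Int.units_eq_one_or (orbSign π s a) with h | h
  · exact (typeLen_loop_of_pos h).le
  · have := typeLen_loop_of_zero h; omega

theorem typeLen_edge_le (π : Perm α) {a b : α} (hab : a ≠ b) (s : α → ℤˣ) (ε : ℤˣ) :
    typeLen (π * swap a b) (edgeSign s a b ε) ≤ typeLen π s + 1 := by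
  by_cases h : π.SameCycle a b
  · rcases Int.units_eq_one_or (orbSign π s a) with h0 | h0
    · rcases Int.units_eq_one_or (orbSign (π * swap a b) (edgeSign s a b ε) a) with h1 | h1
      · have := typeLen_split_of_pos s hab h h0 h1; omega
      · exact (typeLen_split_of_neg s hab h h0 h1).le
    · have := typeLen_split_of_zero s hab h ε h0; omega
  · rcases Int.units_eq_one_or (orbSign π s a) with h0 | h0
    · exact (typeLen_merge_of_pos s h ε (.inl h0)).le
    · rcases Int.units_eq_one_or (orbSign π s b) with h1 | h1
      · exact (typeLen_merge_of_pos s h ε (.inr h1)).le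
      · have := typeLen_merge_of_zero s h ε h0 h1; omega

theorem typeLen_le_length {l : List (Perm (Signed α))} (hl : ∀ t ∈ l, IsTransposition t)
    {π : Perm α} {s : α → ℤˣ} (h : l.prod = toPerm π s) : typeLen π s ≤ l.length := by
  induction l using List.reverseRecOn generalizing π s with
  | nil =>
    rw [List.prod_nil, ← toPerm_one, toPerm_inj] at h
    exact (typeLen_eq_zero_iff.2 ⟨h.1.symm, h.2.symm⟩).le
  | append_singleton l t ih =>
    have ht := hl t (by simp)
    have hl' : ∀ t ∈ l, IsTransposition t := fun t ht => hl t (by simp [ht])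
    obtain ⟨π', s', h'⟩ := exists_toPerm_eq
      (list_prod_mem_signedPerms fun t ht => (hl' t ht).mem_signedPerms)
    have := ih hl' h'.symm
    rw [List.prod_append, List.prod_singleton, ← h'] at h
    rw [List.length_append, List.length_singleton]
    rcases isTransposition_iff.1 ht with ⟨a, rfl⟩ | ⟨a, b, ε, hab, rfl⟩
    · rw [toPerm_mul_loop, toPerm_inj] at h
      obtain ⟨rfl, rfl⟩ := h
      have := typeLen_loop_le π' a s'
      omega
    · rw [toPerm_mul_edge, toPerm_inj] at h
      obtain ⟨rfl, rfl⟩ := h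
      have := typeLen_edge_le π' hab s' ε
      omega

theorem exists_typeLen_add_one {π : Perm α} {s : α → ℤˣ} (h : typeLen π s ≠ 0) :
    ∃ t, IsTransposition t ∧ ∃ π' s', toPerm π s * t = toPerm π' s' ∧
      typeLen π' s' + 1 = typeLen π s := by
  rw [typeLen, Ne, Multiset.sum_eq_zero_iff] at h
  push Not at h
  obtain ⟨_, hn, h0⟩ := h
  obtain ⟨l, hl, rfl⟩ := Multiset.mem_map.1 hn
  obtain ⟨a, rfl⟩ := mem_signedType.1 hl
  rcases Int.units_eq_one_or (orbSign π s a) with h1 | h1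
  · have hc : 1 < (orb π a).card := by simp [labelLen, orbLabel, h1] at h0; omega
    obtain ⟨b, hb, hba⟩ := Finset.exists_mem_ne hc a
    -- This ε makes the part containing a nonzero; the other part is then nonzero too, as the signs
    -- multiply to 1.
    refine ⟨_, isTransposition_edge hba.symm
      (orbSign (π * swap a b) (edgeSign s a b 1) a), _, _, toPerm_mul_edge _ _ _ _ _, ?_⟩
    refine typeLen_split_of_pos s hba.symm (mem_orb.1 hb) h1 ?_
    rw [orbSign_split_left s hba.symm (mem_orb.1 hb), Int.units_mul_self]
  · exact ⟨_, isTransposition_loop a, _, _, toPerm_mul_loop _ _ _, typeLen_loop_of_zero h1⟩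

theorem exists_list_length_eq_typeLen (π : Perm α) (s : α → ℤˣ) :
    ∃ l : List (Perm (Signed α)), l.length = typeLen π s ∧ (∀ t ∈ l, IsTransposition t) ∧
      l.prod = toPerm π s := by
  generalize hn : typeLen π s = n
  induction n generalizing π s with
  | zero =>
    obtain ⟨rfl, rfl⟩ := typeLen_eq_zero_iff.1 hn
    exact ⟨[], rfl, by simp, toPerm_one.symm⟩
  | succ n ih =>
    obtain ⟨t, ht, π', s', h1, h2⟩ := exists_typeLen_add_one (π := π) (s := s) (by omega)
    obtain ⟨l, hl1, hl2, hl3⟩ := ih π' s' (by omega)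
    refine ⟨l ++ [t], by simp [hl1], fun u hu => ?_, ?_⟩
    · rcases List.mem_append.1 hu with hu | hu
      · exact hl2 u hu
      · rwa [List.mem_singleton.1 hu]
    · rw [List.prod_append, List.prod_singleton, hl3, ← h1, mul_assoc, ht.mul_self, mul_one]

theorem absLength_toPerm (π : Perm α) (s : α → ℤˣ) : absLength (toPerm π s) = typeLen π s := by
  apply le_antisymm
  · exact Nat.sInf_le (exists_list_length_eq_typeLen π s)
  · obtain ⟨l, h1, h2, h3⟩ := Nat.sInf_mem (s := {k | ∃ l : List (Perm (Signed α)),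
      l.length = k ∧ (∀ t ∈ l, IsTransposition t) ∧ l.prod = toPerm π s})
      ⟨_, exists_list_length_eq_typeLen π s⟩
    exact (typeLen_le_length h2 h3).trans h1.le

theorem exists_list_length_eq_absLength {σ : Perm (Signed α)} (hσ : σ ∈ signedPerms α) :
    ∃ l : List (Perm (Signed α)), l.length = absLength σ ∧ (∀ t ∈ l, IsTransposition t) ∧
      l.prod = σ := by
  obtain ⟨π, s, rfl⟩ := exists_toPerm_eq hσ
  rw [absLength_toPerm]
  exact exists_list_length_eq_typeLen π s

omit [Fintype α] in
theorem absLength_prod_le {l : List (Perm (Signed α))} (hl : ∀ t ∈ l, IsTransposition t) :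
    absLength l.prod ≤ l.length := Nat.sInf_le ⟨l, rfl, hl, rfl⟩

theorem absLength_mul_le {σ τ : Perm (Signed α)} (hσ : σ ∈ signedPerms α)
    (hτ : τ ∈ signedPerms α) : absLength (σ * τ) ≤ absLength σ + absLength τ := by
  obtain ⟨l, h1, h2, rfl⟩ := exists_list_length_eq_absLength hσ
  obtain ⟨m, h3, h4, rfl⟩ := exists_list_length_eq_absLength hτ
  rw [← h1, ← h3, ← List.prod_append, ← List.length_append]
  refine absLength_prod_le fun t ht => ?_
  rcases List.mem_append.1 ht with ht | ht
  exacts [h2 t ht, h4 t ht]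

/-- Signedness is essential: for any other permutation `absLength` is the infimum of the empty set,
which is 0. -/
theorem eq_one_of_absLength_eq_zero {σ : Perm (Signed α)} (hσ : σ ∈ signedPerms α)
    (h : absLength σ = 0) : σ = 1 := by
  obtain ⟨l, h1, -, rfl⟩ := exists_list_length_eq_absLength hσ
  rw [h, List.length_eq_zero_iff] at h1
  rw [h1, List.prod_nil]

omit [Fintype α] in
theorem absLength_one : absLength (1 : Perm (Signed α)) = 0 :=
  Nat.le_zero.1 (Nat.sInf_le ⟨[], rfl, by simp, rfl⟩)

end Length

/-! ### Maximal chains and reduced factorizations -/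

section Chains
variable {α : Type*} [DecidableEq α]

/-- The factorizations of `γ` into a minimal number of transpositions. -/
def reducedFactorizations (γ : Perm (Signed α)) : Set (List (Perm (Signed α))) :=
  {τ | τ.length = absLength γ ∧ (∀ t ∈ τ, IsTransposition t) ∧ τ.prod = γ}

theorem prod_take_mem_signedPerms {τ : List (Perm (Signed α))} (h : ∀ t ∈ τ, IsTransposition t)
    (i : ℕ) : (τ.take i).prod ∈ signedPerms α :=
  list_prod_mem_signedPerms fun t ht => (h t (List.mem_of_mem_take ht)).mem_signedPerms

omit [DecidableEq α] in
theorem inv_prod_take_mul_prod_take (τ : List (Perm (Signed α))) {i j : ℕ} (hij : i ≤ j) :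
    (τ.take i).prod⁻¹ * (τ.take j).prod = ((τ.take j).drop i).prod := by
  rw [inv_mul_eq_iff_eq_mul]
  conv_lhs => rw [← List.prod_take_mul_prod_drop (τ.take j) i]
  rw [List.take_take, min_eq_left hij]

omit [DecidableEq α] in
theorem prod_take_mem_partialProducts (τ : List (Perm (Signed α))) (i : ℕ) :
    (τ.take i).prod ∈ partialProducts τ := by
  rcases le_total i τ.length with h | h
  · exact ⟨i, h, rfl⟩
  · exact ⟨τ.length, le_rfl, by rw [List.take_of_length_le h, List.take_length]⟩

variable [Fintype α]

/-- Cut γ into three segments at i and j. Subadditivity bounds the length of γ by those of the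
segments, and a reduced factorization leaves no slack. -/
theorem absLength_prod_take {γ : Perm (Signed α)} {τ : List (Perm (Signed α))}
    (hτ : τ ∈ reducedFactorizations γ) {i j : ℕ} (hij : i ≤ j) (hj : j ≤ τ.length) :
    absLength (τ.take i).prod = i ∧ absLength ((τ.take i).prod⁻¹ * (τ.take j).prod) = j - i := by
  obtain ⟨h1, h2, h3⟩ := hτ
  have hlen : ∀ l : List (Perm (Signed α)), (∀ t ∈ l, t ∈ τ) → absLength l.prod ≤ l.length :=
    fun l hl => absLength_prod_le fun t ht => h2 t (hl t ht)
  have hS : ∀ l : List (Perm (Signed α)), (∀ t ∈ l, t ∈ τ) → l.prod ∈ signedPerms α :=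
    fun l hl => list_prod_mem_signedPerms fun t ht => (h2 t (hl t ht)).mem_signedPerms
  have m1 : ∀ t ∈ τ.take i, t ∈ τ := fun t ht => List.mem_of_mem_take ht
  have m2 : ∀ t ∈ (τ.take j).drop i, t ∈ τ :=
    fun t ht => List.mem_of_mem_take (List.mem_of_mem_drop ht)
  have m3 : ∀ t ∈ τ.drop j, t ∈ τ := fun t ht => List.mem_of_mem_drop ht
  have e : γ = (τ.take i).prod * ((τ.take j).drop i).prod * (τ.drop j).prod := by
    rw [← inv_prod_take_mul_prod_take τ hij, mul_inv_cancel_left, List.prod_take_mul_prod_drop, h3]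
  have l1 := hlen _ m1
  have l2 := hlen _ m2
  have l3 := hlen _ m3
  have l4 := absLength_mul_le (mul_mem_signedPerms (hS _ m1) (hS _ m2)) (hS _ m3)
  have l5 := absLength_mul_le (hS _ m1) (hS _ m2)
  rw [← e, ← h1] at l4
  rw [inv_prod_take_mul_prod_take τ hij]
  simp only [List.length_take, List.length_drop] at l1 l2 l3
  omega

theorem absLE_prod_take {γ : Perm (Signed α)} {τ : List (Perm (Signed α))}
    (hτ : τ ∈ reducedFactorizations γ) {i j : ℕ} (hij : i ≤ j) (hj : j ≤ τ.length) :
    AbsLE (τ.take i).prod (τ.take j).prod := by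
  rw [AbsLE, (absLength_prod_take hτ hij hj).1, (absLength_prod_take hτ hij hj).2,
    (absLength_prod_take hτ le_rfl hj).1]
  omega

theorem AbsLE.eq_of_absLength_eq {π σ : Perm (Signed α)} (h : AbsLE π σ) (hπ : π ∈ signedPerms α)
    (hσ : σ ∈ signedPerms α) (he : absLength π = absLength σ) : π = σ := by
  have h0 : absLength (π⁻¹ * σ) = 0 := by rw [AbsLE] at h; omega
  have := eq_one_of_absLength_eq_zero (mul_mem_signedPerms (inv_mem_signedPerms hπ) hσ) h0
  exact inv_mul_eq_one.1 this

theorem AbsLE.absLength_le {π σ : Perm (Signed α)} (h : AbsLE π σ) :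
    absLength π ≤ absLength σ := by rw [AbsLE] at h; omega

theorem absLE_one (σ : Perm (Signed α)) : AbsLE 1 σ := by
  rw [AbsLE, absLength_one, inv_one, one_mul, zero_add]

theorem mem_intervalBelow {γ σ : Perm (Signed α)} :
    σ ∈ intervalBelow γ ↔ σ ∈ signedPerms α ∧ AbsLE σ γ :=
  ⟨fun h => ⟨h.1, h.2.2⟩, fun h => ⟨h.1, absLE_one σ, h.2⟩⟩

theorem prod_take_mem_intervalBelow {γ : Perm (Signed α)} {τ : List (Perm (Signed α))}
    (hτ : τ ∈ reducedFactorizations γ) {i : ℕ} (hi : i ≤ τ.length) :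
    (τ.take i).prod ∈ intervalBelow γ := by
  have := absLE_prod_take hτ hi le_rfl
  rw [List.take_length, hτ.2.2] at this
  exact mem_intervalBelow.2 ⟨prod_take_mem_signedPerms hτ.2.1 i, this⟩

theorem partialProducts_mem_maximalChains {γ : Perm (Signed α)} {τ : List (Perm (Signed α))}
    (hτ : τ ∈ reducedFactorizations γ) : partialProducts τ ∈ maximalChains γ := by
  refine ⟨⟨?_, ?_⟩, ?_⟩
  · rintro _ ⟨i, hi, rfl⟩
    exact prod_take_mem_intervalBelow hτ hi
  · rintro _ ⟨i, hi, rfl⟩ _ ⟨j, hj, rfl⟩ _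
    rcases le_total i j with h | h
    · exact .inl (absLE_prod_take hτ h hj)
    · exact .inr (absLE_prod_take hτ h hi)
  · rintro D ⟨hD1, hD2⟩ hCD σ hσ
    obtain ⟨hσs, hσγ⟩ := mem_intervalBelow.1 (hD1 hσ)
    -- The chain already has an element of the same length as σ, and comparable signed permutations
    -- of equal length coincide.
    have hi : absLength σ ≤ τ.length := hτ.1 ▸ hσγ.absLength_le
    have hmem := prod_take_mem_partialProducts τ (absLength σ)
    have hl := (absLength_prod_take hτ (le_refl _) hi).1
    have hs := prod_take_mem_signedPerms hτ.2.1 (absLength σ)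
    by_cases he : σ = (τ.take (absLength σ)).prod
    · rw [he]; exact hmem
    · rcases hD2 hσ (hCD hmem) he with h | h
      · exact absurd (h.eq_of_absLength_eq hσs hs hl.symm) he
      · exact absurd (h.eq_of_absLength_eq hs hσs hl).symm he

theorem reducedFactorizations_nonempty {γ : Perm (Signed α)} (hγ : γ ∈ signedPerms α) :
    (reducedFactorizations γ).Nonempty := exists_list_length_eq_absLength hγ

omit [Fintype α] in
theorem append_mem_reducedFactorizations {π γ : Perm (Signed α)} (h : AbsLE π γ)
    {τ τ' : List (Perm (Signed α))} (hτ : τ ∈ reducedFactorizations π)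
    (hτ' : τ' ∈ reducedFactorizations (π⁻¹ * γ)) : τ ++ τ' ∈ reducedFactorizations γ := by
  refine ⟨?_, fun t ht => ?_, ?_⟩
  · rw [List.length_append, hτ.1, hτ'.1, h]
  · rcases List.mem_append.1 ht with ht | ht
    exacts [hτ.2.1 t ht, hτ'.2.1 t ht]
  · rw [List.prod_append, hτ.2.2, hτ'.2.2, mul_inv_cancel_left]

/-- Induction on the length of γ: refine the chain up to its longest element σ ≠ γ, then append a
minimal factorization of σ⁻¹γ. -/
theorem exists_subset_partialProducts {γ : Perm (Signed α)} (hγ : γ ∈ signedPerms α)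
    {D : Set (Perm (Signed α))} (hD : D ⊆ intervalBelow γ) (hc : IsChain AbsLE D) :
    ∃ τ ∈ reducedFactorizations γ, D ⊆ partialProducts τ := by
  induction hn : absLength γ using Nat.strong_induction_on generalizing γ D with
  | _ n ih =>
    have hγmem : ∀ τ ∈ reducedFactorizations γ, γ ∈ partialProducts τ := fun τ hτ =>
      ⟨τ.length, le_rfl, by rw [List.take_length, hτ.2.2]⟩
    by_cases hE : (D \ {γ}).Nonempty
    · obtain ⟨σ, ⟨hσD, hσγ⟩, hmax⟩ := Set.exists_max_image (D \ {γ}) absLength (Set.toFinite _) hE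
      obtain ⟨hσs, hσle⟩ := mem_intervalBelow.1 (hD hσD)
      have hlt : absLength σ < absLength γ := by
        refine lt_of_le_of_ne hσle.absLength_le fun he => hσγ ?_
        exact hσle.eq_of_absLength_eq hσs hγ he
      obtain ⟨τ, hτ, hsub⟩ := ih (absLength σ) (hn ▸ hlt) (γ := σ) hσs (D := D \ {γ}) (by
        intro ρ hρ
        refine mem_intervalBelow.2 ⟨(mem_intervalBelow.1 (hD hρ.1)).1, ?_⟩
        by_cases he : ρ = σ
        · rw [he, AbsLE, inv_mul_cancel, absLength_one, add_zero]
        · rcases hc hρ.1 hσD he with h | h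
          · exact h
          · have := h.eq_of_absLength_eq hσs (mem_intervalBelow.1 (hD hρ.1)).1
              (le_antisymm h.absLength_le (hmax ρ hρ))
            exact absurd this.symm he) (hc.mono Set.sdiff_subset) rfl
      obtain ⟨τ', hτ'⟩ := reducedFactorizations_nonempty
        (mul_mem_signedPerms (inv_mem_signedPerms hσs) hγ)
      have happ := append_mem_reducedFactorizations hσle hτ hτ'
      refine ⟨τ ++ τ', happ, fun ρ hρ => ?_⟩
      by_cases he : ρ = γ
      · rw [he]; exact hγmem _ happ
      · obtain ⟨i, hi, rfl⟩ := hsub ⟨hρ, he⟩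
        rw [← List.take_append_of_le_length hi (l₂ := τ')]
        exact prod_take_mem_partialProducts _ i
    · obtain ⟨τ, hτ⟩ := reducedFactorizations_nonempty hγ
      refine ⟨τ, hτ, fun ρ hρ => ?_⟩
      have : ρ = γ := by
        by_contra he
        exact hE ⟨ρ, hρ, he⟩
      rw [this]; exact hγmem τ hτ

theorem maximalChains_eq_image {γ : Perm (Signed α)} (hγ : γ ∈ signedPerms α) :
    maximalChains γ = partialProducts '' reducedFactorizations γ := by
  ext C
  constructor
  · intro hC
    obtain ⟨τ, hτ, hsub⟩ := exists_subset_partialProducts hγ hC.1.1 hC.1.2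
    have hC' : Maximal (fun D => D ⊆ intervalBelow γ ∧ IsChain AbsLE D) C := hC
    exact ⟨τ, hτ, (hC'.eq_of_subset (partialProducts_mem_maximalChains hτ).1 hsub).symm⟩
  · rintro ⟨τ, hτ, rfl⟩
    exact partialProducts_mem_maximalChains hτ

/-- Length identifies the i-th partial product within the set, and consecutive partial products
determine the factors. -/
theorem partialProducts_injOn (γ : Perm (Signed α)) :
    Set.InjOn partialProducts (reducedFactorizations γ) := by
  intro τ hτ τ' hτ' h
  have hlen : τ.length = τ'.length := hτ.1.trans hτ'.1.symm
  have key : ∀ i ≤ τ.length, (τ.take i).prod = (τ'.take i).prod := by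
    intro i hi
    have := prod_take_mem_partialProducts τ i
    rw [h] at this
    obtain ⟨j, hj, he⟩ := this
    have h1 := (absLength_prod_take hτ le_rfl hi).1
    have h2 := (absLength_prod_take hτ' le_rfl hj).1
    rw [← he, h1] at h2
    rw [he, h2]
  refine List.ext_getElem hlen fun i hi hi' => ?_
  have h1 := key (i + 1) hi
  rw [List.prod_take_succ _ _ hi, List.prod_take_succ _ _ hi', key i hi.le] at h1
  exact mul_left_cancel h1

/-- The list of partial products. -/
def partialProductList (τ : List (Perm (Signed α))) : List (Perm (Signed α)) :=
  (List.range (τ.length + 1)).map fun i => (τ.take i).prod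

omit [DecidableEq α] [Fintype α] in
theorem mem_partialProductList {τ : List (Perm (Signed α))} {π : Perm (Signed α)} :
    π ∈ partialProductList τ ↔ π ∈ partialProducts τ := by
  simp only [partialProductList, List.mem_map, List.mem_range, Nat.lt_succ_iff]
  exact ⟨fun ⟨i, hi, he⟩ => ⟨i, hi, he.symm⟩, fun ⟨i, hi, he⟩ => ⟨i, hi, he.symm⟩⟩

omit [DecidableEq α] [Fintype α] in
theorem zipWith_partialProductList (τ : List (Perm (Signed α))) :
    List.zipWith (fun π σ => π⁻¹ * σ) (partialProductList τ) (partialProductList τ).tail = τ := by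
  refine List.ext_getElem (by simp [partialProductList]) fun i h1 h2 => ?_
  rw [List.getElem_zipWith, List.getElem_tail]
  simp only [partialProductList, List.getElem_map, List.getElem_range]
  rw [List.prod_take_succ _ _ h2, inv_mul_cancel_left]

theorem partialProductList_pairwise {γ : Perm (Signed α)} {τ : List (Perm (Signed α))}
    (hτ : τ ∈ reducedFactorizations γ) :
    (partialProductList τ).Pairwise fun π σ => AbsLE π σ ∧ π ≠ σ := by
  rw [partialProductList, List.pairwise_map]
  refine List.pairwise_lt_range.imp_of_mem fun {i j} hi hj hij => ?_
  rw [List.mem_range, Nat.lt_succ_iff] at hi hj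
  refine ⟨absLE_prod_take hτ hij.le hj, fun he => ?_⟩
  have h1 := (absLength_prod_take hτ le_rfl hi).1
  rw [he, (absLength_prod_take hτ le_rfl hj).1] at h1
  omega

theorem isFactorization_partialProducts {γ : Perm (Signed α)} {τ : List (Perm (Signed α))}
    (hτ : τ ∈ reducedFactorizations γ) : IsFactorization (partialProducts τ) τ :=
  ⟨partialProductList τ, partialProductList_pairwise hτ,
    Set.ext fun _ => mem_partialProductList.symm, (zipWith_partialProductList τ).symm⟩

/-- Every increasing listing of the chain is a rearrangement of the list of partial products. Both
are sorted by a relation that is antisymmetric on signed permutations, so they agree. -/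
theorem IsFactorization.eq {γ : Perm (Signed α)} {τ τ' : List (Perm (Signed α))}
    (hτ : τ ∈ reducedFactorizations γ) (h : IsFactorization (partialProducts τ) τ') : τ' = τ := by
  obtain ⟨l, hl, hC, rfl⟩ := h
  have hmem : ∀ π, π ∈ l ↔ π ∈ partialProductList τ := fun π => by
    rw [mem_partialProductList, hC]; rfl
  have hs : ∀ π ∈ partialProductList τ, π ∈ signedPerms α := by
    intro π hπ
    obtain ⟨i, -, rfl⟩ := mem_partialProductList.1 hπ
    exact prod_take_mem_signedPerms hτ.2.1 i
  have hp := partialProductList_pairwise hτ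
  have hperm : l.Perm (partialProductList τ) :=
    (List.perm_ext_iff_of_nodup (hl.imp And.right) (hp.imp And.right)).2 hmem
  rw [hperm.eq_of_pairwise ?_ hl hp, zipWith_partialProductList]
  intro π σ hπ hσ h1 h2
  exact h1.1.eq_of_absLength_eq (hs π ((hmem π).1 hπ)) (hs σ hσ)
    (le_antisymm h1.1.absLength_le h2.1.absLength_le)

theorem exists_isFactorization_iff {γ : Perm (Signed α)} (hγ : γ ∈ signedPerms α)
    {τ : List (Perm (Signed α))} :
    (∃ C ∈ maximalChains γ, IsFactorization C τ) ↔ τ ∈ reducedFactorizations γ := by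
  constructor
  · rintro ⟨C, hC, h⟩
    rw [maximalChains_eq_image hγ] at hC
    obtain ⟨τ', hτ', rfl⟩ := hC
    rwa [h.eq hτ']
  · intro hτ
    exact ⟨_, partialProducts_mem_maximalChains hτ, isFactorization_partialProducts hτ⟩

end Chains

/-! ### Zero cycles under length-decreasing steps -/

section DescendingSteps
variable {α : Type*} [Fintype α] [DecidableEq α]

theorem orbSign_edge_of_notMem {π : Perm α} {a b x : α} (s : α → ℤˣ) (ε : ℤˣ)
    (ha : ¬ π.SameCycle a x) (hb : ¬ π.SameCycle b x) :
    orbSign (π * swap a b) (edgeSign s a b ε) x = orbSign π s x := by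
  rw [orbSign, orbSign, orb_mul_swap_of_notMem ha hb, prod_edgeSign_of_notMem]
  · exact fun h => ha (mem_orb.1 h).symm
  · exact fun h => hb (mem_orb.1 h).symm

theorem orbSign_merge {π : Perm α} {a b : α} (s : α → ℤˣ) (h : ¬ π.SameCycle a b) (ε : ℤˣ) :
    orbSign (π * swap a b) (edgeSign s a b ε) a = orbSign π s a * orbSign π s b := by
  have hab : a ≠ b := by rintro rfl; exact h (.refl _ _)
  have h4 := orbSign_split (edgeSign s a b ε) hab (sameCycle_mul_swap h) ε
  rw [mul_swap_mul_swap, edgeSign_edgeSign] at h4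
  rw [h4, ← mul_assoc, Int.units_mul_self, one_mul]

/-- A descending step can only shrink a zero cycle. -/
theorem zero_of_edge_descending {π : Perm α} {s : α → ℤˣ} {a b : α} (hab : a ≠ b) {ε : ℤˣ}
    (hlen : typeLen (π * swap a b) (edgeSign s a b ε) + 1 = typeLen π s) {x : α}
    (hx : orbSign (π * swap a b) (edgeSign s a b ε) x = -1) :
    orbSign π s x = -1 ∧ ∀ y, (π * swap a b).SameCycle x y ↔
      π.SameCycle x y ∧ orbSign (π * swap a b) (edgeSign s a b ε) y = -1 := by
  have hn : (1 : ℤˣ) ≠ -1 := by decide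
  -- An orbit containing neither a nor b is unchanged.
  have hoff : ¬ π.SameCycle a x → ¬ π.SameCycle b x → orbSign π s x = -1 ∧
      ∀ y, (π * swap a b).SameCycle x y ↔
      π.SameCycle x y ∧ orbSign (π * swap a b) (edgeSign s a b ε) y = -1 := by
    intro ha hb
    have h1 := orbSign_edge_of_notMem s ε ha hb
    refine ⟨h1 ▸ hx, fun y => ?_⟩
    rw [← mem_orb, orb_mul_swap_of_notMem ha hb, mem_orb, iff_self_and]
    intro hxy
    rw [orbSign_edge_of_notMem s ε (fun h => ha (h.trans hxy.symm))
      (fun h => hb (h.trans hxy.symm)), ← orbSign_congr s hxy, ← h1, hx]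
  by_cases h : π.SameCycle a b
  · by_cases hax : π.SameCycle a x
    · rcases Int.units_eq_one_or (orbSign π s a) with h0 | h0
      · rcases Int.units_eq_one_or (orbSign (π * swap a b) (edgeSign s a b ε) a) with h1 | h1
        -- A descending split of a nonzero cycle has two nonzero parts, so x is in neither.
        · exfalso
          have h2 := orbSign_split s hab h ε
          rw [h0, h1, mul_one] at h2
          have hx' := mem_orb.2 hax
          rw [← (orb_union_of_sameCycle hab h).1, Finset.mem_union, mem_orb, mem_orb] at hx'
          rcases hx' with hx' | hx'
          · rw [← orbSign_congr _ hx', h1] at hx; exact hn hx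
          · rw [← orbSign_congr _ hx', h2] at hx; exact hn hx
        · have := typeLen_split_of_neg s hab h h0 h1; omega
      -- A zero cycle breaks into one zero and one nonzero part, so the sign at y tells which part
      -- contains y.
      · refine ⟨(orbSign_congr s hax) ▸ h0, fun y => ?_⟩
        have hu := (orb_union_of_sameCycle hab h).1
        have hmem : ∀ z, π.SameCycle a z ↔
            (π * swap a b).SameCycle a z ∨ (π * swap a b).SameCycle b z := fun z => by
          rw [← mem_orb, ← hu, Finset.mem_union, mem_orb, mem_orb]
        have h2 := orbSign_split s hab h ε
        rw [h0] at h2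
        have hax' := (hmem x).1 hax
        constructor
        · intro hxy
          refine ⟨hax.symm.trans ((hmem y).2 (hax'.imp (·.trans hxy) (·.trans hxy))), ?_⟩
          rw [← orbSign_congr _ hxy, hx]
        · rintro ⟨hxy, hy⟩
          have hay' := (hmem y).1 (hax.trans hxy)
          have hne : orbSign (π * swap a b) (edgeSign s a b ε) a ≠
              orbSign (π * swap a b) (edgeSign s a b ε) b := by
            rw [h2]
            rcases Int.units_eq_one_or (orbSign (π * swap a b) (edgeSign s a b ε) a)
              with h1 | h1 <;> rw [h1] <;> decide
          rcases hax' with h3 | h3 <;> rcases hay' with h4 | h4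
          · exact h3.symm.trans h4
          · rw [orbSign_congr _ h3, orbSign_congr _ h4, hx, hy] at hne
            exact absurd rfl hne
          · rw [orbSign_congr _ h3, orbSign_congr _ h4, hx, hy] at hne
            exact absurd rfl hne
          · exact h3.symm.trans h4
    · exact hoff hax fun hbx => hax (h.trans hbx)
  · rcases Int.units_eq_one_or (orbSign π s a) with h0 | h0
    · have := typeLen_merge_of_pos s h ε (.inl h0); omega
    · rcases Int.units_eq_one_or (orbSign π s b) with h1 | h1
      · have := typeLen_merge_of_pos s h ε (.inr h1); omega
      -- Two zero cycles merge into a nonzero one, so x lies outside it.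
      · have hm := orbSign_merge s h ε
        rw [h0, h1, Int.units_mul_self] at hm
        have hu := (orb_union_of_not_sameCycle h).1
        have hnot : ¬ (π * swap a b).SameCycle a x := by
          intro hax
          rw [← orbSign_congr _ hax, hm] at hx
          exact hn hx
        rw [← mem_orb, ← hu, Finset.mem_union, mem_orb, mem_orb, not_or] at hnot
        exact hoff hnot.1 hnot.2

theorem orbSign_loop_of_notMem {π : Perm α} {s : α → ℤˣ} {a x : α} (h : ¬ π.SameCycle a x) :
    orbSign π (loopSign s a) x = orbSign π s x := by
  refine Finset.prod_congr rfl fun y hy => ?_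
  have : y ≠ a := by rintro rfl; exact h (mem_orb.1 hy).symm
  simp [loopSign, this]

theorem zero_of_loop_descending {π : Perm α} {s : α → ℤˣ} {a : α}
    (hlen : typeLen π (loopSign s a) + 1 = typeLen π s) {x : α}
    (hx : orbSign π (loopSign s a) x = -1) :
    orbSign π s x = -1 ∧ ∀ y, π.SameCycle x y ↔
      π.SameCycle x y ∧ orbSign π (loopSign s a) y = -1 := by
  refine ⟨?_, fun y => ⟨fun h => ⟨h, orbSign_congr _ h ▸ hx⟩, And.left⟩⟩
  rcases Int.units_eq_one_or (orbSign π s a) with h0 | h0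
  · have := typeLen_loop_of_pos h0; omega
  · by_cases h : π.SameCycle a x
    · rw [← orbSign_congr _ h]; exact h0
    · rwa [← orbSign_loop_of_notMem h]

end DescendingSteps

/-! ### Recursion for the number of factorizations -/

section Counting
variable {α : Type*} [Fintype α] [DecidableEq α] {C : Type*}

/-- The transpositions preserving the colouring `κ`. -/
def colouredTranspositions (κ : α → C) : Set (Perm (Signed α)) :=
  {t | (∃ a, t = loop a) ∨ ∃ a b ε, a ≠ b ∧ κ a = κ b ∧ t = edge a b ε}

/-- The number of factorizations into `r` transpositions preserving the colouring `κ`. -/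
noncomputable def numFactorizations (κ : α → C) (r : ℕ) (σ : Perm (Signed α)) : ℕ :=
  {τ : List (Perm (Signed α)) |
    τ.length = r ∧ (∀ t ∈ τ, t ∈ colouredTranspositions κ) ∧ τ.prod = σ}.ncard

omit [Fintype α] in
theorem isTransposition_of_mem_coloured {κ : α → C} {t : Perm (Signed α)}
    (ht : t ∈ colouredTranspositions κ) : IsTransposition t := by
  rcases ht with ⟨a, rfl⟩ | ⟨a, b, ε, hab, _, rfl⟩
  · exact isTransposition_loop a
  · exact isTransposition_edge hab ε

theorem numFactorizations_zero_one (κ : α → C) : numFactorizations κ 0 1 = 1 := by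
  rw [numFactorizations, Set.ncard_eq_one]
  refine ⟨[], Set.ext fun τ => ⟨fun h => List.length_eq_zero_iff.1 h.1, ?_⟩⟩
  rintro rfl
  simp

theorem numFactorizations_eq_zero (κ : α → C) {r : ℕ} {π : Perm α} {s : α → ℤˣ}
    (h : r < typeLen π s) : numFactorizations κ r (toPerm π s) = 0 := by
  refine (congrArg Set.ncard (Set.eq_empty_of_forall_notMem fun τ hτ => ?_)).trans
    (Set.ncard_empty _)
  have := typeLen_le_length (fun t ht => isTransposition_of_mem_coloured (hτ.2.1 t ht)) hτ.2.2
  exact absurd hτ.1 (by omega)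

/-- Remove the last factor t; the remaining ones multiply to σ t because t is an involution. -/
theorem numFactorizations_succ (κ : α → C) (r : ℕ) (σ : Perm (Signed α)) :
    numFactorizations κ (r + 1) σ =
      ∑ t ∈ (Set.toFinite (colouredTranspositions κ)).toFinset, numFactorizations κ r (σ * t) := by
  have hfin : ∀ r σ, {τ : List (Perm (Signed α)) |
      τ.length = r ∧ (∀ t ∈ τ, t ∈ colouredTranspositions κ) ∧ τ.prod = σ}.Finite :=
    fun r _ => (List.finite_length_eq _ r).subset fun _ h => h.1
  have heq : (hfin (r + 1) σ).toFinset =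
      (Set.toFinite (colouredTranspositions κ)).toFinset.biUnion fun t =>
        (hfin r (σ * t)).toFinset.image (· ++ [t]) := by
    ext τ
    simp only [Set.Finite.mem_toFinset, Set.mem_ofPred_eq, Finset.mem_biUnion, Finset.mem_image]
    constructor
    · rintro ⟨h1, h2, rfl⟩
      rcases List.eq_nil_or_concat τ with rfl | ⟨l, t, rfl⟩
      · simp at h1
      · rw [List.concat_eq_append] at *
        have ht := h2 t (by simp)
        refine ⟨t, ht, l, ⟨by simpa using h1, fun u hu => h2 u (by simp [hu]), ?_⟩, rfl⟩
        rw [List.prod_append, List.prod_singleton, mul_assoc,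
          (isTransposition_of_mem_coloured ht).mul_self, mul_one]
    · rintro ⟨t, ht, l, ⟨h1, h2, h3⟩, rfl⟩
      refine ⟨by simp [h1], fun u hu => ?_, ?_⟩
      · rcases List.mem_append.1 hu with hu | hu
        · exact h2 u hu
        · rwa [List.mem_singleton.1 hu]
      · rw [List.prod_append, List.prod_singleton, h3, mul_assoc,
          (isTransposition_of_mem_coloured ht).mul_self, mul_one]
  simp only [numFactorizations]
  rw [Set.ncard_eq_toFinset_card _ (hfin _ _), heq, Finset.card_biUnion]
  · refine Finset.sum_congr rfl fun t _ => ?_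
    rw [Finset.card_image_of_injective _ fun l m h => List.append_cancel_right h,
      Set.ncard_eq_toFinset_card _ (hfin _ _)]
  · intro t _ u _ htu
    rw [Function.onFun, Finset.disjoint_left]
    intro τ h1 h2
    obtain ⟨l, -, rfl⟩ := Finset.mem_image.1 h1
    obtain ⟨m, -, h⟩ := Finset.mem_image.1 h2
    exact htu (List.singleton_injective (List.append_inj_right' h rfl)).symm

open Classical in
theorem two_mul_sum_coloured (κ : α → C) (f : Perm (Signed α) → ℚ) :
    2 * ∑ t ∈ (Set.toFinite (colouredTranspositions κ)).toFinset, f t =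
      ∑ a, (2 * f (loop a) + ∑ b with a ≠ b ∧ κ a = κ b, ∑ ε, f (edge a b ε)) := by
  let E : Finset (α × α × ℤˣ) := Finset.univ.filter fun x => x.1 ≠ x.2.1 ∧ κ x.1 = κ x.2.1
  let g : α × α × ℤˣ → Perm (Signed α) := fun x => edge x.1 x.2.1 x.2.2
  have hT : (Set.toFinite (colouredTranspositions κ)).toFinset =
      Finset.univ.image loop ∪ E.image g := by
    ext t
    simp only [Set.Finite.mem_toFinset, colouredTranspositions, Set.mem_ofPred_eq, Finset.mem_union,
      Finset.mem_image, Finset.mem_univ, true_and, E, g, Finset.mem_filter, Prod.exists]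
    refine or_congr (exists_congr fun a => eq_comm) ?_
    refine exists_congr fun a => exists_congr fun b => exists_congr fun ε => ?_
    rw [and_assoc, eq_comm (a := t)]
  have hdisj : Disjoint (Finset.univ.image (loop : α → Perm (Signed α))) (E.image g) := by
    rw [Finset.disjoint_left]
    intro t h1 h2
    obtain ⟨c, -, rfl⟩ := Finset.mem_image.1 h1
    obtain ⟨x, hx, he⟩ := Finset.mem_image.1 h2
    exact loop_ne_edge c (Finset.mem_filter.1 hx).2.1 _ he.symm
  -- Every edge arises from exactly the two triples (a, b, ε) and (b, a, ε).
  have hE : ∑ x ∈ E, f (g x) = 2 * ∑ t ∈ E.image g, f t := by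
    rw [Finset.sum_comp, Finset.mul_sum]
    refine Finset.sum_congr rfl fun t ht => ?_
    obtain ⟨⟨a, b, ε⟩, hx, rfl⟩ := Finset.mem_image.1 ht
    obtain ⟨hab, hk⟩ : a ≠ b ∧ κ a = κ b := (Finset.mem_filter.1 hx).2
    have : E.filter (fun x => g x = g (a, b, ε)) = {(a, b, ε), (b, a, ε)} := by
      ext ⟨c, d, δ⟩
      simp only [E, g, Finset.mem_filter, Finset.mem_univ, true_and, Finset.mem_insert,
        Finset.mem_singleton, Prod.mk.injEq]
      constructor
      · rintro ⟨⟨h1, h2⟩, h3⟩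
        exact (edge_eq_edge_iff h1).1 h3
      · rintro (⟨rfl, rfl, rfl⟩ | ⟨rfl, rfl, rfl⟩)
        · exact ⟨⟨hab, hk⟩, rfl⟩
        · exact ⟨⟨hab.symm, hk.symm⟩, edge_comm _ _ _⟩
    rw [this, Finset.card_pair (by simp [hab]), nsmul_eq_mul, Nat.cast_ofNat]
  have hE' : ∑ x ∈ E, f (g x) = ∑ a, ∑ b with a ≠ b ∧ κ a = κ b, ∑ ε, f (edge a b ε) := by
    simp only [E, g, Finset.sum_filter]
    rw [Fintype.sum_prod_type]
    refine Finset.sum_congr rfl fun a _ => ?_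
    rw [Fintype.sum_prod_type]
    refine Finset.sum_congr rfl fun b _ => ?_
    by_cases h : a ≠ b ∧ κ a = κ b
    · simp only [if_pos h]
    · simp only [if_neg h, Finset.sum_const_zero]
  rw [hT, Finset.sum_union hdisj, Finset.sum_image fun _ _ _ _ h => loop_injective h, mul_add,
    ← hE, hE', Finset.sum_add_distrib, Finset.mul_sum]

theorem sum_orb_erase {M : Type*} [AddCommMonoid M] (π : Perm α) (a : α) (F : α → M) :
    ∑ b ∈ (orb π a).erase a, F b = ∑ i ∈ Finset.Ico 1 (orb π a).card, F ((π ^ i) a) := by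
  symm
  have hp := orb_card_pos π a
  refine Finset.sum_bij (fun i _ => (π ^ i) a) ?_ ?_ ?_ ?_
  · intro i hi
    rw [Finset.mem_Ico] at hi
    refine Finset.mem_erase.2 ⟨fun h => ?_, mem_orb.2 (by simp [Perm.SameCycle.refl])⟩
    have := pow_injOn π a 0 (by simpa using hi.2 : i ∈ _) (by simpa using ⟨a, self_mem_orb π a⟩ : 0 ∈ _) h
    omega
  · intro i hi j hj h
    rw [Finset.mem_Ico] at hi hj
    exact pow_injOn π a 0 (by simpa using hi.2) (by simpa using hj.2) h
  · intro b hb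
    obtain ⟨hba, hb⟩ := Finset.mem_erase.1 hb
    obtain ⟨i, hi, rfl⟩ := exists_pow_eq_of_sameCycle (mem_orb.1 hb)
    refine ⟨i, Finset.mem_Ico.2 ⟨?_, hi⟩, rfl⟩
    rcases Nat.eq_zero_or_pos i with rfl | h
    · exact absurd rfl hba
    · exact h
  · intro _ _; rfl

open Classical in
-- Steps are grouped by a starting point a: changing a sign, splitting the orbit of a at π^i a, or
-- merging it with another orbit. Since π preserves colours, the colour condition only restricts the
-- merges.
theorem two_mul_numFactorizations_succ {κ : α → C} {π : Perm α} (hκ : ∀ x, κ (π x) = κ x)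
    (s : α → ℤˣ) (r : ℕ) :
    2 * (numFactorizations κ (r + 1) (toPerm π s) : ℚ) =
      ∑ a, (2 * (numFactorizations κ r (toPerm π (loopSign s a)) : ℚ) +
        ∑ i ∈ Finset.Ico 1 (orb π a).card, ∑ ε, (numFactorizations κ r
          (toPerm (π * swap a ((π ^ i) a)) (edgeSign s a ((π ^ i) a) ε)) : ℚ) +
        ∑ b with ¬ π.SameCycle a b ∧ κ a = κ b, ∑ ε, (numFactorizations κ r
          (toPerm (π * swap a b) (edgeSign s a b ε)) : ℚ)) := by
  rw [numFactorizations_succ, Nat.cast_sum]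
  rw [two_mul_sum_coloured κ fun t => (numFactorizations κ r (toPerm π s * t) : ℚ)]
  refine Finset.sum_congr rfl fun a _ => ?_
  rw [toPerm_mul_loop, add_assoc]
  congr 1
  simp only [toPerm_mul_edge]
  rw [← sum_orb_erase π a fun b => ∑ ε, (numFactorizations κ r
          (toPerm (π * swap a b) (edgeSign s a b ε)) : ℚ), ← Finset.sum_union]
  · refine Finset.sum_congr (Finset.ext fun b => ?_) fun _ _ => rfl
    have hc : π.SameCycle a b → κ a = κ b := by
      intro h
      obtain ⟨n, -, rfl⟩ := h.exists_pow_eq'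
      clear h
      induction n with
      | zero => rfl
      | succ n ih => rw [pow_succ', Perm.mul_apply, hκ, ih]
    have hr : a = b → π.SameCycle a b := by rintro rfl; exact .refl _ _
    simp only [Finset.mem_filter, Finset.mem_univ, true_and, Finset.mem_union, Finset.mem_erase,
      mem_orb]
    rw [ne_comm (a := b)]
    tauto
  · rw [Finset.disjoint_left]
    intro b hb hb'
    exact (Finset.mem_filter.1 hb').2.1 (mem_orb.1 (Finset.mem_of_mem_erase hb))

theorem sum_units (f : ℤˣ → ℚ) (e : ℤˣ) : ∑ ε, f ε = f e + f (-e) := by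
  have : (Finset.univ : Finset ℤˣ) = {e, -e} := by
    rcases Int.units_eq_one_or e with rfl | rfl <;> decide
  rw [this, Finset.sum_pair]
  rcases Int.units_eq_one_or e with rfl | rfl <;> decide

/-- The weight of a label. -/
def labelWeight (l : ℕ × ℤˣ) : ℚ := if l.2 = 1 then treeWeight l.1 else zeroWeight l.1

/-- The weight of a signed cycle type. -/
def typeWeight (T : Multiset (ℕ × ℤˣ)) : ℚ := (T.map labelWeight).prod

theorem typeWeight_cons (l : ℕ × ℤˣ) (T : Multiset (ℕ × ℤˣ)) :
    typeWeight (l ::ₘ T) = labelWeight l * typeWeight T := by simp [typeWeight]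

theorem labelWeight_one (k : ℕ) : labelWeight (k, 1) = treeWeight k := rfl

theorem labelWeight_neg_one (k : ℕ) : labelWeight (k, -1) = zeroWeight k := rfl

/-- The two cycle types that arise by splitting the orbit of `a` between `a` and `π ^ i a`. -/
theorem exists_signedType_split (π : Perm α) (s : α → ℤˣ) (a : α) {R : Multiset (ℕ × ℤˣ)}
    (hR : signedType π s = orbLabel π s a ::ₘ R) {i : ℕ} (hi : 0 < i)
    (hik : i < (orb π a).card) :
    ∃ e, signedType (π * swap a ((π ^ i) a)) (edgeSign s a ((π ^ i) a) e) =
        ((orb π a).card - i, 1) ::ₘ (i, orbSign π s a) ::ₘ R ∧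
      signedType (π * swap a ((π ^ i) a)) (edgeSign s a ((π ^ i) a) (-e)) =
        ((orb π a).card - i, -1) ::ₘ (i, -orbSign π s a) ::ₘ R := by
  have hab : a ≠ (π ^ i) a := by
    intro h
    have := pow_injOn π a 0 (by simpa using hik : i ∈ _)
      (by simpa using ⟨a, self_mem_orb π a⟩ : 0 ∈ _) h.symm
    omega
  have h : π.SameCycle a ((π ^ i) a) := by simp [Perm.SameCycle.refl]
  obtain ⟨R', h1, h2⟩ := signedType_split s hab h
  obtain ⟨c1, c2⟩ := card_orb_mul_swap_pow π a hi hik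
  rw [hR, Multiset.cons_inj_right] at h1
  subst h1
  have h3 := orbSign_split s hab h
  have h4 := orbSign_split_left s hab h
  have hu := Int.units_mul_self
    (orbSign (π * swap a ((π ^ i) a)) (edgeSign s a ((π ^ i) a) 1) a)
  -- This e makes the part containing a nonzero, so the other part inherits the sign of the old
  -- orbit.
  refine ⟨orbSign (π * swap a ((π ^ i) a)) (edgeSign s a ((π ^ i) a) 1) a, ?_, ?_⟩
  · rw [h2, orbLabel, orbLabel, h3, h4, hu, c1, c2, one_mul]
  · rw [h2, orbLabel, orbLabel, h3, h4, _root_.neg_mul, hu, c1, c2, neg_one_mul]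

end Counting

/-! ### The count when zero cycles cannot merge -/

section Counting
variable {α : Type*} [Fintype α] [DecidableEq α] {C : Type*}

/-- The signed permutation preserves the colouring `κ` and has at most one zero cycle of each
colour. -/
def AtMostOneZero (κ : α → C) (π : Perm α) (s : α → ℤˣ) : Prop :=
  (∀ x, κ (π x) = κ x) ∧ ∀ x y, κ x = κ y → orbSign π s x = -1 → orbSign π s y = -1 →
    π.SameCycle x y

/-- By `zero_of_edge_descending`, new zero cycles lie in old ones, at most one in each. -/
theorem AtMostOneZero.edge {κ : α → C} {π : Perm α} {s : α → ℤˣ} (h : AtMostOneZero κ π s)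
    {a b : α} (hab : a ≠ b) (hk : κ a = κ b) {ε : ℤˣ}
    (hlen : typeLen (π * swap a b) (edgeSign s a b ε) + 1 = typeLen π s) :
    AtMostOneZero κ (π * swap a b) (edgeSign s a b ε) := by
  refine ⟨fun x => ?_, fun x y hxy hx hy => ?_⟩
  · rw [Perm.mul_apply, h.1]
    by_cases ha : x = a
    · rw [ha, swap_apply_left, hk]
    · by_cases hb : x = b
      · rw [hb, swap_apply_right, hk]
      · rw [swap_apply_of_ne_of_ne ha hb]
  · obtain ⟨h1, h2⟩ := zero_of_edge_descending hab hlen hx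
    exact (h2 y).2 ⟨h.2 x y hxy h1 (zero_of_edge_descending hab hlen hy).1, hy⟩

theorem AtMostOneZero.loop {κ : α → C} {π : Perm α} {s : α → ℤˣ} (h : AtMostOneZero κ π s)
    {a : α} (hlen : typeLen π (loopSign s a) + 1 = typeLen π s) :
    AtMostOneZero κ π (loopSign s a) := by
  refine ⟨h.1, fun x y hxy hx hy => ?_⟩
  exact h.2 x y hxy (zero_of_loop_descending hlen hx).1 (zero_of_loop_descending hlen hy).1

theorem colour_pow {κ : α → C} {π : Perm α} (h : ∀ x, κ (π x) = κ x) (a : α) (i : ℕ) :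
    κ ((π ^ i) a) = κ a := by
  induction i with
  | zero => rfl
  | succ n ih => rw [pow_succ', Perm.mul_apply, h, ih]

theorem sum_Ico_reflect' (f : ℕ → ℕ → ℚ) (k : ℕ) :
    ∑ i ∈ Finset.Ico 1 k, f (k - i) i = ∑ i ∈ Finset.Ico 1 k, f i (k - i) := by
  refine Finset.sum_bij' (fun i _ => k - i) (fun i _ => k - i) ?_ ?_ ?_ ?_ ?_
  all_goals intro i hi; rw [Finset.mem_Ico] at hi
  · rw [Finset.mem_Ico]; omega
  · rw [Finset.mem_Ico]; omega
  · omega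
  · omega
  · rw [Nat.sub_sub_self hi.2.le]

theorem typeLen_eq_of_signedType {π : Perm α} {s : α → ℤˣ} {T : Multiset (ℕ × ℤˣ)}
    (h : signedType π s = T) : typeLen π s = (T.map labelLen).sum := by rw [typeLen, h]

theorem labelLen_one (k : ℕ) : labelLen (k, 1) = k - 1 := rfl

theorem labelLen_neg_one (k : ℕ) : labelLen (k, -1) = k := rfl

theorem typeWeight_signedType_one :
    typeWeight (signedType (1 : Perm α) fun _ => 1) = 1 := by
  rw [typeWeight]
  refine Multiset.prod_eq_one fun w hw => ?_
  obtain ⟨l, hl, rfl⟩ := Multiset.mem_map.1 hw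
  obtain ⟨a, rfl⟩ := mem_signedType.1 hl
  have : orb (1 : Perm α) a = {a} := by
    ext x; rw [mem_orb, Perm.sameCycle_one, Finset.mem_singleton, eq_comm]
  simp [labelWeight, orbLabel, orbSign, this, treeWeight_one]

/-- The number of factorizations of a signed permutation with at most one zero cycle of each
colour. -/
theorem numFactorizations_of_atMostOneZero {κ : α → C} {π : Perm α} {s : α → ℤˣ}
    (h : AtMostOneZero κ π s) : (numFactorizations κ (typeLen π s) (toPerm π s) : ℚ) =
      (typeLen π s).factorial * typeWeight (signedType π s) := by
  classical
  induction hr : typeLen π s generalizing π s with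
  | zero =>
    obtain ⟨rfl, rfl⟩ := typeLen_eq_zero_iff.1 hr
    rw [toPerm_one, numFactorizations_zero_one, typeWeight_signedType_one]
    simp
  | succ r ih =>
    have hn : (1 : ℤˣ) ≠ -1 := by decide
    have hedge : ∀ a b, a ≠ b → κ a = κ b → ∀ ε,
        typeLen (π * swap a b) (edgeSign s a b ε) = r →
        (numFactorizations κ r (toPerm (π * swap a b) (edgeSign s a b ε)) : ℚ) =
        r.factorial * typeWeight (signedType (π * swap a b) (edgeSign s a b ε)) :=
      fun a b hab hk ε hl => ih (h.edge hab hk (by omega)) hl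
    have hzero : ∀ a b ε, typeLen (π * swap a b) (edgeSign s a b ε) = typeLen π s + 1 →
        (numFactorizations κ r (toPerm (π * swap a b) (edgeSign s a b ε)) : ℚ) = 0 :=
      fun a b ε hl => by rw [numFactorizations_eq_zero κ (by omega), Nat.cast_zero]
    -- The share of one element in the length of its orbit: size times share is `labelLen`, so all
    -- shares add up to r + 1.
    let c : ℕ × ℤˣ → ℚ := fun l => if l.2 = 1 then ((l.1 : ℚ) - 1) / l.1 else 1
    have key : ∀ a, (2 * (numFactorizations κ r (toPerm π (loopSign s a)) : ℚ) +
        ∑ i ∈ Finset.Ico 1 (orb π a).card, ∑ ε, (numFactorizations κ r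
          (toPerm (π * swap a ((π ^ i) a)) (edgeSign s a ((π ^ i) a) ε)) : ℚ) +
        ∑ b with ¬ π.SameCycle a b ∧ κ a = κ b, ∑ ε, (numFactorizations κ r
          (toPerm (π * swap a b) (edgeSign s a b ε)) : ℚ)) =
        2 * r.factorial * typeWeight (signedType π s) * c (orbLabel π s a) := by
      intro a
      have hk0 := orb_card_pos π a
      have hR := signedType_eq_cons π s a
      generalize ((orbs π).erase (orb π a)).val.map (setLabel s) = R at hR
      -- A merge lowers the length only for two zero cycles, and one colour has at most one of them.
      have hthird : ∑ b with ¬ π.SameCycle a b ∧ κ a = κ b, ∑ ε, (numFactorizations κ r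
          (toPerm (π * swap a b) (edgeSign s a b ε)) : ℚ) = 0 := by
        refine Finset.sum_eq_zero fun b hb => Finset.sum_eq_zero fun ε _ => hzero _ _ _ ?_
        obtain ⟨-, hb, hk⟩ := Finset.mem_filter.1 hb
        refine typeLen_merge_of_pos s hb ε ?_
        rcases Int.units_eq_one_or (orbSign π s a) with h0 | h0
        · exact .inl h0
        · rcases Int.units_eq_one_or (orbSign π s b) with h1 | h1
          · exact .inr h1
          · exact absurd (h.2 a b hk h0 h1) hb
      rw [hthird, add_zero]
      have hL := typeLen_eq_of_signedType hR
      simp only [Multiset.map_cons, Multiset.sum_cons] at hL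
      have hne : ∀ i ∈ Finset.Ico 1 (orb π a).card, a ≠ (π ^ i) a := by
        intro i hi he
        rw [Finset.mem_Ico] at hi
        have := pow_injOn π a 0 (by simpa using hi.2 : i ∈ _)
          (by simpa using ⟨a, self_mem_orb π a⟩ : 0 ∈ _) he.symm
        omega
      rcases Int.units_eq_one_or (orbSign π s a) with h0 | h0
      · rw [orbLabel, h0] at hR hL
        rw [labelLen_one] at hL
        have hloop : (numFactorizations κ r (toPerm π (loopSign s a)) : ℚ) = 0 := by
          have := typeLen_loop_of_pos h0
          rw [numFactorizations_eq_zero κ (by omega), Nat.cast_zero]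
        -- Only ε = e gives two nonzero parts; −e gives two zero cycles and raises the length.
        have hsplit : ∀ i ∈ Finset.Ico 1 (orb π a).card, ∑ ε, (numFactorizations κ r
            (toPerm (π * swap a ((π ^ i) a)) (edgeSign s a ((π ^ i) a) ε)) : ℚ) =
            r.factorial * typeWeight R * (treeWeight i * treeWeight ((orb π a).card - i)) := by
          intro i hi
          have hi' := Finset.mem_Ico.1 hi
          obtain ⟨e, h1, h2⟩ := exists_signedType_split π s a (by rw [orbLabel, h0, hR])
            hi'.1 hi'.2
          rw [h0] at h1 h2
          have l1 := typeLen_eq_of_signedType h1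
          have l2 := typeLen_eq_of_signedType h2
          simp only [Multiset.map_cons, Multiset.sum_cons, labelLen_one, labelLen_neg_one] at l1 l2
          rw [sum_units _ e, hedge a _ (hne i hi) (colour_pow h.1 a i).symm e (by omega),
            hzero _ _ _ (by omega), h1, typeWeight_cons, typeWeight_cons, labelWeight_one,
            labelWeight_one]
          ring
        rw [hloop, Finset.sum_congr rfl hsplit, ← Finset.mul_sum, hR, typeWeight_cons,
          labelWeight_one]
        have hw := sum_treeWeight_mul_treeWeight hk0
        have hkQ : ((orb π a).card : ℚ) ≠ 0 := by exact_mod_cast hk0.ne'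
        simp only [c, orbLabel, h0, if_true]
        field_simp
        linear_combination (r.factorial : ℚ) * typeWeight R * hw
      · rw [orbLabel, h0] at hR hL
        rw [labelLen_neg_one] at hL
        have hloop : (numFactorizations κ r (toPerm π (loopSign s a)) : ℚ) =
            r.factorial * typeWeight R * treeWeight (orb π a).card := by
          have hl := typeLen_loop_of_zero h0
          obtain ⟨R', e1, e2⟩ := signedType_loop π s a
          rw [orbLabel, h0, hR, Multiset.cons_inj_right] at e1
          subst e1
          rw [ih (h.loop hl) (by omega), e2, h0, _root_.neg_neg, typeWeight_cons, labelWeight_one]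
          ring
        -- Here both signs descend: the zero part has size i for e and size k − i for −e, with k the
        -- size of the orbit.
        have hsplit : ∀ i ∈ Finset.Ico 1 (orb π a).card, ∑ ε, (numFactorizations κ r
            (toPerm (π * swap a ((π ^ i) a)) (edgeSign s a ((π ^ i) a) ε)) : ℚ) =
            r.factorial * typeWeight R * (zeroWeight i * treeWeight ((orb π a).card - i) +
              zeroWeight ((orb π a).card - i) * treeWeight i) := by
          intro i hi
          have hi' := Finset.mem_Ico.1 hi
          obtain ⟨e, h1, h2⟩ := exists_signedType_split π s a (by rw [orbLabel, h0, hR])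
            hi'.1 hi'.2
          rw [h0] at h1 h2
          rw [_root_.neg_neg] at h2
          have l1 := typeLen_eq_of_signedType h1
          have l2 := typeLen_eq_of_signedType h2
          simp only [Multiset.map_cons, Multiset.sum_cons, labelLen_one, labelLen_neg_one] at l1 l2
          rw [sum_units _ e, hedge a _ (hne i hi) (colour_pow h.1 a i).symm e (by omega),
            hedge a _ (hne i hi) (colour_pow h.1 a i).symm (-e) (by omega), h1, h2]
          simp only [typeWeight_cons, labelWeight_one, labelWeight_neg_one]
          ring
        rw [hloop, Finset.sum_congr rfl hsplit, ← Finset.mul_sum, Finset.sum_add_distrib,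
          sum_Ico_reflect' (fun i j => zeroWeight i * treeWeight j), hR, typeWeight_cons,
          labelWeight_neg_one, ← sum_zeroWeight_mul_treeWeight hk0]
        simp only [c, orbLabel, h0, if_neg hn.symm]
        ring
    have hsum : ∑ a, c (orbLabel π s a) = (r + 1 : ℕ) := by
      rw [sum_orbLabel, ← hr, typeLen]
      push_cast
      rw [Multiset.map_map]
      congr 1
      refine Multiset.map_congr rfl fun l hl => ?_
      have hp := orbLabel_pos hl
      have hq : (l.1 : ℚ) ≠ 0 := by exact_mod_cast hp.ne'
      simp only [c, labelLen, nsmul_eq_mul, Function.comp]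
      split_ifs
      · rw [Nat.cast_sub hp]; field_simp; simp
      · simp
    have h2 := two_mul_numFactorizations_succ h.1 s r
    rw [Finset.sum_congr rfl fun a _ => key a, ← Finset.mul_sum, hsum] at h2
    rw [Nat.factorial_succ]
    push_cast at h2 ⊢
    linear_combination h2 / 2

end Counting

/-! ### The count with two zero cycles -/

section Counting
variable {α : Type*} [Fintype α] [DecidableEq α]

theorem atMostOneZero_of_signedType {π : Perm α} {s : α → ℤˣ} {l : ℕ × ℤˣ}
    {R : Multiset (ℕ × ℤˣ)} (hT : signedType π s = l ::ₘ R) (hR : ∀ x ∈ R, x.2 = 1) :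
    AtMostOneZero (fun _ : α => ()) π s := by
  refine ⟨fun _ => rfl, fun x y _ hx hy => ?_⟩
  by_contra hxy
  have h := signedType_eq_cons_cons s hxy
  rw [hT] at h
  have h1 := congrArg (Multiset.countP fun l => l.2 = -1) h
  have h0 : R.countP (fun l => l.2 = -1) = 0 := Multiset.countP_eq_zero.2 fun l hl he => by
    rw [hR l hl] at he; exact absurd he (by decide)
  rw [Multiset.countP_cons, Multiset.countP_cons, Multiset.countP_cons, h0] at h1
  simp only [orbLabel, hx, hy, if_true] at h1
  split_ifs at h1 <;> omega

/-- The contribution of an element of a zero cycle of size `k` to the number of factorizations,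
if the second zero cycle has size `m`. -/
def zeroContribution (k m : ℕ) : ℚ :=
  zeroWeight k * zeroWeight m + m * treeWeight (k + m) +
    ∑ i ∈ Finset.Ico 1 k, annularWeight i m * treeWeight (k - i)

/-- This is `annularWeight_recursion` as the induction uses it, collected from the p elements of one
zero cycle and the q elements of the other. Symmetry of `annularWeight` lets either cycle come
first. -/
theorem zeroContribution_add {p q : ℕ} (hp : 0 < p) (hq : 0 < q) :
    p * zeroContribution p q + q * zeroContribution q p =
      ((p : ℚ) + q) * (zeroWeight p * zeroWeight q + annularWeight p q) := by
  have h := annularWeight_recursion hp hq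
  have h2 : ∑ i ∈ Finset.Ico 1 q, annularWeight i p * treeWeight (q - i) =
      ∑ j ∈ Finset.Ico 1 q, annularWeight p j * treeWeight (q - j) :=
    Finset.sum_congr rfl fun i hi => by rw [annularWeight_comm hp (Finset.mem_Ico.1 hi).1]
  rw [zeroContribution, zeroContribution, h2, add_comm q p]
  linear_combination -h

/-- The number of factorizations of a signed permutation with two zero cycles. -/
theorem numFactorizations_of_two_zero {π : Perm α} {s : α → ℤˣ} {p q : ℕ}
    {R : Multiset (ℕ × ℤˣ)} (hT : signedType π s = (p, -1) ::ₘ (q, -1) ::ₘ R)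
    (hR : ∀ x ∈ R, x.2 = 1) :
    (numFactorizations (fun _ : α => ()) (typeLen π s) (toPerm π s) : ℚ) =
      (typeLen π s).factorial *
        (typeWeight R * (zeroWeight p * zeroWeight q + annularWeight p q)) := by
  classical
  have hp : 0 < p := orbLabel_pos (l := (p, -1)) (by rw [hT]; simp)
  have hq : 0 < q := orbLabel_pos (l := (q, -1)) (by rw [hT]; simp)
  induction hr : typeLen π s generalizing π s p q R with
  | zero =>
    have := typeLen_eq_of_signedType hT
    simp only [Multiset.map_cons, Multiset.sum_cons, labelLen_neg_one] at this
    omega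
  | succ r ih =>
    have hn : (1 : ℤˣ) ≠ -1 := by decide
    set κ : α → Unit := fun _ => () with hκ
    have hzero : ∀ a b ε, typeLen (π * swap a b) (edgeSign s a b ε) = typeLen π s + 1 →
        (numFactorizations κ r (toPerm (π * swap a b) (edgeSign s a b ε)) : ℚ) = 0 :=
      fun a b ε hl => by rw [numFactorizations_eq_zero κ (by omega), Nat.cast_zero]
    -- After making one zero cycle nonzero or merging the two, at most one zero cycle remains and
    -- the previous count applies.
    have hone : ∀ (π' : Perm α) (s' : α → ℤˣ) l R', signedType π' s' = l ::ₘ R' →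
        (∀ x ∈ R', x.2 = 1) → typeLen π' s' = r → (numFactorizations κ r (toPerm π' s') : ℚ) =
        r.factorial * (labelWeight l * typeWeight R') := by
      intro π' s' l R' h1 h2 h3
      have := numFactorizations_of_atMostOneZero (atMostOneZero_of_signedType h1 h2)
      rwa [h3, h1, typeWeight_cons] at this
    -- Shares as before. For an element of a zero cycle, the size of the other zero cycle is
    -- recovered as `p + q - l.1`.
    let c : ℕ × ℤˣ → ℚ := fun l => if l.2 = 1 then
      ((l.1 : ℚ) - 1) / l.1 * (zeroWeight p * zeroWeight q + annularWeight p q)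
      else zeroContribution l.1 (p + q - l.1)
    have key : ∀ a, (2 * (numFactorizations κ r (toPerm π (loopSign s a)) : ℚ) +
        ∑ i ∈ Finset.Ico 1 (orb π a).card, ∑ ε, (numFactorizations κ r
          (toPerm (π * swap a ((π ^ i) a)) (edgeSign s a ((π ^ i) a) ε)) : ℚ) +
        ∑ b with ¬ π.SameCycle a b ∧ κ a = κ b, ∑ ε, (numFactorizations κ r
          (toPerm (π * swap a b) (edgeSign s a b ε)) : ℚ)) =
        2 * r.factorial * typeWeight R * c (orbLabel π s a) := by
      intro a
      have hk0 := orb_card_pos π a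
      have hmem := orbLabel_mem π s a
      rw [hT, Multiset.mem_cons, Multiset.mem_cons] at hmem
      rcases Int.units_eq_one_or (orbSign π s a) with h0 | h0
      · have hmem' : ((orb π a).card, (1 : ℤˣ)) ∈ R := by
          rw [orbLabel, h0] at hmem
          simpa [hn] using hmem
        obtain ⟨R', rfl⟩ := Multiset.exists_cons_of_mem hmem'
        have hR' : ∀ x ∈ R', x.2 = 1 := fun x hx => hR x (Multiset.mem_cons_of_mem hx)
        have hT' : signedType π s = orbLabel π s a ::ₘ (p, -1) ::ₘ (q, -1) ::ₘ R' := by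
          rw [hT, orbLabel, h0, Multiset.cons_swap (q, -1), Multiset.cons_swap (p, -1)]
        have hL := typeLen_eq_of_signedType hT'
        rw [orbLabel, h0] at hL
        simp only [Multiset.map_cons, Multiset.sum_cons, labelLen_one, labelLen_neg_one] at hL
        have hthird : ∑ b with ¬ π.SameCycle a b ∧ κ a = κ b, ∑ ε, (numFactorizations κ r
            (toPerm (π * swap a b) (edgeSign s a b ε)) : ℚ) = 0 := by
          refine Finset.sum_eq_zero fun b hb => Finset.sum_eq_zero fun ε _ => hzero _ _ _ ?_
          exact typeLen_merge_of_pos s (Finset.mem_filter.1 hb).2.1 ε (.inl h0)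
        have hloop : (numFactorizations κ r (toPerm π (loopSign s a)) : ℚ) = 0 := by
          have := typeLen_loop_of_pos h0
          rw [numFactorizations_eq_zero κ (by omega), Nat.cast_zero]
        have hsplit : ∀ i ∈ Finset.Ico 1 (orb π a).card, ∑ ε, (numFactorizations κ r
            (toPerm (π * swap a ((π ^ i) a)) (edgeSign s a ((π ^ i) a) ε)) : ℚ) =
            r.factorial * (typeWeight R' * (zeroWeight p * zeroWeight q + annularWeight p q)) *
              (treeWeight i * treeWeight ((orb π a).card - i)) := by
          intro i hi
          have hi' := Finset.mem_Ico.1 hi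
          obtain ⟨e, h1, h2⟩ := exists_signedType_split π s a hT' hi'.1 hi'.2
          rw [h0] at h1 h2
          have l1 := typeLen_eq_of_signedType h1
          have l2 := typeLen_eq_of_signedType h2
          simp only [Multiset.map_cons, Multiset.sum_cons, labelLen_one, labelLen_neg_one] at l1 l2
          have h3 : signedType (π * swap a ((π ^ i) a)) (edgeSign s a ((π ^ i) a) e) =
              (p, -1) ::ₘ (q, -1) ::ₘ ((orb π a).card - i, 1) ::ₘ (i, 1) ::ₘ R' := by
            rw [h1, Multiset.cons_swap (i, 1), Multiset.cons_swap (i, 1),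
              Multiset.cons_swap (_, 1), Multiset.cons_swap (_, 1)]
          have h4 : ∀ x ∈ ((orb π a).card - i, (1 : ℤˣ)) ::ₘ (i, 1) ::ₘ R', x.2 = 1 := by
            intro x hx
            rw [Multiset.mem_cons, Multiset.mem_cons] at hx
            rcases hx with rfl | rfl | hx
            exacts [rfl, rfl, hR' x hx]
          rw [sum_units _ e, ih h3 h4 hp hq (by omega), hzero _ _ _ (by omega), typeWeight_cons,
            typeWeight_cons, labelWeight_one, labelWeight_one]
          ring
        rw [hloop, hthird, Finset.sum_congr rfl hsplit, ← Finset.mul_sum, typeWeight_cons,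
          labelWeight_one]
        have hw := sum_treeWeight_mul_treeWeight hk0
        have hkQ : ((orb π a).card : ℚ) ≠ 0 := by exact_mod_cast hk0.ne'
        simp only [c, orbLabel, h0, if_true]
        field_simp
        linear_combination (r.factorial : ℚ) * typeWeight R' *
          (zeroWeight p * zeroWeight q + annularWeight p q) * hw
      · obtain ⟨m, hm, hT'⟩ : ∃ m, (orb π a).card + m = p + q ∧
            signedType π s = orbLabel π s a ::ₘ (m, -1) ::ₘ R := by
          rw [orbLabel, h0] at hmem ⊢
          rcases hmem with h1 | h1 | h1
          · rw [Prod.mk.injEq] at h1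
            exact ⟨q, by rw [h1.1], by rw [h1.1, hT]⟩
          · rw [Prod.mk.injEq] at h1
            exact ⟨p, by rw [h1.1, add_comm], by rw [h1.1, hT, Multiset.cons_swap]⟩
          · exact absurd (hR _ h1).symm hn
        have hm0 : 0 < m := orbLabel_pos (l := (m, -1)) (by rw [hT']; simp)
        have hL := typeLen_eq_of_signedType hT'
        rw [orbLabel, h0] at hL
        simp only [Multiset.map_cons, Multiset.sum_cons, labelLen_neg_one] at hL
        have hloop : (numFactorizations κ r (toPerm π (loopSign s a)) : ℚ) =
            r.factorial * (typeWeight R * (treeWeight (orb π a).card * zeroWeight m)) := by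
          have hl := typeLen_loop_of_zero h0
          obtain ⟨R', e1, e2⟩ := signedType_loop π s a
          rw [hT', Multiset.cons_inj_right] at e1
          subst e1
          rw [h0, _root_.neg_neg, Multiset.cons_swap] at e2
          rw [hone _ _ _ _ e2 ?_ (by omega), typeWeight_cons, labelWeight_one, labelWeight_neg_one]
          · ring
          · intro x hx
            rcases Multiset.mem_cons.1 hx with rfl | hx
            exacts [rfl, hR x hx]
        have hsplit : ∀ i ∈ Finset.Ico 1 (orb π a).card, ∑ ε, (numFactorizations κ r
            (toPerm (π * swap a ((π ^ i) a)) (edgeSign s a ((π ^ i) a) ε)) : ℚ) =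
            r.factorial * typeWeight R * ((zeroWeight i * zeroWeight m + annularWeight i m) *
              treeWeight ((orb π a).card - i) +
              (zeroWeight ((orb π a).card - i) * zeroWeight m +
                annularWeight ((orb π a).card - i) m) * treeWeight i) := by
          intro i hi
          have hi' := Finset.mem_Ico.1 hi
          obtain ⟨e, h1, h2⟩ := exists_signedType_split π s a hT' hi'.1 hi'.2
          rw [h0] at h1 h2
          rw [_root_.neg_neg] at h2
          have l1 := typeLen_eq_of_signedType h1
          have l2 := typeLen_eq_of_signedType h2
          simp only [Multiset.map_cons, Multiset.sum_cons, labelLen_one, labelLen_neg_one] at l1 l2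
          have h4 : ∀ j, ∀ x ∈ ((j, (1 : ℤˣ)) ::ₘ R), x.2 = 1 := by
            intro j x hx
            rcases Multiset.mem_cons.1 hx with rfl | hx
            exacts [rfl, hR x hx]
          rw [Multiset.cons_swap (_, 1), Multiset.cons_swap (_, 1)] at h1
          rw [Multiset.cons_swap (i, 1)] at h2
          rw [sum_units _ e, ih h1 (h4 _) hi'.1 hm0 (by omega),
            ih h2 (h4 _) (by omega) hm0 (by omega)]
          simp only [typeWeight_cons, labelWeight_one]
          ring
        -- The new kind of step: a may be joined to any of the m elements of the other zero cycle,
        -- with either sign, giving a nonzero cycle.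
        have hthird : ∑ b with ¬ π.SameCycle a b ∧ κ a = κ b, ∑ ε, (numFactorizations κ r
            (toPerm (π * swap a b) (edgeSign s a b ε)) : ℚ) =
            m * (2 * (r.factorial * (typeWeight R * treeWeight ((orb π a).card + m)))) := by
          have hval : ∀ b, ¬ π.SameCycle a b → ∑ ε, (numFactorizations κ r
              (toPerm (π * swap a b) (edgeSign s a b ε)) : ℚ) = if orbSign π s b = -1 then
              2 * (r.factorial * (typeWeight R * treeWeight ((orb π a).card + m))) else 0 := by
            intro b hb
            split_ifs with hs
            · have hv : ∀ ε, (numFactorizations κ r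
                  (toPerm (π * swap a b) (edgeSign s a b ε)) : ℚ) =
                  r.factorial * (typeWeight R * treeWeight ((orb π a).card + m)) := by
                intro ε
                have hl := typeLen_merge_of_zero s hb ε h0 hs
                obtain ⟨R', e1, e2⟩ := signedType_merge s hb ε
                rw [hT', Multiset.cons_inj_right, orbLabel, hs] at e1
                have hmb : ((orb π b).card, (-1 : ℤˣ)) ∈ (m, (-1 : ℤˣ)) ::ₘ R := by
                  rw [e1]; exact Multiset.mem_cons_self _ _
                rcases Multiset.mem_cons.1 hmb with h5 | h5
                · rw [h5, Multiset.cons_inj_right] at e1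
                  subst e1
                  rw [Prod.mk.injEq] at h5
                  rw [h5.1, h0, hs, Int.units_mul_self] at e2
                  rw [hone _ _ _ _ e2 hR (by omega), labelWeight_one]
                  ring
                · exact absurd (hR _ h5).symm hn
              rw [sum_units _ 1, hv, hv]; ring
            · refine Finset.sum_eq_zero fun ε _ => hzero _ _ _ ?_
              refine typeLen_merge_of_pos s hb ε (.inr ?_)
              exact (Int.units_eq_one_or _).resolve_right hs
          have hcount : (Finset.univ.filter fun b => ¬ π.SameCycle a b ∧ orbSign π s b = -1).card =
              m := by
            have h1 : ∑ b, (if orbSign π s b = -1 then 1 else 0) =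
                ((signedType π s).map fun l => l.1 • if l.2 = -1 then 1 else 0).sum :=
              sum_orbLabel π s fun l => if l.2 = -1 then 1 else 0
            rw [hT'] at h1
            have h2 : (R.map fun l : ℕ × ℤˣ => l.1 • if l.2 = -1 then 1 else 0).sum = 0 := by
              refine Multiset.sum_eq_zero fun x hx => ?_
              obtain ⟨l, hl, rfl⟩ := Multiset.mem_map.1 hx
              rw [hR l hl, if_neg hn, smul_zero]
            rw [Multiset.map_cons, Multiset.map_cons, Multiset.sum_cons, Multiset.sum_cons, h2,
              orbLabel, h0, if_pos rfl, smul_eq_mul, smul_eq_mul, mul_one, mul_one,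
              add_zero] at h1
            rw [← Finset.sum_filter, ← Finset.card_eq_sum_ones] at h1
            have h3 : Finset.univ.filter (fun b => orbSign π s b = -1) =
                orb π a ∪ Finset.univ.filter fun b => ¬ π.SameCycle a b ∧ orbSign π s b = -1 := by
              ext b
              simp only [Finset.mem_filter, Finset.mem_univ, true_and, Finset.mem_union, mem_orb]
              have : π.SameCycle a b → orbSign π s b = -1 := fun h => orbSign_congr s h ▸ h0
              tauto
            rw [h3, Finset.card_union_of_disjoint] at h1
            · omega
            · rw [Finset.disjoint_left]
              intro b hb hb'
              exact (Finset.mem_filter.1 hb').2.1 (mem_orb.1 hb)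
          rw [Finset.sum_congr rfl fun b hb => hval b (Finset.mem_filter.1 hb).2.1,
            ← Finset.sum_filter, Finset.filter_filter, Finset.sum_const, nsmul_eq_mul]
          congr 2
          rw [← hcount]
          congr 1
          ext b
          simp [κ]
        rw [hloop, hthird, Finset.sum_congr rfl hsplit, ← Finset.mul_sum, Finset.sum_add_distrib,
          sum_Ico_reflect' (fun i j => (zeroWeight i * zeroWeight m + annularWeight i m) *
            treeWeight j)]
        simp only [c, orbLabel, h0, if_neg hn.symm]
        rw [show p + q - (orb π a).card = m by omega, zeroContribution,
          ← sum_zeroWeight_mul_treeWeight hk0]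
        have : ∑ i ∈ Finset.Ico 1 (orb π a).card, (zeroWeight i * zeroWeight m +
            annularWeight i m) * treeWeight ((orb π a).card - i) =
            zeroWeight m * (∑ i ∈ Finset.Ico 1 (orb π a).card, zeroWeight i *
              treeWeight ((orb π a).card - i)) + ∑ i ∈ Finset.Ico 1 (orb π a).card,
              annularWeight i m * treeWeight ((orb π a).card - i) := by
          rw [Finset.mul_sum, ← Finset.sum_add_distrib]
          exact Finset.sum_congr rfl fun i _ => by ring
        rw [this]
        ring
    have hsum : ∑ a, c (orbLabel π s a) =
        (r + 1 : ℕ) * (zeroWeight p * zeroWeight q + annularWeight p q) := by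
      have hL := typeLen_eq_of_signedType hT
      rw [sum_orbLabel, ← hr, hL, hT]
      have h2 : (R.map fun l => l.1 • c l).sum =
          ((R.map labelLen).sum : ℕ) * (zeroWeight p * zeroWeight q + annularWeight p q) := by
        push_cast
        rw [Multiset.map_map, ← Multiset.sum_map_mul_right]
        congr 1
        refine Multiset.map_congr rfl fun l hl => ?_
        have hp : 0 < l.1 := orbLabel_pos (by rw [hT]; simp [hl] : l ∈ signedType π s)
        have hq : (l.1 : ℚ) ≠ 0 := by exact_mod_cast hp.ne'
        simp only [c, labelLen, nsmul_eq_mul, Function.comp, hR l hl, if_true]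
        rw [Nat.cast_sub (show 1 ≤ l.1 from hp), Nat.cast_one]
        field_simp
      simp only [Multiset.map_cons, Multiset.sum_cons, h2, labelLen_neg_one]
      simp only [c, if_neg hn.symm, nsmul_eq_mul, Nat.add_sub_cancel_left, Nat.add_sub_cancel]
      push_cast
      linear_combination zeroContribution_add hp hq
    have h2 := two_mul_numFactorizations_succ (κ := κ) (π := π) (fun _ => rfl) s r
    replace h2 := h2.trans (Finset.sum_congr rfl
      (g := fun a => 2 * r.factorial * typeWeight R * c (orbLabel π s a))
      fun a _ => by rw [← key a]; congr!)
    rw [← Finset.mul_sum, hsum] at h2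
    rw [Nat.factorial_succ]
    push_cast at h2 ⊢
    linear_combination h2 / 2

end Counting

/-! ### Cycles on signed elements, and what lies below a given element -/

section SignedCycles
variable {α : Type*}

theorem toPerm_pow_fst (π : Perm α) (s : α → ℤˣ) (n : ℕ) (x : Signed α) :
    ((toPerm π s ^ n) x).1 = (π ^ n) x.1 := by
  induction n with
  | zero => rfl
  | succ n ih => rw [pow_succ', pow_succ', Perm.mul_apply, Perm.mul_apply, toPerm_apply, ih]

variable [Fintype α]

theorem sameCycle_fst {π : Perm α} {s : α → ℤˣ} {x y : Signed α}
    (h : (toPerm π s).SameCycle x y) : π.SameCycle x.1 y.1 := by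
  obtain ⟨n, -, rfl⟩ := h.exists_pow_eq'
  rw [toPerm_pow_fst]
  simp [Perm.SameCycle.refl]

theorem exists_sameCycle_toPerm {π : Perm α} (s : α → ℤˣ) {a b : α} (h : π.SameCycle a b)
    (e : ℤˣ) : ∃ f, (toPerm π s).SameCycle (a, e) (b, f) := by
  obtain ⟨n, -, rfl⟩ := h.exists_pow_eq'
  refine ⟨((toPerm π s ^ n) (a, e)).2, n, ?_⟩
  rw [zpow_natCast]
  exact Prod.ext (toPerm_pow_fst π s n (a, e)) rfl

variable [DecidableEq α]

/-- One turn around the orbit multiplies all its signs. This ties the orbit sign to whether a cycle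
on signed elements contains its negative. -/
theorem toPerm_pow_card (π : Perm α) (s : α → ℤˣ) (a : α) (e : ℤˣ) :
    (toPerm π s ^ (orb π a).card) (a, e) = (a, e * orbSign π s a) := by
  have h1 : ∀ n, (toPerm π s ^ n) (a, e) =
      ((π ^ n) a, e * ∏ i ∈ Finset.range n, s ((π ^ i) a)) := by
    intro n
    induction n with
    | zero => simp
    | succ n ih =>
      rw [pow_succ', Perm.mul_apply, ih, toPerm_apply, Finset.prod_range_succ, pow_succ' π,
        Perm.mul_apply]
      congr 1
      simp only
      rw [mul_comm (s _), mul_assoc]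
  rw [h1, pow_orb_card]
  congr 2
  refine Finset.prod_bij (fun i _ => (π ^ i) a) ?_ ?_ ?_ ?_
  · intro i _
    exact mem_orb.2 (by simp [Perm.SameCycle.refl])
  · intro i hi j hj h
    rw [Finset.mem_range] at hi hj
    exact pow_injOn π a 0 (by simpa using hi) (by simpa using hj) h
  · intro b hb
    obtain ⟨i, hi, rfl⟩ := exists_pow_eq_of_sameCycle (mem_orb.1 hb)
    exact ⟨i, Finset.mem_range.2 hi, rfl⟩
  · intro _ _; rfl

/-- A power returning to a is a multiple of the orbit size, and such powers keep the sign. -/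
theorem not_sameCycle_neg {π : Perm α} {s : α → ℤˣ} {a : α} (h : orbSign π s a = 1) (e : ℤˣ) :
    ¬ (toPerm π s).SameCycle (a, e) (neg (a, e)) := by
  intro hs
  obtain ⟨n, -, hn⟩ := hs.exists_pow_eq'
  have h1 : (π ^ n) a = (π ^ 0) a := by
    have := toPerm_pow_fst π s n (a, e)
    rw [hn] at this
    exact this.symm
  rw [pow_eq_pow_iff, Nat.modEq_zero_iff_dvd] at h1
  obtain ⟨m, rfl⟩ := h1
  have h2 : (toPerm π s ^ (orb π a).card) (a, e) = (a, e) := by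
    rw [toPerm_pow_card, h, mul_one]
  rw [pow_mul, Perm.pow_apply_eq_self_of_apply_eq_self h2] at hn
  have := congrArg Prod.snd hn
  rcases Int.units_eq_one_or e with rfl | rfl <;> exact absurd this (by simp [neg])

theorem orbSign_eq_neg_one {π : Perm α} {s : α → ℤˣ} {a : α} {e : ℤˣ}
    (h : (toPerm π s).SameCycle (a, e) (neg (a, e))) : orbSign π s a = -1 :=
  (Int.units_eq_one_or _).resolve_left fun h1 => not_sameCycle_neg h1 e h

/-- Going down from `σ` to `σ t` shrinks zero cycles. -/
theorem zero_of_descending {π π' : Perm α} {s s' : α → ℤˣ} {t : Perm (Signed α)}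
    (ht : IsTransposition t) (h : toPerm π s * t = toPerm π' s')
    (hlen : typeLen π' s' + 1 = typeLen π s) {x : α} (hx : orbSign π' s' x = -1) :
    orbSign π s x = -1 ∧ ∀ y, π'.SameCycle x y → π.SameCycle x y := by
  rcases isTransposition_iff.1 ht with ⟨a, rfl⟩ | ⟨a, b, ε, hab, rfl⟩
  · rw [toPerm_mul_loop, toPerm_inj] at h
    obtain ⟨rfl, rfl⟩ := h
    exact ⟨(zero_of_loop_descending hlen hx).1, fun _ => id⟩
  · rw [toPerm_mul_edge, toPerm_inj] at h
    obtain ⟨rfl, rfl⟩ := h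
    obtain ⟨h1, h2⟩ := zero_of_edge_descending hab hlen hx
    exact ⟨h1, fun y hy => ((h2 y).1 hy).1⟩

/-- The zero cycles of `σ` are contained in the zero cycles of every `γ ≥ σ`. -/
theorem zero_of_ascending {π π' : Perm α} {s s' : α → ℤˣ} {l : List (Perm (Signed α))}
    (hl : ∀ t ∈ l, IsTransposition t) (h : toPerm π' s' * l.prod = toPerm π s)
    (hlen : typeLen π' s' + l.length = typeLen π s) {x : α} (hx : orbSign π' s' x = -1) :
    orbSign π s x = -1 ∧ ∀ y, π'.SameCycle x y → π.SameCycle x y := by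
  induction l using List.reverseRecOn generalizing π s with
  | nil =>
    rw [List.prod_nil, mul_one, toPerm_inj] at h
    obtain ⟨rfl, rfl⟩ := h
    exact ⟨hx, fun _ => id⟩
  | append_singleton l t ih =>
    have ht := hl t (by simp)
    have hl' : ∀ t ∈ l, IsTransposition t := fun t ht => hl t (by simp [ht])
    have hls := list_prod_mem_signedPerms fun t ht => (hl' t ht).mem_signedPerms
    obtain ⟨π₁, s₁, h₁⟩ := exists_toPerm_eq
      (mul_mem_signedPerms (toPerm_mem_signedPerms π' s') hls)
    rw [List.prod_append, List.prod_singleton, ← mul_assoc, ← h₁] at h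
    rw [List.length_append, List.length_singleton] at hlen
    -- Together with `hlen` these two bounds are tight, so removing the last factor is a descending
    -- step and induction handles the rest.
    have hle : typeLen π₁ s₁ ≤ typeLen π' s' + l.length := by
      rw [← absLength_toPerm, ← absLength_toPerm, h₁]
      exact (absLength_mul_le (toPerm_mem_signedPerms π' s') hls).trans
        (Nat.add_le_add_left (absLength_prod_le hl') _)
    have hge : typeLen π s ≤ typeLen π₁ s₁ + 1 := by
      rw [← absLength_toPerm, ← absLength_toPerm, ← h]
      refine (absLength_mul_le (toPerm_mem_signedPerms _ _) ht.mem_signedPerms).trans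
        (Nat.add_le_add_left ?_ _)
      simpa using absLength_prod_le (l := [t]) (by simpa using ht)
    obtain ⟨h2, h3⟩ := ih hl' h₁.symm (by omega)
    obtain ⟨h4, h5⟩ := zero_of_descending ht (by rw [← h, mul_assoc, ht.mul_self, mul_one])
      (by omega) h2
    exact ⟨h4, fun y hy => h5 y (h3 y hy)⟩

/-- The transpositions of a reduced factorization fix every fixed point. -/
theorem apply_eq_self_of_mem_reducedFactorizations {γ : Perm (Signed α)}
    {τ : List (Perm (Signed α))} (hγ : γ ∈ signedPerms α) (hτ : τ ∈ reducedFactorizations γ)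
    {a : α} (ha : ∀ e, γ (a, e) = (a, e)) {t : Perm (Signed α)} (ht : t ∈ τ) (e : ℤˣ) :
    t (a, e) = (a, e) := by
  induction τ using List.reverseRecOn generalizing γ t e with
  | nil => simp at ht
  | append_singleton l u ih =>
    obtain ⟨h1, h2, h3⟩ := hτ
    obtain ⟨π, s, rfl⟩ := exists_toPerm_eq hγ
    have hu := h2 u (by simp)
    have hl : ∀ t ∈ l, IsTransposition t := fun t ht => h2 t (by simp [ht])
    rw [List.prod_append, List.prod_singleton] at h3
    have h4 : toPerm π s * u = l.prod := by rw [← h3, mul_assoc, hu.mul_self, mul_one]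
    have hls := list_prod_mem_signedPerms fun t ht => (hl t ht).mem_signedPerms
    obtain ⟨π', s', h'⟩ := exists_toPerm_eq hls
    rw [List.length_append, List.length_singleton, absLength_toPerm] at h1
    have hle : typeLen π' s' ≤ l.length := typeLen_le_length hl h'.symm
    have hπa : π a = a ∧ s a = 1 := by
      have := ha 1
      rw [toPerm_apply, Prod.mk.injEq, mul_one] at this
      exact this
    have horb : ∀ x, π.SameCycle a x → a = x := fun x hx =>
      hx.eq_of_left hπa.1
    have hsign : orbSign π s a = 1 := by
      have : orb π a = {a} := by
        ext x
        rw [mem_orb, Finset.mem_singleton]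
        exact ⟨fun h => (horb x h).symm, by rintro rfl; exact .refl _ _⟩
      rw [orbSign, this, Finset.prod_singleton, hπa.2]
    -- A fixed point is a nonzero cycle of size 1. If the last factor moved it, removing that factor
    -- would change its sign or merge it, and so raise the length.
    have huf : ∀ e, u (a, e) = (a, e) := by
      intro e
      rw [← h'] at h4
      rcases isTransposition_iff.1 hu with ⟨b, rfl⟩ | ⟨b, c, ε, hbc, rfl⟩
      · rw [toPerm_mul_loop, toPerm_inj] at h4
        obtain ⟨rfl, rfl⟩ := h4
        by_cases hab : a = b
        · subst hab
          have := typeLen_loop_of_pos hsign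
          omega
        · rw [loop, toPerm_apply]; simp [hab]
      · rw [toPerm_mul_edge, toPerm_inj] at h4
        obtain ⟨rfl, rfl⟩ := h4
        by_cases hab : a = b
        · subst hab
          have := typeLen_merge_of_pos s (fun h => hbc (horb c h)) ε (.inl hsign)
          omega
        · by_cases hac : a = c
          · subst hac
            have := typeLen_merge_of_pos s (a := b) (b := a)
              (fun h => hbc (horb b h.symm).symm) ε (.inr hsign)
            omega
          · rw [edge, toPerm_apply]; simp [hab, hac, swap_apply_of_ne_of_ne hab hac]
    rcases List.mem_append.1 ht with ht | ht
    · refine ih hls ⟨?_, hl, rfl⟩ (fun e => ?_) ht e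
      · refine le_antisymm ?_ (absLength_prod_le hl)
        have := absLength_mul_le hls hu.mem_signedPerms
        rw [h3, absLength_toPerm] at this
        have hu1 : absLength u ≤ 1 := by
          simpa using absLength_prod_le (l := [u]) (by simpa using hu)
        omega
      · rw [← h4, Perm.mul_apply, huf, ha]
    · rw [List.mem_singleton.1 ht]; exact huf e

omit [Fintype α] in
theorem formPerm_map_apply {β : Type*} [DecidableEq β] {f : α → β} (hf : Function.Injective f)
    (l : List α) (x : α) : (l.map f).formPerm (f x) = f (l.formPerm x) := by
  induction l with
  | nil => rfl
  | cons y l ih =>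
    cases l with
    | nil => rfl
    | cons z l =>
      simp only [List.map_cons, List.formPerm_cons_cons, Perm.mul_apply] at ih ⊢
      rw [ih, hf.swap_apply]

omit [Fintype α] in
theorem nodup_zeroCycle_list {m : List α} (hm : m.Nodup) :
    (m.map (fun a => ((a, 1) : Signed α)) ++
      (m.map fun a => ((a, 1) : Signed α)).map neg).Nodup := by
  have h1 : Function.Injective fun a : α => ((a, 1) : Signed α) := fun a b h => congrArg Prod.fst h
  have h2 : Function.Injective (neg : Signed α → Signed α) := fun a b h => by
    rw [← neg_neg a, h, neg_neg]
  refine List.Nodup.append (hm.map h1) ((hm.map h1).map h2) ?_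
  rw [List.disjoint_left]
  intro x hx hx'
  simp only [List.map_map, List.mem_map, Function.comp] at hx hx'
  obtain ⟨a, -, rfl⟩ := hx
  obtain ⟨b, -, h⟩ := hx'
  simp [neg] at h

omit [Fintype α] in
-- Negation rotates the defining list by half its length, and rotation does not change `formPerm`.
theorem zeroCycle_mem_signedPerms {m : List α} (hm : m.Nodup) :
    zeroCycle (m.map fun a => ((a, 1) : Signed α)) ∈ signedPerms α := by
  intro x
  have h2 : Function.Injective (neg : Signed α → Signed α) := fun a b h => by
    rw [← neg_neg a, h, neg_neg]
  rw [zeroCycle, ← formPerm_map_apply h2, List.map_append, List.map_map (g := neg) (f := neg)]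
  have h3 : (neg ∘ neg : Signed α → Signed α) = id := funext neg_neg
  rw [h3, List.map_id]
  congr 1
  exact List.formPerm_eq_of_isRotated (nodup_zeroCycle_list hm) List.isRotated_append

omit [Fintype α] in
theorem zeroCycle_apply_of_notMem {m : List α} {a : α} (ha : a ∉ m) (e : ℤˣ) :
    zeroCycle (m.map fun a => ((a, 1) : Signed α)) (a, e) = (a, e) := by
  refine List.formPerm_apply_of_notMem fun h => ha ?_
  simp only [List.map_map, List.mem_append, List.mem_map, Function.comp, neg] at h
  rcases h with ⟨b, hb, h⟩ | ⟨b, hb, h⟩ <;>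
  · have h' : b = a := congrArg Prod.fst h
    exact h' ▸ hb

omit [Fintype α] in
theorem zeroCycle_sameCycle {m : List α} (hm : m.Nodup) {a b : α} (ha : a ∈ m) (hb : b ∈ m)
    (e f : ℤˣ) :
    (zeroCycle (m.map fun a => ((a, 1) : Signed α))).SameCycle (a, e) (b, f) := by
  rw [zeroCycle]
  have hmem : ∀ c ∈ m, ∀ g : ℤˣ, ((c, g) : Signed α) ∈ m.map (fun a => ((a, 1) : Signed α)) ++
      (m.map fun a => ((a, 1) : Signed α)).map neg := by
    intro c hc g
    rcases Int.units_eq_one_or g with rfl | rfl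
    · exact List.mem_append_left _ (List.mem_map_of_mem hc)
    · exact List.mem_append_right _ (List.mem_map_of_mem (List.mem_map_of_mem hc))
  have hn := nodup_zeroCycle_list hm
  have key : ∀ L : List (Signed α), L.Nodup → ∀ x ∈ L, ∀ y ∈ L, L.formPerm.SameCycle x y := by
    intro L hL x hx y hy
    obtain ⟨i, hi, rfl⟩ := List.getElem_of_mem hx
    obtain ⟨j, hj, rfl⟩ := List.getElem_of_mem hy
    refine ⟨((j + L.length - i : ℕ) : ℤ), ?_⟩
    rw [zpow_natCast, List.formPerm_pow_apply_getElem L hL]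
    congr 1
    rw [show i + (j + L.length - i) = j + L.length by omega, Nat.add_mod_right, Nat.mod_eq_of_lt hj]
  exact key _ hn _ (hmem a ha e) _ (hmem b hb f)

/-- For nonempty m, its elements form one orbit of sign −1; all others are fixed with sign 1 and
contribute nothing. -/
theorem absLength_zeroCycle {m : List α} (hm : m.Nodup) :
    absLength (zeroCycle (m.map fun a => ((a, 1) : Signed α))) = m.length := by
  rcases List.eq_nil_or_concat m with rfl | ⟨m', a, hma⟩
  · simpa [zeroCycle] using absLength_one (α := α)
  have ha : a ∈ m := by rw [hma]; simp
  clear hma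
  obtain ⟨π, s, h⟩ := exists_toPerm_eq (zeroCycle_mem_signedPerms hm)
  have hmem : ∀ b ∈ m, π.SameCycle a b := fun b hb => by
    have := zeroCycle_sameCycle hm ha hb 1 1
    rw [← h] at this
    exact sameCycle_fst this
  have hfix : ∀ b ∉ m, π b = b ∧ s b = 1 := fun b hb => by
    have := zeroCycle_apply_of_notMem hb 1
    rw [← h, toPerm_apply, Prod.mk.injEq, mul_one] at this
    exact this
  have hsign : orbSign π s a = -1 := by
    have := zeroCycle_sameCycle hm ha ha 1 (-1)
    rw [← h] at this
    exact orbSign_eq_neg_one this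
  have horb : orb π a = m.toFinset := by
    ext b
    rw [mem_orb, List.mem_toFinset]
    refine ⟨fun hb => ?_, hmem b⟩
    by_contra hbm
    have := hb.eq_of_right (hfix b hbm).1
    exact hbm (this ▸ ha)
  rw [← h, absLength_toPerm, typeLen_eq_of_signedType (signedType_eq_cons π s a),
    Multiset.map_cons, Multiset.sum_cons, orbLabel, hsign, labelLen_neg_one, horb,
    List.toFinset_card_of_nodup hm, Nat.add_eq_left]
  refine Multiset.sum_eq_zero fun n hn => ?_
  rw [Multiset.map_map] at hn
  obtain ⟨O, hO, rfl⟩ := Multiset.mem_map.1 hn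
  obtain ⟨hne, hO⟩ := Finset.mem_erase.1 hO
  obtain ⟨b, rfl⟩ := mem_orbs.1 hO
  have hbm : b ∉ m := fun hb => hne (by rw [← orb_eq_iff.2 (hmem b hb), horb])
  have hb : orb π b = {b} := by
    ext x
    rw [mem_orb, Finset.mem_singleton]
    exact ⟨fun h => (h.eq_of_left (hfix b hbm).1).symm, by rintro rfl; exact .refl _ _⟩
  simp [setLabel, hb, (hfix b hbm).2, labelLen]

end SignedCycles

/-! ### Shuffles of lists -/

section Shuffles
variable {β : Type*}

theorem IsShuffle.length_eq {l m r : List β} (h : IsShuffle l m r) :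
    r.length = l.length + m.length := by
  induction h with
  | nil => rfl
  | left a _ ih => rw [List.length_cons, List.length_cons, ih]; omega
  | right a _ ih => rw [List.length_cons, List.length_cons, ih]; omega

theorem IsShuffle.mem_iff {l m r : List β} (h : IsShuffle l m r) (x : β) :
    x ∈ r ↔ x ∈ l ∨ x ∈ m := by
  induction h with
  | nil => simp
  | left a _ ih => rw [List.mem_cons, List.mem_cons, ih, or_assoc]
  | right a _ ih => rw [List.mem_cons, List.mem_cons, ih, or_left_comm]

theorem IsShuffle.prod_eq {G : Type*} [Monoid G] {l m r : List G} (h : IsShuffle l m r)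
    (hc : ∀ x ∈ l, ∀ y ∈ m, x * y = y * x) : r.prod = l.prod * m.prod := by
  induction h with
  | nil => simp
  | left a _ ih =>
    rw [List.prod_cons, List.prod_cons, ih fun x hx => hc x (List.mem_cons_of_mem _ hx), mul_assoc]
  | @right a l m r _ ih =>
    rw [List.prod_cons, List.prod_cons,
      ih fun x hx y hy => hc x hx y (List.mem_cons_of_mem _ hy), ← mul_assoc, ← mul_assoc]
    congr 1
    exact (Commute.list_prod_right l a fun x hx => (hc x hx a List.mem_cons_self).symm).eq

theorem exists_isShuffle {P Q : β → Prop} (r : List β) (h : ∀ x ∈ r, P x ∨ Q x) :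
    ∃ l m, IsShuffle l m r ∧ (∀ x ∈ l, P x) ∧ ∀ x ∈ m, Q x := by
  induction r with
  | nil => exact ⟨[], [], .nil, by simp, by simp⟩
  | cons a r ih =>
    obtain ⟨l, m, h1, h2, h3⟩ := ih fun x hx => h x (List.mem_cons_of_mem _ hx)
    rcases h a List.mem_cons_self with ha | ha
    · exact ⟨a :: l, m, .left a h1, by simpa [ha] using h2, h3⟩
    · exact ⟨l, a :: m, .right a h1, h2, by simpa [ha] using h3⟩

end Shuffles

/-! ### The two circles of the annulus -/

section Annulus
variable {p q : ℕ}

/-- The permutation fixes the elements of one of the two circles. -/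
def FixesSide (b : Bool) (σ : Perm (Signed (Ann p q))) : Prop :=
  ∀ x : Signed (Ann p q), x.1.isLeft = b → σ x = x

theorem FixesSide.list_prod {b : Bool} {l : List (Perm (Signed (Ann p q)))}
    (h : ∀ t ∈ l, FixesSide b t) : FixesSide b l.prod := by
  induction l with
  | nil => exact fun _ _ => rfl
  | cons t l ih =>
    intro x hx
    rw [List.prod_cons, Perm.mul_apply, ih (fun u hu => h u (List.mem_cons_of_mem _ hu)) x hx,
      h t List.mem_cons_self x hx]

theorem FixesSide.isLeft_apply {b : Bool} {σ : Perm (Signed (Ann p q))} (h : FixesSide b σ)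
    {x : Signed (Ann p q)} (hx : x.1.isLeft ≠ b) : (σ x).1.isLeft ≠ b := by
  intro hb
  have := σ.injective (h _ hb)
  rw [this] at hb
  exact hx hb

/-- σ moves only outer elements and τ only inner ones. -/
theorem FixesSide.mul_comm {σ τ : Perm (Signed (Ann p q))} (h1 : FixesSide false σ)
    (h2 : FixesSide true τ) : σ * τ = τ * σ := by
  refine Equiv.ext fun x => ?_
  rw [Perm.mul_apply, Perm.mul_apply]
  by_cases hx : x.1.isLeft = true
  · rw [h2 x hx]
    have := h1.isLeft_apply (x := x) (by simp [hx])
    rw [h2 _ (by simpa using this)]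
  · have hx' : x.1.isLeft = false := by simpa using hx
    rw [h1 x hx']
    have := h2.isLeft_apply hx
    rw [h1 _ (by simpa using this)]

theorem gammaOuter_eq (p q : ℕ) : gammaOuter p q =
    zeroCycle (((List.finRange p).map Sum.inl).map fun a => ((a, 1) : Signed (Ann p q))) := by
  rw [gammaOuter, List.map_map]; rfl

theorem gammaInner_eq (p q : ℕ) : gammaInner p q =
    zeroCycle (((List.finRange q).map Sum.inr).map fun a => ((a, 1) : Signed (Ann p q))) := by
  rw [gammaInner, List.map_map]; rfl

theorem nodup_outer (p q : ℕ) : ((List.finRange p).map (Sum.inl : _ → Ann p q)).Nodup :=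
  (List.nodup_finRange p).map Sum.inl_injective

theorem nodup_inner (p q : ℕ) : ((List.finRange q).map (Sum.inr : _ → Ann p q)).Nodup :=
  (List.nodup_finRange q).map Sum.inr_injective

theorem gammaOuter_mem (p q : ℕ) : gammaOuter p q ∈ signedPerms (Ann p q) := by
  rw [gammaOuter_eq]; exact zeroCycle_mem_signedPerms (nodup_outer p q)

theorem gammaInner_mem (p q : ℕ) : gammaInner p q ∈ signedPerms (Ann p q) := by
  rw [gammaInner_eq]; exact zeroCycle_mem_signedPerms (nodup_inner p q)

theorem gamma_mem (p q : ℕ) : gamma p q ∈ signedPerms (Ann p q) :=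
  mul_mem_signedPerms (gammaOuter_mem p q) (gammaInner_mem p q)

theorem absLength_gammaOuter (p q : ℕ) : absLength (gammaOuter p q) = p := by
  rw [gammaOuter_eq, absLength_zeroCycle (nodup_outer p q), List.length_map, List.length_finRange]

theorem absLength_gammaInner (p q : ℕ) : absLength (gammaInner p q) = q := by
  rw [gammaInner_eq, absLength_zeroCycle (nodup_inner p q), List.length_map, List.length_finRange]

theorem fixesSide_gammaOuter (p q : ℕ) : FixesSide false (gammaOuter p q) := by
  rintro ⟨a, e⟩ hx
  rw [gammaOuter_eq]
  refine zeroCycle_apply_of_notMem (fun h => ?_) e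
  obtain ⟨i, -, rfl⟩ := List.mem_map.1 h
  simp at hx

theorem fixesSide_gammaInner (p q : ℕ) : FixesSide true (gammaInner p q) := by
  rintro ⟨a, e⟩ hx
  rw [gammaInner_eq]
  refine zeroCycle_apply_of_notMem (fun h => ?_) e
  obtain ⟨i, -, rfl⟩ := List.mem_map.1 h
  simp at hx

theorem gamma_apply_outer {x : Signed (Ann p q)} (hx : x.1.isLeft = true) :
    gamma p q x = gammaOuter p q x := by
  rw [gamma, Perm.mul_apply, fixesSide_gammaInner p q x hx]

theorem gamma_apply_inner {x : Signed (Ann p q)} (hx : x.1.isLeft = false) :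
    gamma p q x = gammaInner p q x := by
  rw [gamma, (fixesSide_gammaOuter p q).mul_comm (fixesSide_gammaInner p q), Perm.mul_apply,
    fixesSide_gammaOuter p q x hx]

theorem isLeft_gamma (x : Signed (Ann p q)) : (gamma p q x).1.isLeft = x.1.isLeft := by
  rcases hx : x.1.isLeft with _ | _
  · rw [gamma_apply_inner hx]
    simpa using (fixesSide_gammaInner p q).isLeft_apply (x := x) (by simp [hx])
  · rw [gamma_apply_outer hx]
    simpa using (fixesSide_gammaOuter p q).isLeft_apply (x := x) (by simp [hx])

theorem gamma_sameCycle {x y : Signed (Ann p q)} (h : x.1.isLeft = y.1.isLeft) :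
    (gamma p q).SameCycle x y := by
  have key : ∀ (σ : Perm (Signed (Ann p q))) (b : Bool), x.1.isLeft = b → FixesSide (!b) σ →
      (∀ z : Signed (Ann p q), z.1.isLeft = b → gamma p q z = σ z) → σ.SameCycle x y →
      (gamma p q).SameCycle x y := by
    intro σ b hx hσ hγ hxy
    rw [← mem_orb] at hxy ⊢
    rwa [orb_congr]
    intro z hz
    refine hγ z ?_
    have := mem_of_sameCycle (S := Finset.univ.filter fun z : Signed (Ann p q) => z.1.isLeft = b)
      (fun w hw => by
        have hw' : w.1.isLeft = b := (Finset.mem_filter.1 hw).2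
        have := hσ.isLeft_apply (x := w) (by simp [hw'])
        simpa using this) (by simpa using hx) (mem_orb.1 hz)
    exact (Finset.mem_filter.1 this).2
  obtain ⟨a, e⟩ := x
  obtain ⟨b, f⟩ := y
  rcases a with i | i <;> rcases b with j | j
  · refine key (gammaOuter p q) true rfl (fixesSide_gammaOuter p q)
      (fun z hz => gamma_apply_outer hz) ?_
    rw [gammaOuter_eq]
    exact zeroCycle_sameCycle (nodup_outer p q) (by simp) (by simp) _ _
  · simp at h
  · simp at h
  · refine key (gammaInner p q) false rfl (fixesSide_gammaInner p q)
      (fun z hz => gamma_apply_inner hz) ?_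
    rw [gammaInner_eq]
    exact zeroCycle_sameCycle (nodup_inner p q) (by simp) (by simp) _ _

theorem isLeft_eq_of_sameCycle {π : Perm (Ann p q)} (h : ∀ x, (π x).isLeft = x.isLeft)
    {a b : Ann p q} (hab : π.SameCycle a b) : a.isLeft = b.isLeft := by
  obtain ⟨n, -, rfl⟩ := hab.exists_pow_eq'
  exact (colour_pow (κ := Sum.isLeft) h a n).symm

/-- The structure of `γ_{p,q}`. -/
theorem exists_gamma_eq (p q : ℕ) : ∃ (π : Perm (Ann p q)) (s : Ann p q → ℤˣ),
    toPerm π s = gamma p q ∧ (∀ x, (π x).isLeft = x.isLeft) ∧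
    (∀ a b, π.SameCycle a b ↔ a.isLeft = b.isLeft) ∧ ∀ a, orbSign π s a = -1 := by
  obtain ⟨π, s, h⟩ := exists_toPerm_eq (gamma_mem p q)
  have h1 : ∀ x, (π x).isLeft = x.isLeft := fun x => by
    have := isLeft_gamma (p := p) (q := q) (x, 1)
    rwa [← h, toPerm_apply] at this
  refine ⟨π, s, h, h1, fun a b => ⟨isLeft_eq_of_sameCycle h1, fun hab => ?_⟩, fun a => ?_⟩
  · have := gamma_sameCycle (p := p) (q := q) (x := (a, 1)) (y := (b, 1)) hab
    rw [← h] at this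
    exact sameCycle_fst this
  · refine orbSign_eq_neg_one (e := 1) ?_
    rw [h]
    exact gamma_sameCycle rfl

theorem gamma_signedType (hp : 0 < p) (hq : 0 < q) {π : Perm (Ann p q)} {s : Ann p q → ℤˣ}
    (h1 : ∀ a b, π.SameCycle a b ↔ a.isLeft = b.isLeft) (h2 : ∀ a, orbSign π s a = -1) :
    signedType π s = (p, -1) ::ₘ (q, -1) ::ₘ 0 := by
  let a : Ann p q := Sum.inl ⟨0, hp⟩
  let b : Ann p q := Sum.inr ⟨0, hq⟩
  have hab : ¬ π.SameCycle a b := by rw [h1]; simp [a, b]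
  have ha : orb π a = Finset.univ.map ⟨Sum.inl, Sum.inl_injective⟩ := by
    ext x
    rw [mem_orb, h1]
    rcases x with i | i <;> simp [a]
  have hb : orb π b = Finset.univ.map ⟨Sum.inr, Sum.inr_injective⟩ := by
    ext x
    rw [mem_orb, h1]
    rcases x with i | i <;> simp [b]
  have hE : ((orbs π).erase (orb π a)).erase (orb π b) = ∅ := by
    refine Finset.eq_empty_of_forall_notMem fun O hO => ?_
    obtain ⟨hne, hO⟩ := Finset.mem_erase.1 hO
    obtain ⟨hne', hO⟩ := Finset.mem_erase.1 hO
    obtain ⟨x, rfl⟩ := mem_orbs.1 hO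
    rw [Ne, orb_eq_iff, h1] at hne hne'
    rcases x with i | i
    · exact hne' rfl
    · exact hne rfl
  rw [signedType_eq_cons_cons s hab, hE, orbLabel, orbLabel, h2, h2, ha, hb]
  simp

theorem absLength_gamma (hp : 0 < p) (hq : 0 < q) : absLength (gamma p q) = p + q := by
  obtain ⟨π, s, h, -, h1, h2⟩ := exists_gamma_eq p q
  rw [← h, absLength_toPerm, typeLen_eq_of_signedType (gamma_signedType hp hq h1 h2)]
  simp [labelLen_neg_one]

/-- The minimal factorizations of `γ_{p,q}` into transpositions that preserve the circles. -/
def sideFactorizations (p q : ℕ) : Set (List (Perm (Signed (Ann p q)))) :=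
  {τ ∈ reducedFactorizations (gamma p q) |
    ∀ t ∈ τ, t ∈ colouredTranspositions (Sum.isLeft : Ann p q → Bool)}

/-- Coloured by circles, γ_{p,q} has one zero cycle of each colour, so no merge is available. -/
theorem ncard_sideFactorizations (hp : 0 < p) (hq : 0 < q) :
    (sideFactorizations p q).ncard = (p + q).choose q * p ^ p * q ^ q := by
  obtain ⟨π, s, h, h0, h1, h2⟩ := exists_gamma_eq p q
  have hT := gamma_signedType hp hq h1 h2
  have hL : typeLen π s = p + q := by rw [← absLength_toPerm, h, absLength_gamma hp hq]
  have hset : (sideFactorizations p q).ncard =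
      numFactorizations (Sum.isLeft : Ann p q → Bool) (p + q) (gamma p q) := by
    refine congrArg Set.ncard (Set.ext fun τ => ?_)
    constructor
    · rintro ⟨⟨e1, -, e3⟩, e4⟩
      exact ⟨e1.trans (absLength_gamma hp hq), e4, e3⟩
    · rintro ⟨e1, e2, e3⟩
      exact ⟨⟨e1.trans (absLength_gamma hp hq).symm,
        fun t ht => isTransposition_of_mem_coloured (e2 t ht), e3⟩, e2⟩
  have hmain := numFactorizations_of_atMostOneZero (κ := (Sum.isLeft : Ann p q → Bool)) (π := π)
    (s := s) ⟨h0, fun x y hxy _ _ => (h1 x y).2 hxy⟩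
  rw [hL, h, hT, typeWeight_cons, typeWeight_cons, labelWeight_neg_one, labelWeight_neg_one] at hmain
  have h0 : typeWeight 0 = 1 := rfl
  rw [h0, mul_one, factorial_mul_zeroWeight] at hmain
  rw [hset]
  exact_mod_cast hmain

/-- The constant colouring admits every transposition, and γ_{p,q} consists of two zero cycles. -/
theorem ncard_reducedFactorizations_gamma (hp : 0 < p) (hq : 0 < q) :
    (reducedFactorizations (gamma p q)).ncard = (p + q).choose q * p ^ p * q ^ q +
      ∑ c ∈ Finset.Icc 1 p,
        2 * c * (p + q).choose (p - c) * p ^ (p - c) * q ^ (q + c) := by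
  obtain ⟨π, s, h, h0, h1, h2⟩ := exists_gamma_eq p q
  have hT := gamma_signedType hp hq h1 h2
  have hL : typeLen π s = p + q := by rw [← absLength_toPerm, h, absLength_gamma hp hq]
  have hset : (reducedFactorizations (gamma p q)).ncard =
      numFactorizations (fun _ : Ann p q => ()) (p + q) (gamma p q) := by
    refine congrArg Set.ncard (Set.ext fun τ => ?_)
    constructor
    · rintro ⟨e1, e2, e3⟩
      refine ⟨e1.trans (absLength_gamma hp hq), fun t ht => ?_, e3⟩
      rcases isTransposition_iff.1 (e2 t ht) with ⟨a, rfl⟩ | ⟨a, b, ε, hab, rfl⟩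
      · exact .inl ⟨a, rfl⟩
      · exact .inr ⟨a, b, ε, hab, rfl, rfl⟩
    · rintro ⟨e1, e2, e3⟩
      exact ⟨e1.trans (absLength_gamma hp hq).symm,
        fun t ht => isTransposition_of_mem_coloured (e2 t ht), e3⟩
  have hmain := numFactorizations_of_two_zero hT (by simp)
  have h0 : typeWeight 0 = 1 := rfl
  rw [hL, h, h0, one_mul, mul_add, factorial_mul_zeroWeight, factorial_mul_annularWeight] at hmain
  rw [hset]
  exact_mod_cast hmain

theorem connectivity_eq_zero {π : Perm (Ann p q)} {s : Ann p q → ℤˣ}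
    (h : ∀ x, (π x).isLeft = x.isLeft) : connectivity (toPerm π s) = 0 := by
  refine (congrArg Set.ncard (Set.eq_empty_of_forall_notMem fun c hc => ?_)).trans
    (Set.ncard_empty _)
  obtain ⟨x, -, ⟨i, e, hi⟩, ⟨j, f, hj⟩, -⟩ := hc
  have h1 := isLeft_eq_of_sameCycle h (sameCycle_fst hi)
  have h2 := isLeft_eq_of_sameCycle h (sameCycle_fst hj)
  rw [h1] at h2
  simp at h2

theorem connectivity_ne_zero {π : Perm (Ann p q)} {s : Ann p q → ℤˣ} {a b : Ann p q}
    (hab : π.SameCycle a b) (hne : a.isLeft ≠ b.isLeft) (hs : orbSign π s a = 1) :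
    connectivity (toPerm π s) ≠ 0 := by
  have hfin : (connectedCycles (toPerm π s)).Finite := Set.toFinite _
  have key : ∀ c ∈ connectedCycles (toPerm π s), connectivity (toPerm π s) ≠ 0 :=
    fun c hc => Set.ncard_ne_zero_of_mem hc hfin
  obtain ⟨f, hf⟩ := exists_sameCycle_toPerm s hab 1
  rcases a with i | i <;> rcases b with j | j
  · simp at hne
  · exact key _ ⟨(Sum.inl i, 1), not_sameCycle_neg hs 1, ⟨i, 1, .refl _ _⟩, ⟨j, f, hf⟩, rfl⟩
  · exact key _ ⟨(Sum.inr i, 1), not_sameCycle_neg hs 1, ⟨j, f, hf⟩, ⟨i, 1, .refl _ _⟩, rfl⟩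
  · simp at hne

theorem isLeft_preserved_of_coloured {l : List (Perm (Signed (Ann p q)))}
    (h : ∀ t ∈ l, t ∈ colouredTranspositions (Sum.isLeft : Ann p q → Bool))
    (x : Signed (Ann p q)) : (l.prod x).1.isLeft = x.1.isLeft := by
  induction l generalizing x with
  | nil => rfl
  | cons t l ih =>
    rw [List.prod_cons, Perm.mul_apply]
    refine Eq.trans ?_ (ih (fun u hu => h u (List.mem_cons_of_mem _ hu)) x)
    generalize l.prod x = y
    rcases h t List.mem_cons_self with ⟨a, rfl⟩ | ⟨a, b, ε, hab, hk, rfl⟩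
    · rfl
    · rw [edge, toPerm_apply]
      by_cases h1 : y.1 = a
      · simp only [h1, swap_apply_left]; exact hk.symm
      · by_cases h2 : y.1 = b
        · simp only [h2, swap_apply_right]; exact hk
        · simp only [swap_apply_of_ne_of_ne h1 h2]

theorem disconnected_iff {τ : List (Perm (Signed (Ann p q)))}
    (hτ : τ ∈ reducedFactorizations (gamma p q)) :
    (∀ π ∈ partialProducts τ, connectivity π = 0) ↔ τ ∈ sideFactorizations p q := by
  constructor
  · intro hconn
    refine ⟨hτ, ?_⟩
    have key : ∀ i ≤ τ.length, ∀ t ∈ τ.take i,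
        t ∈ colouredTranspositions (Sum.isLeft : Ann p q → Bool) := by
      intro i
      induction i with
      | zero => simp
      | succ i ih =>
        intro hi
        have hc := ih (by omega)
        rw [List.take_succ_eq_append_getElem hi]
        intro t ht
        rcases List.mem_append.1 ht with ht | ht
        · exact hc t ht
        rw [List.mem_singleton] at ht
        have htr : IsTransposition t := hτ.2.1 t (ht ▸ List.getElem_mem hi)
        rcases isTransposition_iff.1 htr with ⟨a, rfl⟩ | ⟨a, b, ε, hab, rfl⟩
        · exact .inl ⟨a, rfl⟩
        refine .inr ⟨a, b, ε, hab, ?_, rfl⟩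
        by_contra hk
        obtain ⟨π, s, hπ⟩ := exists_toPerm_eq (prod_take_mem_signedPerms hτ.2.1 i)
        have hside : ∀ x, (π x).isLeft = x.isLeft := fun x => by
          have := isLeft_preserved_of_coloured hc (x, 1)
          rwa [← hπ, toPerm_apply] at this
        -- The earlier factors respect the circles, so this first crossing factor merges two orbits.
        have hnot : ¬ π.SameCycle a b := fun h => hk (isLeft_eq_of_sameCycle hside h)
        have hsc := sameCycle_mul_swap hnot
        have hnext : (τ.take (i + 1)).prod = toPerm (π * swap a b) (edgeSign s a b ε) := by
          rw [← toPerm_mul_edge, hπ, List.prod_take_succ _ _ hi, ht]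
        rcases Int.units_eq_one_or (orbSign (π * swap a b) (edgeSign s a b ε) a) with hs | hs
        -- The merged orbit is a nonzero cycle meeting both circles, so the connectivity is
        -- positive.
        · have := hconn _ (prod_take_mem_partialProducts τ (i + 1))
          rw [hnext] at this
          exact connectivity_ne_zero hsc hk hs this
        -- A merged zero cycle would lie in a zero cycle of γ_{p,q}, that is, in a single circle.
        · obtain ⟨πγ, sγ, hγ, -, hγ1, -⟩ := exists_gamma_eq p q
          have := (zero_of_ascending (l := τ.drop (i + 1)) (π := πγ) (s := sγ)
            (fun t ht => hτ.2.1 t (List.mem_of_mem_drop ht))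
            (by rw [hγ, ← hnext, List.prod_take_mul_prod_drop, hτ.2.2])
            (by
              rw [← absLength_toPerm, ← absLength_toPerm, ← hnext, hγ, ← hτ.1,
                (absLength_prod_take hτ le_rfl hi).1, List.length_drop]
              omega) hs).2 b hsc
          exact hk ((hγ1 a b).1 this)
    intro t ht
    exact key τ.length le_rfl t (by rwa [List.take_length])
  · rintro ⟨-, hc⟩ _ ⟨i, -, rfl⟩
    obtain ⟨π, s, hπ⟩ := exists_toPerm_eq (prod_take_mem_signedPerms hτ.2.1 i)
    rw [← hπ]
    refine connectivity_eq_zero fun x => ?_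
    have := isLeft_preserved_of_coloured (l := τ.take i)
      (fun t ht => hc t (List.mem_of_mem_take ht)) (x, 1)
    rwa [← hπ, toPerm_apply] at this

theorem mem_coloured_of_fixesSide {t : Perm (Signed (Ann p q))} (ht : IsTransposition t) {b : Bool}
    (hf : FixesSide b t) : t ∈ colouredTranspositions (Sum.isLeft : Ann p q → Bool) := by
  rcases isTransposition_iff.1 ht with ⟨a, rfl⟩ | ⟨a, c, ε, hac, rfl⟩
  · exact .inl ⟨a, rfl⟩
  · refine .inr ⟨a, c, ε, hac, ?_, rfl⟩
    have h1 : a.isLeft ≠ b := fun h => by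
      have := congrArg Prod.fst (hf (a, 1) h)
      rw [edge, toPerm_apply] at this
      simp only [swap_apply_left] at this
      exact hac this.symm
    have h2 : c.isLeft ≠ b := fun h => by
      have := congrArg Prod.fst (hf (c, 1) h)
      rw [edge, toPerm_apply] at this
      simp only [swap_apply_right] at this
      exact hac this
    rw [Bool.eq_not.2 h1, Bool.eq_not.2 h2]

theorem fixesSide_of_mem_coloured {t : Perm (Signed (Ann p q))}
    (ht : t ∈ colouredTranspositions (Sum.isLeft : Ann p q → Bool)) :
    FixesSide false t ∨ FixesSide true t := by
  have key : ∃ b, FixesSide b t := by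
    rcases ht with ⟨a, rfl⟩ | ⟨a, b, ε, hab, hk, rfl⟩
    · refine ⟨!a.isLeft, fun x hx => ?_⟩
      have hxa : x.1 ≠ a := by
        rintro rfl; exact absurd hx.symm (Bool.not_ne_self _)
      rw [loop, toPerm_apply]; simp [hxa]
    · refine ⟨!a.isLeft, fun x hx => ?_⟩
      have hxa : x.1 ≠ a := by
        rintro rfl; exact absurd hx.symm (Bool.not_ne_self _)
      have hxb : x.1 ≠ b := by
        rintro rfl; exact absurd (hx.trans (congrArg _ hk)).symm (Bool.not_ne_self _)
      rw [edge, toPerm_apply]; simp [hxa, hxb, swap_apply_of_ne_of_ne hxa hxb]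
  obtain ⟨b, hb⟩ := key
  cases b
  exacts [.inl hb, .inr hb]

theorem mem_sideFactorizations_iff (hp : 0 < p) (hq : 0 < q)
    {τ : List (Perm (Signed (Ann p q)))} :
    τ ∈ sideFactorizations p q ↔ ∃ τ₁ ∈ reducedFactorizations (gammaOuter p q),
      ∃ τ₂ ∈ reducedFactorizations (gammaInner p q), IsShuffle τ₁ τ₂ τ := by
  constructor
  · rintro ⟨⟨h1, h2, h3⟩, h4⟩
    obtain ⟨l, m, hs, hl, hm⟩ := exists_isShuffle τ fun t ht => fixesSide_of_mem_coloured (h4 t ht)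
    have hprod := hs.prod_eq fun x hx y hy => (hl x hx).mul_comm (hm y hy)
    have hl' : ∀ t ∈ l, IsTransposition t := fun t ht => h2 t ((hs.mem_iff t).2 (.inl ht))
    have hm' : ∀ t ∈ m, IsTransposition t := fun t ht => h2 t ((hs.mem_iff t).2 (.inr ht))
    have hlp : l.prod = gammaOuter p q := by
      refine Equiv.ext fun x => ?_
      rcases hx : x.1.isLeft with _ | _
      · rw [FixesSide.list_prod hl x hx, fixesSide_gammaOuter p q x hx]
      · rw [← gamma_apply_outer hx, ← h3, hprod, Perm.mul_apply, FixesSide.list_prod hm x hx]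
    have hmp : m.prod = gammaInner p q := by
      rw [h3, hlp, gamma] at hprod
      exact (mul_left_cancel hprod).symm
    -- The two lists have at least p and at least q factors, and p + q together, so both are
    -- reduced.
    have e1 := absLength_prod_le hl'
    have e2 := absLength_prod_le hm'
    rw [hlp, absLength_gammaOuter] at e1
    rw [hmp, absLength_gammaInner] at e2
    have e3 := hs.length_eq
    rw [h1, absLength_gamma hp hq] at e3
    exact ⟨l, ⟨by rw [absLength_gammaOuter]; omega, hl', hlp⟩, m,
      ⟨by rw [absLength_gammaInner]; omega, hm', hmp⟩, hs⟩
  · rintro ⟨l, hl, m, hm, hs⟩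
    -- Factors of a reduced factorization fix whatever the product fixes, so those of γ_p leave the
    -- inner circle alone.
    have hl' : ∀ t ∈ l, FixesSide false t := fun t ht ⟨a, e⟩ hx =>
      apply_eq_self_of_mem_reducedFactorizations (gammaOuter_mem p q) hl
        (fun e => fixesSide_gammaOuter p q (a, e) hx) ht e
    have hm' : ∀ t ∈ m, FixesSide true t := fun t ht ⟨a, e⟩ hx =>
      apply_eq_self_of_mem_reducedFactorizations (gammaInner_mem p q) hm
        (fun e => fixesSide_gammaInner p q (a, e) hx) ht e
    refine ⟨⟨?_, fun t ht => ?_, ?_⟩, fun t ht => ?_⟩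
    · rw [hs.length_eq, hl.1, hm.1, absLength_gammaOuter, absLength_gammaInner,
        absLength_gamma hp hq]
    · rcases (hs.mem_iff t).1 ht with ht | ht
      exacts [hl.2.1 t ht, hm.2.1 t ht]
    · rw [hs.prod_eq fun x hx y hy => (hl' x hx).mul_comm (hm' y hy), hl.2.2, hm.2.2, gamma]
    · rcases (hs.mem_iff t).1 ht with ht | ht
      exacts [mem_coloured_of_fixesSide (hl.2.1 t ht) (hl' t ht),
        mem_coloured_of_fixesSide (hm.2.1 t ht) (hm' t ht)]

theorem disconnectedMaximalChains_eq (p q : ℕ) :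
    disconnectedMaximalChains p q = partialProducts '' sideFactorizations p q := by
  ext C
  rw [disconnectedMaximalChains, maximalChains_eq_image (gamma_mem p q)]
  constructor
  · rintro ⟨⟨τ, hτ, rfl⟩, h⟩
    exact ⟨τ, (disconnected_iff hτ).1 h, rfl⟩
  · rintro ⟨τ, hτ, rfl⟩
    exact ⟨⟨τ, hτ.1, rfl⟩, (disconnected_iff hτ.1).2 hτ⟩

theorem connectedMaximalChains_eq (p q : ℕ) : connectedMaximalChains p q =
    partialProducts '' (reducedFactorizations (gamma p q) \ sideFactorizations p q) := by
  ext C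
  rw [connectedMaximalChains, maximalChains_eq_image (gamma_mem p q)]
  constructor
  · rintro ⟨⟨τ, hτ, rfl⟩, h⟩
    exact ⟨τ, ⟨hτ, fun h' => h ((disconnected_iff hτ).2 h')⟩, rfl⟩
  · rintro ⟨τ, ⟨hτ, hn⟩, rfl⟩
    exact ⟨⟨τ, hτ, rfl⟩, fun h => hn ((disconnected_iff hτ).1 h)⟩

end Annulus

end AnnularB

theorem mainTheorem2 (p q : ℕ) (hp : 0 < p) (hq : 0 < q) :
    (AnnularB.disconnectedMaximalChains p q).ncard = (p + q).choose q * p ^ p * q ^ q ∧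
    AnnularB.disconnectedMaximalChains p q =
      {C | ∃ C₁ ∈ AnnularB.maximalChains (AnnularB.gammaOuter p q),
        ∃ C₂ ∈ AnnularB.maximalChains (AnnularB.gammaInner p q),
        ∃ τ₁ τ₂ τ, AnnularB.IsFactorization C₁ τ₁ ∧ AnnularB.IsFactorization C₂ τ₂ ∧
          AnnularB.IsShuffle τ₁ τ₂ τ ∧ C = AnnularB.partialProducts τ} ∧
    (AnnularB.connectedMaximalChains p q).ncard =
      ∑ c ∈ Finset.Icc 1 p,
        2 * c * (p + q).choose (p - c) * p ^ (p - c) * q ^ (q + c) := by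
  open AnnularB in
  have hsub : sideFactorizations p q ⊆ reducedFactorizations (gamma p q) := fun _ h => h.1
  have hinj := partialProducts_injOn (gamma p q)
  have hfin : (reducedFactorizations (gamma p q)).Finite :=
    (List.finite_length_eq _ (absLength (gamma p q))).subset fun _ h => h.1
  refine ⟨?_, ?_, ?_⟩
  · rw [disconnectedMaximalChains_eq, (hinj.mono hsub).ncard_image,
      ncard_sideFactorizations hp hq]
  · rw [disconnectedMaximalChains_eq]
    ext C
    constructor
    · rintro ⟨τ, hτ, rfl⟩
      obtain ⟨τ₁, h1, τ₂, h2, hs⟩ := (mem_sideFactorizations_iff hp hq).1 hτ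
      exact ⟨_, partialProducts_mem_maximalChains h1, _, partialProducts_mem_maximalChains h2,
        τ₁, τ₂, τ, isFactorization_partialProducts h1, isFactorization_partialProducts h2, hs, rfl⟩
    · rintro ⟨C₁, hC₁, C₂, hC₂, τ₁, τ₂, τ, h1, h2, hs, rfl⟩
      refine ⟨τ, (mem_sideFactorizations_iff hp hq).2 ⟨τ₁, ?_, τ₂, ?_, hs⟩, rfl⟩
      · exact (exists_isFactorization_iff (gammaOuter_mem p q)).1 ⟨C₁, hC₁, h1⟩
      · exact (exists_isFactorization_iff (gammaInner_mem p q)).1 ⟨C₂, hC₂, h2⟩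
  -- Connected chains are counted as all maximal chains minus the disconnected ones.
  · rw [connectedMaximalChains_eq, (hinj.mono Set.sdiff_subset).ncard_image,
      Set.ncard_sdiff hsub (hfin.subset hsub), ncard_reducedFactorizations_gamma hp hq,
      ncard_sideFactorizations hp hq, Nat.add_sub_cancel_left]
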